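/- Fix an integer $k\ge 1$ and put $t=e^{\pi i/(2k+4)}$, $q=t^2$, $[i]=\dfrac{q^i-q^{-i}}{q-q^{-1}}$ and $\delta=-q-q^{-1}$. Let $\mathcal D$ be the strict monoidal category with objects $0,1,2,\dots$ whose morphisms $m\to n$ are the planar diagrams with $m$ dots on the bottom and $n$ dots on the top (each dot joined to exactly one line, lines non-crossing, finitely many closed loops allowed) up to isotopy; composition is vertical stacking, read upwards, and $\otimes$ is horizontal juxtaposition. Let $\cup:0\to 2$ and $\cap:2\to 0$ be the cup and the cap. Let $\mathrm{TL}$ be the additive and idempotent completion of the quotient of the $\mathbb C$-linearization of $\mathcal D$ by the relation that every loop equals $\delta$. In $\mathrm{TL}$ define the Jones–Wenzl idempotents $f_i:i\to i$ for $0\le i\le k+1$ by $f_0=1_0$, $f_1=1_1$ and $$f_i=f_{i-1}\otimes 1_1+\frac{[i-1]}{[i]}\,(f_{i-1}\otimes 1_1)\circ(1_{i-2}\otimes(\cup\circ\cap))\circ(f_{i-1}\otimes 1_1)\qquad(2\le i\le k+1),$$ and let $F_i=(i,f_i)$ be the corresponding objects. Let $\widetilde{\mathrm{TL}}=\mathrm{TL}/(F_{k+1})$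 be the quotient by the tensor ideal of morphisms generated by the identity of $F_{k+1}$. Equip $\widetilde{\mathrm{TL}}$ with the braiding $\sigma$ determined, through naturality and the hexagon axioms, by $\sigma_{1,1}=t\,1_{1\otimes 1}+t^{-1}\,\cup\circ\cap$. For $0\le j\le k+1$ the object $F_j$ is self-dual with evaluation $e_j=\cap^{(j)}\circ(f_j\otimes f_j):F_j\otimes F_j\to\mathbb 1$ and coevaluation $c_j=(f_j\otimes f_j)\circ\cup^{(j)}:\mathbb 1\to F_j\otimes F_j$, where $\cap^{(j)}:2j\to 0$ and $\cup^{(j)}:0\to 2j$ denote $j$ nested caps and $j$ nested cups; the pivotal structure is the identity $F_j\to F_j^{\vee\vee}=F_j$. The left and right twists of $F_j$ are $$\theta^{\ell}_{F_j}=(e_j\otimes 1_{F_j})\circ(1_{F_j}\otimes\sigma_{F_j,F_j})\circ(c_j\otimes 1_{F_j}),\qquad \theta^{r}_{F_j}=(1_{F_j}\otimes e_j)\circ(\sigma_{F_j,F_j}\otimes 1_{F_j})\circ(1_{F_j}\otimes c_j).$$ Then for every $0\le j\le k+1$, in $\widetilde{\mathrm{TL}}$, $$\theta^{\ell}_{F_j}=\theta^{r}_{F_j}=(-1)^j\,t^{\,j^2+2j}\,1_{F_j}.$$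 -/

import Mathlib

open CategoryTheory MonoidalCategory

namespace TLJ

noncomputable section

section Linearization
universe v u

/-- The bilinear extension of a binary operation on basis elements. -/
def bilin {A B D : Type*} (op : A → B → D) : (A →₀ ℂ) →ₗ[ℂ] (B →₀ ℂ) →ₗ[ℂ] (D →₀ ℂ) :=
  Finsupp.lsum ℂ fun a => LinearMap.toSpanSingleton ℂ _ (Finsupp.lmapDomain ℂ ℂ (op a))

theorem bilin_single {A B D : Type*} (op : A → B → D) (a : A) (b : B) (r s : ℂ) :
    bilin op (Finsupp.single a r) (Finsupp.single b s) = Finsupp.single (op a b) (r * s) := by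
  simp [bilin, Finsupp.mapDomain_single]

theorem bilin_assoc {A B D E F G : Type*} (op₁ : A → B → E) (op₂ : E → D → G) (op₃ : B → D → F)
    (op₄ : A → F → G) (H : ∀ a b d, op₂ (op₁ a b) d = op₄ a (op₃ b d))
    (f : A →₀ ℂ) (g : B →₀ ℂ) (h : D →₀ ℂ) :
    bilin op₂ (bilin op₁ f g) h = bilin op₄ f (bilin op₃ g h) := by
  induction f using Finsupp.induction_linear with
  | zero => simp
  | add f f' e e' => simp [e, e']
  | single a r =>
    induction g using Finsupp.induction_linear with
    | zero => simp
    | add f f' e e' => simp [e, e']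
    | single b s =>
      induction h using Finsupp.induction_linear with
      | zero => simp
      | add f f' e e' => simp [e, e']
      | single d t => simp only [bilin_single, H, mul_assoc]

theorem bilin_interchange {A B A' B' E F E' F' G : Type*} (c₁ : A → B → E) (c₂ : A' → B' → F)
    (t₁ : A → A' → E') (t₂ : B → B' → F') (t₃ : E → F → G) (c₃ : E' → F' → G)
    (H : ∀ a a' b b', c₃ (t₁ a a') (t₂ b b') = t₃ (c₁ a b) (c₂ a' b'))
    (f : A →₀ ℂ) (f' : A' →₀ ℂ) (g : B →₀ ℂ) (g' : B' →₀ ℂ) :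
    bilin c₃ (bilin t₁ f f') (bilin t₂ g g') = bilin t₃ (bilin c₁ f g) (bilin c₂ f' g') := by
  induction f using Finsupp.induction_linear with
  | zero => simp
  | add f f' e e' => simp [e, e']
  | single a r =>
    induction f' using Finsupp.induction_linear with
    | zero => simp
    | add f f' e e' => simp [e, e']
    | single b s =>
      induction g using Finsupp.induction_linear with
      | zero => simp
      | add f f' e e' => simp [e, e']
      | single d t =>
        induction g' using Finsupp.induction_linear with
        | zero => simp
        | add f f' e e' => simp [e, e']
        | single d t => simp only [bilin_single, H]; congr 1; ring

theorem bilin_unit_left {A B D : Type*} (op : A → B → D) (a : A) (φ : B → D)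
    (H : ∀ b, op a b = φ b) (g : B →₀ ℂ) :
    bilin op (Finsupp.single a 1) g = Finsupp.mapDomain φ g := by
  have : op a = φ := funext H
  simp [bilin, this]

theorem bilin_unit_right {A B D : Type*} (op : A → B → D) (b : B) (φ : A → D)
    (H : ∀ a, op a b = φ a) (f : A →₀ ℂ) :
    bilin op f (Finsupp.single b 1) = Finsupp.mapDomain φ f := by
  induction f using Finsupp.induction_linear with
  | zero => simp
  | add f f' e e' => simp [e, e', Finsupp.mapDomain_add]
  | single a r => rw [bilin_single, Finsupp.mapDomain_single, H, mul_one]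

/-- The `ℂ`-linearization of a category: the same objects, and morphism spaces with basis the
original morphisms. -/
structure Linearization (C : Type u) where
  /-- the underlying object -/
  base : C

namespace Linearization
variable {C : Type u} [Category.{v} C]

instance : Category (Linearization C) where
  Hom X Y := (X.base ⟶ Y.base) →₀ ℂ
  id X := Finsupp.single (𝟙 X.base) 1
  comp f g := bilin (fun a b => a ≫ b) f g
  id_comp f := (bilin_unit_left _ _ id (fun b => Category.id_comp b) f).trans Finsupp.mapDomain_id
  comp_id f := (bilin_unit_right _ _ id (fun b => Category.comp_id b) f).trans Finsupp.mapDomain_id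
  assoc f g h := bilin_assoc _ _ _ _ (fun a b c => Category.assoc a b c) f g h

/-- The basis morphism given by a morphism of the original category. -/
def ι {X Y : C} (f : X ⟶ Y) : (⟨X⟩ : Linearization C) ⟶ ⟨Y⟩ := Finsupp.single f 1

theorem ι_comp {X Y Z : C} (f : X ⟶ Y) (g : Y ⟶ Z) : ι (f ≫ g) = ι f ≫ ι g :=
  ((bilin_single _ f g 1 1).trans (by rw [one_mul]; rfl)).symm

theorem ι_id (X : C) : ι (𝟙 X) = 𝟙 (⟨X⟩ : Linearization C) := rfl

instance : Preadditive (Linearization C) where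
  homGroup X Y := inferInstanceAs (AddCommGroup ((X.base ⟶ Y.base) →₀ ℂ))
  add_comp X Y Z f f' g := LinearMap.map_add₂ (bilin fun a b => a ≫ b) f f' g
  comp_add X Y Z f g g' :=
    (bilin (fun (a : X.base ⟶ Y.base) (b : Y.base ⟶ Z.base) => a ≫ b) f).map_add' g g'

instance : Linear ℂ (Linearization C) where
  homModule X Y := inferInstanceAs (Module ℂ ((X.base ⟶ Y.base) →₀ ℂ))
  smul_comp X Y Z r f g := LinearMap.map_smul₂ (bilin fun a b => a ≫ b) r f g
  comp_smul X Y Z f r g :=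
    (bilin (fun (a : X.base ⟶ Y.base) (b : Y.base ⟶ Z.base) => a ≫ b) f).map_smul' r g

variable [MonoidalCategory C]

/-- An isomorphism of the original category as an isomorphism of the linearization. -/
def ιIso {X Y : C} (e : X ≅ Y) : (⟨X⟩ : Linearization C) ≅ ⟨Y⟩ where
  hom := ι e.hom
  inv := ι e.inv
  hom_inv_id := by rw [← ι_comp, e.hom_inv_id, ι_id]
  inv_hom_id := by rw [← ι_comp, e.inv_hom_id, ι_id]

instance : MonoidalCategoryStruct (Linearization C) where
  tensorObj X Y := ⟨X.base ⊗ Y.base⟩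
  tensorHom f g := bilin (fun a b => a ⊗ₘ b) f g
  whiskerLeft X _ _ f := bilin (fun a b => a ⊗ₘ b) (Finsupp.single (𝟙 X.base) 1) f
  whiskerRight f X := bilin (fun a b => a ⊗ₘ b) f (Finsupp.single (𝟙 X.base) 1)
  tensorUnit := ⟨𝟙_ C⟩
  associator X Y Z := ιIso (α_ X.base Y.base Z.base)
  leftUnitor X := ιIso (λ_ X.base)
  rightUnitor X := ιIso (ρ_ X.base)

theorem ι_tensor {X Y X' Y' : C} (f : X ⟶ Y) (g : X' ⟶ Y') : ι (f ⊗ₘ g) = ι f ⊗ₘ ι g :=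
  ((bilin_single _ f g 1 1).trans (by rw [one_mul]; rfl)).symm

theorem ι_wl (Z : C) {X Y : C} (f : X ⟶ Y) : ι (Z ◁ f) = (⟨Z⟩ : Linearization C) ◁ ι f := by
  rw [← id_tensorHom, ι_tensor]; rfl

theorem ι_wr (Z : C) {X Y : C} (f : X ⟶ Y) : ι (f ▷ Z) = ι f ▷ (⟨Z⟩ : Linearization C) := by
  rw [← tensorHom_id, ι_tensor]; rfl

instance : MonoidalCategory (Linearization C) := MonoidalCategory.ofTensorHom
  (id_tensorHom_id := fun X Y => by rw [← ι_id, ← ι_id, ← ι_tensor, id_tensorHom_id]; rfl)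
  (id_tensorHom := fun _ _ _ _ => rfl)
  (tensorHom_id := fun _ _ => rfl)
  (tensorHom_comp_tensorHom := fun f₁ f₂ g₁ g₂ =>
    bilin_interchange _ _ _ _ _ _ (fun a a' b b' => tensorHom_comp_tensorHom a a' b b') f₁ f₂ g₁ g₂)
  (associator_naturality := fun {X₁ X₂ X₃ Y₁ Y₂ Y₃} f₁ f₂ f₃ => by
    change bilin (fun a b => a ≫ b) (bilin (fun a b => a ⊗ₘ b) (bilin (fun a b => a ⊗ₘ b) f₁ f₂) f₃)
      (Finsupp.single (α_ Y₁.base Y₂.base Y₃.base).hom 1) =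
      bilin (fun a b => a ≫ b) (Finsupp.single (α_ X₁.base X₂.base X₃.base).hom 1)
        (bilin (fun a b => a ⊗ₘ b) f₁ (bilin (fun a b => a ⊗ₘ b) f₂ f₃))
    induction f₁ using Finsupp.induction_linear with
    | zero => simp
    | add f f' e e' => simp [e, e']
    | single a r =>
      induction f₂ using Finsupp.induction_linear with
      | zero => simp
      | add f f' e e' => simp [e, e']
      | single b s =>
        induction f₃ using Finsupp.induction_linear with
        | zero => simp
        | add f f' e e' => simp [e, e']
        | single d t =>
          simp only [bilin_single, MonoidalCategory.associator_naturality, mul_one, one_mul,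
            mul_assoc])
  (leftUnitor_naturality := fun {X Y} f => by
    change bilin (fun a b => a ≫ b) (bilin (fun a b => a ⊗ₘ b) (Finsupp.single (𝟙 _) 1) f)
      (Finsupp.single (λ_ Y.base).hom 1) = bilin (fun a b => a ≫ b)
        (Finsupp.single (λ_ X.base).hom 1) f
    induction f using Finsupp.induction_linear with
    | zero => simp
    | add f f' e e' => simp [e, e']
    | single a r =>
      simp only [bilin_single, id_tensorHom, MonoidalCategory.leftUnitor_naturality, mul_one,
        one_mul])
  (rightUnitor_naturality := fun {X Y} f => by
    change bilin (fun a b => a ≫ b) (bilin (fun a b => a ⊗ₘ b) f (Finsupp.single (𝟙 _) 1))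
      (Finsupp.single (ρ_ Y.base).hom 1) = bilin (fun a b => a ≫ b)
        (Finsupp.single (ρ_ X.base).hom 1) f
    induction f using Finsupp.induction_linear with
    | zero => simp
    | add f f' e e' => simp [e, e']
    | single a r =>
      simp only [bilin_single, tensorHom_id, MonoidalCategory.rightUnitor_naturality, mul_one,
        one_mul])
  (pentagon := fun W X Y Z => by
    have h := congrArg ι (pentagon W.base X.base Y.base Z.base)
    simp only [ι_comp, ι_wl, ι_wr] at h
    exact h)
  (triangle := fun X Y => by
    have h := congrArg ι (triangle X.base Y.base)
    simp only [ι_comp, ι_wl, ι_wr] at h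
    exact h)

instance : MonoidalPreadditive (Linearization C) where
  whiskerLeft_zero {X Y Z} := map_zero (bilin (fun a b => a ⊗ₘ b) (Finsupp.single (𝟙 X.base) 1))
  zero_whiskerRight {X Y Z} := LinearMap.map_zero₂ (bilin (fun a b => a ⊗ₘ b)) _
  whiskerLeft_add {X Y Z} f g :=
    map_add (bilin (fun a b => a ⊗ₘ b) (Finsupp.single (𝟙 X.base) 1)) f g
  add_whiskerRight {X Y Z} f g := LinearMap.map_add₂ (bilin (fun a b => a ⊗ₘ b)) f g _

instance : MonoidalLinear ℂ (Linearization C) where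
  whiskerLeft_smul X _ _ c f :=
    map_smul (bilin (fun a b => a ⊗ₘ b) (Finsupp.single (𝟙 X.base) 1)) c f
  smul_whiskerRight c _ _ f X := LinearMap.map_smul₂ (bilin (fun a b => a ⊗ₘ b)) c f _

/-- Every morphism of the linearization is a linear combination of basis morphisms. -/
theorem hom_induction {X Y : C} {P : ((⟨X⟩ : Linearization C) ⟶ ⟨Y⟩) → Prop}
    (f : (⟨X⟩ : Linearization C) ⟶ ⟨Y⟩) (h0 : P 0) (ha : ∀ f g, P f → P g → P (f + g))
    (hs : ∀ (r : ℂ) (f : X ⟶ Y), P (r • ι f)) : P f :=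
  Finsupp.induction_linear (motive := P) f h0 ha (fun a r => by
    have : (Finsupp.single a r : (X ⟶ Y) →₀ ℂ) = r • Finsupp.single a (1 : ℂ) := by simp
    rw [this]; exact hs r a)

end Linearization
end Linearization

section TensorQuotient
universe v u
variable {C : Type u} [Category.{v} C] [Preadditive C] [Linear ℂ C] [MonoidalCategory C]

/-- The tensor ideal of a `ℂ`-linear monoidal category generated by one morphism `g`: the smallest
family of linear subspaces of the morphism spaces that contains `g` and is stable under
composition and under tensoring with objects (hence with arbitrary morphisms) on both sides. -/
inductive TensorIdeal {A B : C} (g : A ⟶ B) : ∀ {X Y : C}, (X ⟶ Y) → Prop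
  | of : TensorIdeal g g
  | zero (X Y : C) : TensorIdeal g (0 : X ⟶ Y)
  | add {X Y : C} {f h : X ⟶ Y} : TensorIdeal g f → TensorIdeal g h → TensorIdeal g (f + h)
  | smul {X Y : C} (c : ℂ) {f : X ⟶ Y} : TensorIdeal g f → TensorIdeal g (c • f)
  | comp_left {X Y Z : C} (h : X ⟶ Y) {f : Y ⟶ Z} : TensorIdeal g f → TensorIdeal g (h ≫ f)
  | comp_right {X Y Z : C} {f : X ⟶ Y} (h : Y ⟶ Z) : TensorIdeal g f → TensorIdeal g (f ≫ h)
  | whisker_left (Z : C) {X Y : C} {f : X ⟶ Y} : TensorIdeal g f → TensorIdeal g (Z ◁ f)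
  | whisker_right {X Y : C} {f : X ⟶ Y} (Z : C) : TensorIdeal g f → TensorIdeal g (f ▷ Z)

/-- Congruence of morphisms modulo the tensor ideal generated by `g`. -/
def idealRel {A B : C} (g : A ⟶ B) : HomRel C := fun _ _ f h => TensorIdeal g (f - h)

variable {A B : C} (g : A ⟶ B)

theorem TensorIdeal.neg {X Y : C} {f : X ⟶ Y} (hf : TensorIdeal g f) : TensorIdeal g (-f) := by
  have h := TensorIdeal.smul (-1) hf
  rwa [neg_one_smul] at h

instance : Congruence (idealRel g) where
  equivalence :=
    { refl := fun f => by
        change TensorIdeal g (f - f); rw [sub_self]; exact .zero _ _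
      symm := fun {f h} hfh => by
        change TensorIdeal g (h - f); rw [← neg_sub]; exact TensorIdeal.neg g hfh
      trans := fun {a b c} h1 h2 => by
        change TensorIdeal g (a - c); rw [← sub_add_sub_cancel a b c]; exact .add h1 h2 }
  comp_left f _ _ h := by
    change TensorIdeal g _; rw [← Preadditive.comp_sub]; exact .comp_left f h
  comp_right f h := by
    change TensorIdeal g _; rw [← Preadditive.sub_comp]; exact .comp_right f h

/-- The quotient of a `ℂ`-linear monoidal category by the tensor ideal generated by `g`. -/
abbrev TensorQuotient : Type u := Quotient (idealRel g)

theorem idealRel_add ⦃X Y : C⦄ (f₁ f₂ g₁ g₂ : X ⟶ Y) (hf : idealRel g f₁ f₂)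
    (hg : idealRel g g₁ g₂) : idealRel g (f₁ + g₁) (f₂ + g₂) := by
  change TensorIdeal g _; rw [add_sub_add_comm]; exact .add hf hg

theorem idealRel_smul (a : ℂ) ⦃X Y : C⦄ (f₁ f₂ : X ⟶ Y) (hf : idealRel g f₁ f₂) :
    idealRel g (a • f₁) (a • f₂) := by
  change TensorIdeal g _; rw [← smul_sub]; exact .smul a hf

instance : Preadditive (TensorQuotient g) := Quotient.preadditive _ (idealRel_add g)

instance : (Quotient.functor (idealRel g)).Additive :=
  Quotient.functor_additive _ (idealRel_add g)

instance : Linear ℂ (TensorQuotient g) := Quotient.linear ℂ _ (idealRel_smul g)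

variable [MonoidalPreadditive C] [MonoidalLinear ℂ C]

theorem sub_wr {X Y : C} (f h : X ⟶ Y) (Z : C) : f ▷ Z - h ▷ Z = (f - h) ▷ Z := by
  rw [eq_comm, eq_sub_iff_add_eq, ← MonoidalPreadditive.add_whiskerRight, sub_add_cancel]

theorem wl_sub {X Y : C} (f h : X ⟶ Y) (Z : C) : Z ◁ f - Z ◁ h = Z ◁ (f - h) := by
  rw [eq_comm, eq_sub_iff_add_eq, ← MonoidalPreadditive.whiskerLeft_add, sub_add_cancel]

theorem idealRel_wl (Z : C) {X Y : C} {f h : X ⟶ Y} (H : idealRel g f h) :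
    idealRel g (Z ◁ f) (Z ◁ h) := by
  change TensorIdeal g _; rw [wl_sub]; exact .whisker_left Z H

theorem idealRel_wr {X Y : C} {f h : X ⟶ Y} (H : idealRel g f h) (Z : C) :
    idealRel g (f ▷ Z) (h ▷ Z) := by
  change TensorIdeal g _; rw [sub_wr]; exact .whisker_right Z H

/-- The functor to the quotient. -/
abbrev toQuot : C ⥤ TensorQuotient g := Quotient.functor (idealRel g)

theorem toQuot_eq {X Y : C} {f h : X ⟶ Y} (H : idealRel g f h) :
    (toQuot g).map f = (toQuot g).map h := CategoryTheory.Quotient.sound _ H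

theorem toQuot_surj {X Y : TensorQuotient g} (f : X ⟶ Y) :
    ∃ f' : X.as ⟶ Y.as, (toQuot g).map f' = f := (toQuot g).map_surjective f

instance : MonoidalCategoryStruct (TensorQuotient g) where
  tensorObj X Y := ⟨X.as ⊗ Y.as⟩
  whiskerLeft X _ _ f := Quot.liftOn f (fun f => (toQuot g).map (X.as ◁ f)) (fun _ _ h => by
    rw [HomRel.compClosure_iff_self] at h
    exact toQuot_eq g (idealRel_wl g _ h))
  whiskerRight f Y := Quot.liftOn f (fun f => (toQuot g).map (f ▷ Y.as)) (fun _ _ h => by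
    rw [HomRel.compClosure_iff_self] at h
    exact toQuot_eq g (idealRel_wr g h _))
  tensorUnit := ⟨𝟙_ C⟩
  associator X Y Z := (toQuot g).mapIso (α_ X.as Y.as Z.as)
  leftUnitor X := (toQuot g).mapIso (λ_ X.as)
  rightUnitor X := (toQuot g).mapIso (ρ_ X.as)

theorem toQuot_wl (Z : C) {X Y : C} (f : X ⟶ Y) :
    (toQuot g).obj Z ◁ (toQuot g).map f = (toQuot g).map (Z ◁ f) := rfl

theorem toQuot_wr {X Y : C} (f : X ⟶ Y) (Z : C) :
    (toQuot g).map f ▷ (toQuot g).obj Z = (toQuot g).map (f ▷ Z) := rfl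

theorem toQuot_tensor {X Y X' Y' : C} (f : X ⟶ Y) (f' : X' ⟶ Y') :
    (toQuot g).map f ⊗ₘ (toQuot g).map f' = (toQuot g).map (f ⊗ₘ f') := by
  rw [MonoidalCategory.tensorHom_def f f', Functor.map_comp]; rfl

instance : MonoidalCategory (TensorQuotient g) where
  tensorHom_def _ _ := rfl
  id_tensorHom_id := by
    rintro ⟨X⟩ ⟨Y⟩
    exact (toQuot_tensor g (𝟙 X) (𝟙 Y)).trans (congrArg (toQuot g).map (id_tensorHom_id X Y))
  tensorHom_comp_tensorHom := by
    rintro ⟨X₁⟩ ⟨Y₁⟩ ⟨Z₁⟩ ⟨X₂⟩ ⟨Y₂⟩ ⟨Z₂⟩ ⟨f₁⟩ ⟨f₂⟩ ⟨g₁⟩ ⟨g₂⟩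
    have h := congrArg (toQuot g).map (tensorHom_comp_tensorHom f₁ f₂ g₁ g₂)
    rw [Functor.map_comp, ← toQuot_tensor, ← toQuot_tensor, ← toQuot_tensor] at h
    exact h
  whiskerLeft_id := by
    rintro ⟨X⟩ ⟨Y⟩
    exact congrArg (toQuot g).map (whiskerLeft_id X Y)
  id_whiskerRight := by
    rintro ⟨X⟩ ⟨Y⟩
    exact congrArg (toQuot g).map (id_whiskerRight X Y)
  associator_naturality := by
    rintro ⟨X₁⟩ ⟨X₂⟩ ⟨X₃⟩ ⟨Y₁⟩ ⟨Y₂⟩ ⟨Y₃⟩ ⟨f₁⟩ ⟨f₂⟩ ⟨f₃⟩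
    have h := congrArg (toQuot g).map (associator_naturality f₁ f₂ f₃)
    rw [Functor.map_comp, Functor.map_comp, ← toQuot_tensor, ← toQuot_tensor, ← toQuot_tensor,
      ← toQuot_tensor] at h
    exact h
  leftUnitor_naturality := by
    rintro ⟨X⟩ ⟨Y⟩ ⟨f⟩
    exact congrArg (toQuot g).map (leftUnitor_naturality f)
  rightUnitor_naturality := by
    rintro ⟨X⟩ ⟨Y⟩ ⟨f⟩
    exact congrArg (toQuot g).map (rightUnitor_naturality f)
  pentagon := by
    rintro ⟨W⟩ ⟨X⟩ ⟨Y⟩ ⟨Z⟩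
    exact congrArg (toQuot g).map (pentagon W X Y Z)
  triangle := by
    rintro ⟨X⟩ ⟨Y⟩
    exact congrArg (toQuot g).map (triangle X Y)

instance : MonoidalPreadditive (TensorQuotient g) where
  whiskerLeft_zero := by
    rintro ⟨X⟩ ⟨Y⟩ ⟨Z⟩
    exact congrArg (toQuot g).map (MonoidalPreadditive.whiskerLeft_zero (X := X) (Y := Y) (Z := Z))
  zero_whiskerRight := by
    rintro ⟨X⟩ ⟨Y⟩ ⟨Z⟩
    exact congrArg (toQuot g).map (MonoidalPreadditive.zero_whiskerRight (X := X) (Y := Y) (Z := Z))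
  whiskerLeft_add := by
    rintro ⟨X⟩ ⟨Y⟩ ⟨Z⟩ ⟨f⟩ ⟨h⟩
    exact congrArg (toQuot g).map (MonoidalPreadditive.whiskerLeft_add (X := X) f h)
  add_whiskerRight := by
    rintro ⟨X⟩ ⟨Y⟩ ⟨Z⟩ ⟨f⟩ ⟨h⟩
    exact congrArg (toQuot g).map (MonoidalPreadditive.add_whiskerRight (X := X) f h)

instance : MonoidalLinear ℂ (TensorQuotient g) where
  whiskerLeft_smul := by
    rintro ⟨X⟩ ⟨Y⟩ ⟨Z⟩ c ⟨f⟩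
    exact congrArg (toQuot g).map (MonoidalLinear.whiskerLeft_smul X c f)
  smul_whiskerRight := by
    rintro c ⟨Y⟩ ⟨Z⟩ ⟨f⟩ ⟨X⟩
    exact congrArg (toQuot g).map (MonoidalLinear.smul_whiskerRight c f X)

instance [BraidedCategory C] : BraidedCategory (TensorQuotient g) where
  braiding X Y := (toQuot g).mapIso (β_ X.as Y.as)
  braiding_naturality_right := by
    rintro ⟨X⟩ ⟨Y⟩ ⟨Z⟩ ⟨f⟩
    exact congrArg (toQuot g).map (BraidedCategory.braiding_naturality_right X f)
  braiding_naturality_left := by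
    rintro ⟨X⟩ ⟨Y⟩ ⟨f⟩ ⟨Z⟩
    exact congrArg (toQuot g).map (BraidedCategory.braiding_naturality_left f Z)
  hexagon_forward := by
    rintro ⟨X⟩ ⟨Y⟩ ⟨Z⟩
    exact congrArg (toQuot g).map (BraidedCategory.hexagon_forward X Y Z)
  hexagon_reverse := by
    rintro ⟨X⟩ ⟨Y⟩ ⟨Z⟩
    exact congrArg (toQuot g).map (BraidedCategory.hexagon_reverse X Y Z)

end TensorQuotient

section AdditiveCompletion
universe v u
variable {C : Type u} [Category.{v} C] [Preadditive C]

instance [Linear ℂ C] : Linear ℂ (Mat_ C) where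
  homModule M N := inferInstanceAs (Module ℂ (∀ i j, M.X i ⟶ N.X j))
  smul_comp M N K r f g := Mat_.hom_ext _ _ fun i k => by
    change ∑ j, (r • f i j) ≫ g j k = r • ∑ j, f i j ≫ g j k
    simp [Finset.smul_sum]
  comp_smul M N K f r g := Mat_.hom_ext _ _ fun i k => by
    change ∑ j, f i j ≫ (r • g j k) = r • ∑ j, f i j ≫ g j k
    simp [Finset.smul_sum]

open scoped Classical in
/-- The isomorphism of formal direct sums given by a bijection of the index sets and
isomorphisms of corresponding summands. -/
def relabel {M N : Mat_ C} (e : M.ι ≃ N.ι) (φ : ∀ i, M.X i ≅ N.X (e i)) : M ⟶ N :=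
  fun i j => if h : e i = j then (φ i).hom ≫ eqToHom (congrArg N.X h) else 0

open scoped Classical in
/-- The inverse of `relabel`. -/
def relabelInv {M N : Mat_ C} (e : M.ι ≃ N.ι) (φ : ∀ i, M.X i ≅ N.X (e i)) : N ⟶ M :=
  fun j i => if h : e i = j then eqToHom (congrArg N.X h).symm ≫ (φ i).inv else 0

theorem relabel_comp {M N K : Mat_ C} (e : M.ι ≃ N.ι) (φ : ∀ i, M.X i ≅ N.X (e i)) (f : N ⟶ K)
    (i : M.ι) (k : K.ι) : (relabel e φ ≫ f) i k = (φ i).hom ≫ f (e i) k := by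
  change ∑ j, (relabel e φ) i j ≫ f j k = _
  rw [Finset.sum_eq_single (e i)]
  · simp [relabel]
  · intro j _ hj; simp [relabel, hj.symm]
  · simp

theorem comp_relabel {M N K : Mat_ C} (e : M.ι ≃ N.ι) (φ : ∀ i, M.X i ≅ N.X (e i)) (f : K ⟶ M)
    (k : K.ι) (i : M.ι) : (f ≫ relabel e φ) k (e i) = f k i ≫ (φ i).hom := by
  change ∑ j, f k j ≫ (relabel e φ) j (e i) = _
  rw [Finset.sum_eq_single i]
  · simp [relabel]
  · intro j _ hj; simp [relabel, hj]
  · simp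

/-- `relabel` as an isomorphism. -/
def relabelIso {M N : Mat_ C} (e : M.ι ≃ N.ι) (φ : ∀ i, M.X i ≅ N.X (e i)) : M ≅ N where
  hom := relabel e φ
  inv := relabelInv e φ
  hom_inv_id := Mat_.hom_ext _ _ fun i j => by
    rw [relabel_comp]
    by_cases h : i = j
    · subst h; simp [relabelInv]
    · have h' : ¬ e j = e i := fun h' => h (e.injective h').symm
      rw [Mat_.id_apply_of_ne _ _ _ h]
      simp [relabelInv, h']
  inv_hom_id := Mat_.hom_ext _ _ fun i j => by
    obtain ⟨i, rfl⟩ := e.surjective i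
    obtain ⟨j, rfl⟩ := e.surjective j
    rw [comp_relabel]
    by_cases h : i = j
    · subst h; simp [relabelInv]
    · have h' : ¬ e i = e j := fun h' => h (e.injective h')
      rw [Mat_.id_apply_of_ne _ _ _ h']
      simp [relabelInv, Ne.symm h]

theorem relabel_congr {M N : Mat_ C} {e e' : M.ι ≃ N.ι} {φ : ∀ i, M.X i ≅ N.X (e i)}
    {φ' : ∀ i, M.X i ≅ N.X (e' i)} (h : e = e')
    (hφ : ∀ i, (φ i).hom ≫ eqToHom (by rw [h]) = (φ' i).hom) : relabel e φ = relabel e' φ' := by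
  subst h
  have : φ = φ' := funext fun i => Iso.ext (by simpa using hφ i)
  rw [this]

theorem relabel_apply {M N : Mat_ C} (e : M.ι ≃ N.ι) (φ : ∀ i, M.X i ≅ N.X (e i)) (i : M.ι) :
    relabel e φ i (e i) = (φ i).hom := by simp [relabel]

theorem relabel_apply_ne {M N : Mat_ C} (e : M.ι ≃ N.ι) (φ : ∀ i, M.X i ≅ N.X (e i)) (i : M.ι)
    (j : N.ι) (h : e i ≠ j) : relabel e φ i j = 0 := by simp [relabel, h]

theorem eq_relabel {M N : Mat_ C} {f : M ⟶ N} {e : M.ι ≃ N.ι} {φ : ∀ i, M.X i ≅ N.X (e i)}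
    (h : ∀ i, f i (e i) = (φ i).hom) (h' : ∀ i i', i ≠ i' → f i (e i') = 0) : f = relabel e φ :=
  Mat_.hom_ext _ _ fun i j => by
    obtain ⟨j, rfl⟩ := e.surjective j
    by_cases hij : i = j
    · subst hij; rw [h, relabel_apply]
    · rw [h' _ _ hij, relabel_apply_ne _ _ _ _ (fun h => hij (e.injective h))]

theorem relabel_trans {M N K : Mat_ C} {f : M ⟶ N} {g : N ⟶ K} {e : M.ι ≃ N.ι}
    {φ : ∀ i, M.X i ≅ N.X (e i)} {e' : N.ι ≃ K.ι} {φ' : ∀ i, N.X i ≅ K.X (e' i)}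
    (hf : f = relabel e φ) (hg : g = relabel e' φ') :
    f ≫ g = relabel (e.trans e') (fun i => φ i ≪≫ φ' (e i)) := by
  subst hf hg
  refine eq_relabel (fun i => ?_) (fun i j h => ?_)
  · rw [relabel_comp]
    exact congrArg _ (relabel_apply e' φ' (e i))
  · rw [relabel_comp]
    exact (congrArg _ (relabel_apply_ne e' φ' (e i) (e' (e j))
      (fun h' => h (e.injective (e'.injective h'))))).trans Limits.comp_zero

theorem relabel_ext {M N : Mat_ C} {f g : M ⟶ N} {e e' : M.ι ≃ N.ι}
    {φ : ∀ i, M.X i ≅ N.X (e i)} {φ' : ∀ i, M.X i ≅ N.X (e' i)} (hf : f = relabel e φ)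
    (hg : g = relabel e' φ') (h : e = e')
    (hφ : ∀ i, (φ i).hom ≫ eqToHom (by rw [h]) = (φ' i).hom) : f = g := by
  rw [hf, hg, relabel_congr h hφ]

theorem relabel_naturality {M N M' N' : Mat_ C} (e : M.ι ≃ N.ι) (φ : ∀ i, M.X i ≅ N.X (e i))
    (e' : M'.ι ≃ N'.ι) (φ' : ∀ i, M'.X i ≅ N'.X (e' i)) (f : M ⟶ M') (g : N ⟶ N')
    (H : ∀ i j, f i j ≫ (φ' j).hom = (φ i).hom ≫ g (e i) (e' j)) :
    f ≫ relabel e' φ' = relabel e φ ≫ g := Mat_.hom_ext _ _ fun i j => by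
  obtain ⟨j, rfl⟩ := e'.surjective j
  rw [comp_relabel, relabel_comp]
  exact H i j

variable [MonoidalCategory C]

/-- The tensor product of formal direct sums. -/
def matTensor (M N : Mat_ C) : Mat_ C := ⟨M.ι × N.ι, fun p => M.X p.1 ⊗ N.X p.2⟩

/-- The tensor product (Kronecker product) of matrices. -/
def matTensorHom {M N M' N' : Mat_ C} (f : M ⟶ M') (g : N ⟶ N') :
    matTensor M N ⟶ matTensor M' N' := fun p q => f p.1 q.1 ⊗ₘ g p.2 q.2

/-- The associator. -/
def matAssoc (M N K : Mat_ C) : matTensor (matTensor M N) K ≅ matTensor M (matTensor N K) :=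
  relabelIso (M := matTensor (matTensor M N) K) (N := matTensor M (matTensor N K))
    (Equiv.prodAssoc _ _ _) (fun p => α_ (M.X p.1.1) (N.X p.1.2) (K.X p.2))

/-- The unit object. -/
def matUnit : Mat_ C := ⟨PUnit, fun _ => 𝟙_ C⟩

/-- The left unitor. -/
def matLeft (M : Mat_ C) : matTensor matUnit M ≅ M :=
  relabelIso (M := matTensor matUnit M) (Equiv.punitProd _) (fun p => λ_ (M.X p.2))

/-- The right unitor. -/
def matRight (M : Mat_ C) : matTensor M matUnit ≅ M :=
  relabelIso (M := matTensor M matUnit) (Equiv.prodPUnit _) (fun p => ρ_ (M.X p.1))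

/-- The braiding. -/
def matBraid [BraidedCategory C] (M N : Mat_ C) : matTensor M N ≅ matTensor N M :=
  relabelIso (M := matTensor M N) (N := matTensor N M) (Equiv.prodComm _ _)
    (fun p => β_ (M.X p.1) (N.X p.2))

instance : MonoidalCategoryStruct (Mat_ C) where
  tensorObj := matTensor
  tensorHom := matTensorHom
  whiskerLeft M _ _ f := matTensorHom (𝟙 M) f
  whiskerRight f M := matTensorHom f (𝟙 M)
  tensorUnit := matUnit
  associator := matAssoc
  leftUnitor := matLeft
  rightUnitor := matRight

variable [MonoidalPreadditive C]

theorem matTensor_id (M N : Mat_ C) : matTensorHom (𝟙 M) (𝟙 N) = 𝟙 (matTensor M N) :=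
  Mat_.hom_ext _ _ fun i j => by
    change (𝟙 M : Mat_.Hom M M) i.1 j.1 ⊗ₘ (𝟙 N : Mat_.Hom N N) i.2 j.2 = _
    by_cases h : i = j
    · subst h
      rw [Mat_.id_apply_self, Mat_.id_apply_self]
      exact (id_tensorHom_id _ _).trans (Mat_.id_apply_self (matTensor M N) i).symm
    · refine Eq.trans ?_ (Mat_.id_apply_of_ne (matTensor M N) i j h).symm
      by_cases h1 : i.1 = j.1
      · have h2 : i.2 ≠ j.2 := fun h2 => h (Prod.ext h1 h2)
        rw [Mat_.id_apply_of_ne _ _ _ h2, MonoidalPreadditive.tensor_zero]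
        rfl
      · rw [Mat_.id_apply_of_ne _ _ _ h1, MonoidalPreadditive.zero_tensor]
        rfl

theorem relabel_wl (K : Mat_ C) {M N : Mat_ C} (e : M.ι ≃ N.ι) (φ : ∀ i, M.X i ≅ N.X (e i)) :
    matTensorHom (𝟙 K) (relabel e φ) = relabel (M := matTensor K M) (N := matTensor K N)
      ((Equiv.refl K.ι).prodCongr e) (fun p => whiskerLeftIso (K.X p.1) (φ p.2)) := by
  refine eq_relabel (fun i => ?_) (fun i j h => ?_)
  · change (𝟙 K : Mat_.Hom K K) i.1 i.1 ⊗ₘ relabel e φ i.2 (e i.2) = K.X i.1 ◁ (φ i.2).hom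
    rw [Mat_.id_apply_self, relabel_apply, id_tensorHom]
  · change (𝟙 K : Mat_.Hom K K) i.1 j.1 ⊗ₘ relabel e φ i.2 (e j.2) = _
    by_cases h1 : i.1 = j.1
    · have h2 : i.2 ≠ j.2 := fun h2 => h (Prod.ext h1 h2)
      rw [relabel_apply_ne _ _ _ _ (fun h => h2 (e.injective h)), MonoidalPreadditive.tensor_zero]
      rfl
    · rw [Mat_.id_apply_of_ne _ _ _ h1, MonoidalPreadditive.zero_tensor]
      rfl

theorem relabel_wr (K : Mat_ C) {M N : Mat_ C} (e : M.ι ≃ N.ι) (φ : ∀ i, M.X i ≅ N.X (e i)) :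
    matTensorHom (relabel e φ) (𝟙 K) = relabel (M := matTensor M K) (N := matTensor N K)
      (e.prodCongr (Equiv.refl K.ι)) (fun p => whiskerRightIso (φ p.1) (K.X p.2)) := by
  refine eq_relabel (fun i => ?_) (fun i j h => ?_)
  · change relabel e φ i.1 (e i.1) ⊗ₘ (𝟙 K : Mat_.Hom K K) i.2 i.2 = (φ i.1).hom ▷ K.X i.2
    rw [Mat_.id_apply_self, relabel_apply, tensorHom_id]
  · change relabel e φ i.1 (e j.1) ⊗ₘ (𝟙 K : Mat_.Hom K K) i.2 j.2 = _
    by_cases h1 : i.2 = j.2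
    · have h2 : i.1 ≠ j.1 := fun h2 => h (Prod.ext h2 h1)
      rw [relabel_apply_ne _ _ _ _ (fun h => h2 (e.injective h)), MonoidalPreadditive.zero_tensor]
      rfl
    · rw [Mat_.id_apply_of_ne _ _ _ h1, MonoidalPreadditive.tensor_zero]
      rfl

theorem matAssoc_wr (M N K L : Mat_ C) : matTensorHom (matAssoc M N K).hom (𝟙 L) =
    relabel (M := matTensor (matTensor (matTensor M N) K) L)
      (N := matTensor (matTensor M (matTensor N K)) L)
      ((Equiv.prodAssoc _ _ _).prodCongr (Equiv.refl _))
      (fun p => whiskerRightIso (α_ (M.X p.1.1.1) (N.X p.1.1.2) (K.X p.1.2)) (L.X p.2)) :=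
  relabel_wr _ _ _

theorem matAssoc_wl (M N K L : Mat_ C) : matTensorHom (𝟙 L) (matAssoc M N K).hom =
    relabel (M := matTensor L (matTensor (matTensor M N) K))
      (N := matTensor L (matTensor M (matTensor N K)))
      ((Equiv.refl _).prodCongr (Equiv.prodAssoc _ _ _))
      (fun p => whiskerLeftIso (L.X p.1) (α_ (M.X p.2.1.1) (N.X p.2.1.2) (K.X p.2.2))) :=
  relabel_wl _ _ _

theorem mat_pentagon (W X Y Z : Mat_ C) :
    matTensorHom (matAssoc W X Y).hom (𝟙 Z) ≫ (matAssoc W (matTensor X Y) Z).hom ≫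
      matTensorHom (𝟙 W) (matAssoc X Y Z).hom =
    (matAssoc (matTensor W X) Y Z).hom ≫ (matAssoc W X (matTensor Y Z)).hom := by
  refine relabel_ext (relabel_trans (matAssoc_wr _ _ _ _) (relabel_trans rfl
    (matAssoc_wl _ _ _ _))) (relabel_trans rfl rfl) rfl fun i => ?_
  exact (Category.comp_id _).trans (MonoidalCategory.pentagon (W.X i.1.1.1) (X.X i.1.1.2)
    (Y.X i.1.2) (Z.X i.2))

theorem mat_triangle (X Y : Mat_ C) : (matAssoc X matUnit Y).hom ≫
    matTensorHom (𝟙 X) (matLeft Y).hom = matTensorHom (matRight X).hom (𝟙 Y) := by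
  refine relabel_ext (relabel_trans rfl (relabel_wl _ _ _)) (relabel_wr _ _ _) rfl fun i => ?_
  exact (Category.comp_id _).trans (MonoidalCategory.triangle (X.X i.1.1) (Y.X i.2))

theorem matBraid_wr [BraidedCategory C] (M N L : Mat_ C) :
    matTensorHom (matBraid M N).hom (𝟙 L) =
    relabel (M := matTensor (matTensor M N) L) (N := matTensor (matTensor N M) L)
      ((Equiv.prodComm _ _).prodCongr (Equiv.refl _))
      (fun p => whiskerRightIso (β_ (M.X p.1.1) (N.X p.1.2)) (L.X p.2)) :=
  relabel_wr _ _ _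

theorem matBraid_wl [BraidedCategory C] (M N L : Mat_ C) :
    matTensorHom (𝟙 L) (matBraid M N).hom =
    relabel (M := matTensor L (matTensor M N)) (N := matTensor L (matTensor N M))
      ((Equiv.refl _).prodCongr (Equiv.prodComm _ _))
      (fun p => whiskerLeftIso (L.X p.1) (β_ (M.X p.2.1) (N.X p.2.2))) :=
  relabel_wl _ _ _

theorem matAssoc_inv (X Y Z : Mat_ C) : (matAssoc X Y Z).inv =
    relabel (M := matTensor X (matTensor Y Z)) (N := matTensor (matTensor X Y) Z)
      (Equiv.prodAssoc _ _ _).symm (fun p => (α_ (X.X p.1) (Y.X p.2.1) (Z.X p.2.2)).symm) := by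
  rw [← cancel_epi (matAssoc X Y Z).hom, Iso.hom_inv_id]
  refine relabel_ext (e := Equiv.refl _) (φ := fun p => Iso.refl _)
    (eq_relabel (fun i => Mat_.id_apply_self _ _) (fun i j h => Mat_.id_apply_of_ne _ _ _ h))
    (relabel_trans rfl rfl) rfl fun i => ?_
  exact (Category.comp_id _).trans (α_ (X.X i.1.1) (Y.X i.1.2) (Z.X i.2)).hom_inv_id.symm

theorem mat_hexagon_forward [BraidedCategory C] (X Y Z : Mat_ C) :
    (matAssoc X Y Z).hom ≫ (matBraid X (matTensor Y Z)).hom ≫ (matAssoc Y Z X).hom =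
    matTensorHom (matBraid X Y).hom (𝟙 Z) ≫ (matAssoc Y X Z).hom ≫
      matTensorHom (𝟙 Y) (matBraid X Z).hom := by
  refine relabel_ext (relabel_trans rfl (relabel_trans rfl rfl)) (relabel_trans
    (matBraid_wr _ _ _) (relabel_trans rfl (matBraid_wl _ _ _))) rfl fun i => ?_
  exact (Category.comp_id _).trans (BraidedCategory.hexagon_forward (X.X i.1.1) (Y.X i.1.2)
    (Z.X i.2))

theorem mat_hexagon_reverse [BraidedCategory C] (X Y Z : Mat_ C) :
    (matAssoc X Y Z).inv ≫ (matBraid (matTensor X Y) Z).hom ≫ (matAssoc Z X Y).inv =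
    matTensorHom (𝟙 X) (matBraid Y Z).hom ≫ (matAssoc X Z Y).inv ≫
      matTensorHom (matBraid X Z).hom (𝟙 Y) := by
  refine relabel_ext (relabel_trans (matAssoc_inv _ _ _) (relabel_trans rfl
    (matAssoc_inv _ _ _))) (relabel_trans (matBraid_wl _ _ _) (relabel_trans
    (matAssoc_inv _ _ _) (matBraid_wr _ _ _))) rfl fun i => ?_
  exact (Category.comp_id _).trans (BraidedCategory.hexagon_reverse (X.X i.1) (Y.X i.2.1)
    (Z.X i.2.2))

theorem matUnit_id (i j : PUnit) :
    (𝟙 (matUnit : Mat_ C) : Mat_.Hom _ _) i j = 𝟙 (𝟙_ C) := Mat_.id_apply_self _ _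

instance : MonoidalCategory (Mat_ C) := MonoidalCategory.ofTensorHom
  (id_tensorHom_id := matTensor_id)
  (id_tensorHom := fun _ _ _ _ => rfl)
  (tensorHom_id := fun _ _ => rfl)
  (tensorHom_comp_tensorHom := fun {X₁ Y₁ Z₁ X₂ Y₂ Z₂} f₁ f₂ g₁ g₂ => Mat_.hom_ext _ _ fun i k => by
    change ∑ j : Y₁.ι × Y₂.ι, (f₁ i.1 j.1 ⊗ₘ f₂ i.2 j.2) ≫ (g₁ j.1 k.1 ⊗ₘ g₂ j.2 k.2) =
      (∑ j, f₁ i.1 j ≫ g₁ j k.1) ⊗ₘ (∑ j, f₂ i.2 j ≫ g₂ j k.2)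
    rw [sum_tensor, Fintype.sum_prod_type]
    refine Finset.sum_congr rfl fun a _ => ?_
    rw [tensor_sum]
    refine Finset.sum_congr rfl fun b _ => ?_
    rw [tensorHom_comp_tensorHom])
  (associator_naturality := fun f₁ f₂ f₃ => relabel_naturality _ _ _ _ _ _ fun i j =>
    MonoidalCategory.associator_naturality _ _ _)
  (leftUnitor_naturality := fun {M N} f => relabel_naturality _ _ _ _ _ _ fun i j => by
    have e (g : M.X i.2 ⟶ N.X j.2) : (𝟙 (𝟙_ C) ⊗ₘ g) ≫ (λ_ _).hom = (λ_ _).hom ≫ g := by simp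
    exact (congrArg (fun x => (x ⊗ₘ f i.2 j.2) ≫ (λ_ _).hom) (matUnit_id i.1 j.1)).trans (e _))
  (rightUnitor_naturality := fun {M N} f => relabel_naturality _ _ _ _ _ _ fun i j => by
    have e (g : M.X i.1 ⟶ N.X j.1) : (g ⊗ₘ 𝟙 (𝟙_ C)) ≫ (ρ_ _).hom = (ρ_ _).hom ≫ g := by simp
    exact (congrArg (fun x => (f i.1 j.1 ⊗ₘ x) ≫ (ρ_ _).hom) (matUnit_id i.2 j.2)).trans (e _))
  (pentagon := mat_pentagon)
  (triangle := mat_triangle)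

instance : MonoidalPreadditive (Mat_ C) where
  whiskerLeft_zero := Mat_.hom_ext _ _ fun _ _ => MonoidalPreadditive.tensor_zero _
  zero_whiskerRight := Mat_.hom_ext _ _ fun _ _ => MonoidalPreadditive.zero_tensor _
  whiskerLeft_add {X _ _} f g := Mat_.hom_ext _ _ fun i j =>
    MonoidalPreadditive.tensor_add ((𝟙 X : Mat_.Hom X X) i.1 j.1) (f i.2 j.2) (g i.2 j.2)
  add_whiskerRight {X _ _} f g := Mat_.hom_ext _ _ fun i j =>
    MonoidalPreadditive.add_tensor (f i.1 j.1) (g i.1 j.1) ((𝟙 X : Mat_.Hom X X) i.2 j.2)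

theorem smul_tensor [Linear ℂ C] [MonoidalLinear ℂ C] {X Y X' Y' : C} (c : ℂ) (f : X ⟶ Y)
    (g : X' ⟶ Y') : (c • f) ⊗ₘ g = c • (f ⊗ₘ g) := by
  simp [MonoidalCategory.tensorHom_def]

theorem tensor_smul [Linear ℂ C] [MonoidalLinear ℂ C] {X Y X' Y' : C} (c : ℂ) (f : X ⟶ Y)
    (g : X' ⟶ Y') : f ⊗ₘ (c • g) = c • (f ⊗ₘ g) := by
  simp [MonoidalCategory.tensorHom_def]

instance [Linear ℂ C] [MonoidalLinear ℂ C] : MonoidalLinear ℂ (Mat_ C) where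
  whiskerLeft_smul X _ _ c f := Mat_.hom_ext _ _ fun i j =>
    tensor_smul c ((𝟙 X : Mat_.Hom X X) i.1 j.1) (f i.2 j.2)
  smul_whiskerRight c _ _ f X := Mat_.hom_ext _ _ fun i j =>
    smul_tensor c (f i.1 j.1) ((𝟙 X : Mat_.Hom X X) i.2 j.2)

instance [BraidedCategory C] : BraidedCategory (Mat_ C) where
  braiding := matBraid
  braiding_naturality_right X Y Z f := relabel_naturality _ _ _ _ _ _ fun i j =>
    BraidedCategory.braiding_naturality ((𝟙 X : Mat_.Hom X X) i.1 j.1) (f i.2 j.2)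
  braiding_naturality_left f Z := relabel_naturality _ _ _ _ _ _ fun i j =>
    BraidedCategory.braiding_naturality (f i.1 j.1) ((𝟙 Z : Mat_.Hom Z Z) i.2 j.2)
  hexagon_forward := mat_hexagon_forward
  hexagon_reverse := mat_hexagon_reverse
end AdditiveCompletion

section IdempotentCompletion
open Idempotents
universe v u
variable {C : Type u} [Category.{v} C]

instance [Preadditive C] [Linear ℂ C] : Linear ℂ (Karoubi C) where
  homModule P Q :=
    { smul := fun a f => ⟨a • f.f, by
        rw [Linear.smul_comp, Linear.comp_smul, f.comm]⟩
      one_smul := fun f => Karoubi.hom_ext _ _ (one_smul ℂ f.f)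
      mul_smul := fun a b f => Karoubi.hom_ext _ _ (mul_smul a b f.f)
      smul_zero := fun a => Karoubi.hom_ext _ _ (smul_zero a)
      smul_add := fun a f g => Karoubi.hom_ext _ _ (smul_add a f.f g.f)
      add_smul := fun a b f => Karoubi.hom_ext _ _ (add_smul a b f.f)
      zero_smul := fun f => Karoubi.hom_ext _ _ (zero_smul ℂ f.f) }
  smul_comp X Y Z r f g := Karoubi.hom_ext _ _ (Linear.smul_comp _ _ _ r f.f g.f)
  comp_smul X Y Z f r g := Karoubi.hom_ext _ _ (Linear.comp_smul _ _ _ f.f r g.f)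

/-- An isomorphism that intertwines two idempotents induces an isomorphism of their images. -/
def karoubiIso (P Q : Karoubi C) (a : P.X ≅ Q.X) (h : P.p ≫ a.hom = a.hom ≫ Q.p) : P ≅ Q where
  hom := ⟨P.p ≫ a.hom, by rw [Category.assoc, ← h, P.idem_assoc, P.idem_assoc]⟩
  inv := ⟨Q.p ≫ a.inv, by
    have h' : Q.p ≫ a.inv = a.inv ≫ P.p := by
      rw [Iso.eq_inv_comp, ← Category.assoc, ← h, Category.assoc, Iso.hom_inv_id, Category.comp_id]
    rw [Category.assoc, ← h', Q.idem_assoc, Q.idem_assoc]⟩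
  hom_inv_id := Karoubi.hom_ext _ _ (by
    change (P.p ≫ a.hom) ≫ Q.p ≫ a.inv = P.p
    rw [h, Category.assoc, Q.idem_assoc, ← Category.assoc, ← h, Category.assoc, Iso.hom_inv_id,
      Category.comp_id])
  inv_hom_id := Karoubi.hom_ext _ _ (by
    change (Q.p ≫ a.inv) ≫ P.p ≫ a.hom = Q.p
    rw [h, Category.assoc, Iso.inv_hom_id_assoc, Q.idem])

variable [MonoidalCategory C]

/-- The tensor product on objects of the idempotent completion: `(X, p) ⊗ (Y, q)` is
`(X ⊗ Y, p ⊗ q)`. -/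
def karoubiTensor (P Q : Karoubi C) : Karoubi C where
  X := P.X ⊗ Q.X
  p := P.p ⊗ₘ Q.p
  idem := by rw [tensorHom_comp_tensorHom, P.idem, Q.idem]

/-- The tensor product on morphisms of the idempotent completion. -/
def karoubiTensorHom {P Q P' Q' : Karoubi C} (f : P ⟶ P') (g : Q ⟶ Q') :
    karoubiTensor P Q ⟶ karoubiTensor P' Q' where
  f := f.f ⊗ₘ g.f
  comm := by
    change (P.p ⊗ₘ Q.p) ≫ (f.f ⊗ₘ g.f) ≫ (P'.p ⊗ₘ Q'.p) = (f.f ⊗ₘ g.f)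
    rw [tensorHom_comp_tensorHom, tensorHom_comp_tensorHom, f.comm, g.comm]

instance : MonoidalCategoryStruct (Karoubi C) where
  tensorObj := karoubiTensor
  tensorHom := karoubiTensorHom
  whiskerLeft P _ _ f := karoubiTensorHom (𝟙 P) f
  whiskerRight f P := karoubiTensorHom f (𝟙 P)
  tensorUnit := ⟨𝟙_ C, 𝟙 _, Category.comp_id _⟩
  associator P Q R := karoubiIso (karoubiTensor (karoubiTensor P Q) R)
    (karoubiTensor P (karoubiTensor Q R)) (α_ P.X Q.X R.X)
    (MonoidalCategory.associator_naturality P.p Q.p R.p)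
  leftUnitor P := karoubiIso (karoubiTensor ⟨𝟙_ C, 𝟙 _, Category.comp_id _⟩ P) P (λ_ P.X) (by
    change (𝟙 _ ⊗ₘ P.p) ≫ _ = _
    rw [id_tensorHom]; exact MonoidalCategory.leftUnitor_naturality P.p)
  rightUnitor P := karoubiIso (karoubiTensor P ⟨𝟙_ C, 𝟙 _, Category.comp_id _⟩) P (ρ_ P.X) (by
    change (P.p ⊗ₘ 𝟙 _) ≫ _ = _
    rw [tensorHom_id]; exact MonoidalCategory.rightUnitor_naturality P.p)

theorem pentagon_idem {W X Y Z : C} {w : W ⟶ W} {x : X ⟶ X} {y : Y ⟶ Y} {z : Z ⟶ Z}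
    (hw : w ≫ w = w) (hx : x ≫ x = x) (hy : y ≫ y = y) (hz : z ≫ z = z) :
    ((((w ⊗ₘ x) ⊗ₘ y) ≫ (α_ W X Y).hom) ⊗ₘ z) ≫
      (((w ⊗ₘ (x ⊗ₘ y)) ⊗ₘ z) ≫ (α_ W (X ⊗ Y) Z).hom) ≫
        (w ⊗ₘ (((x ⊗ₘ y) ⊗ₘ z) ≫ (α_ X Y Z).hom)) =
    ((((w ⊗ₘ x) ⊗ₘ y) ⊗ₘ z) ≫ (α_ (W ⊗ X) Y Z).hom) ≫
      (((w ⊗ₘ x) ⊗ₘ (y ⊗ₘ z)) ≫ (α_ W X (Y ⊗ Z)).hom) := by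
  have e1 : ((((w ⊗ₘ x) ⊗ₘ y) ≫ (α_ W X Y).hom) ⊗ₘ z) =
      (((w ⊗ₘ x) ⊗ₘ y) ⊗ₘ z) ≫ ((α_ W X Y).hom ▷ Z) := by
    rw [← tensorHom_id, tensorHom_comp_tensorHom, Category.comp_id]
  have e2 : (w ⊗ₘ (((x ⊗ₘ y) ⊗ₘ z) ≫ (α_ X Y Z).hom)) =
      (w ⊗ₘ ((x ⊗ₘ y) ⊗ₘ z)) ≫ (W ◁ (α_ X Y Z).hom) := by
    rw [← id_tensorHom, tensorHom_comp_tensorHom, Category.comp_id]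
  have e3 : (((w ⊗ₘ x) ⊗ₘ y) ⊗ₘ z) ≫ ((α_ W X Y).hom ▷ Z) =
      ((α_ W X Y).hom ▷ Z) ≫ ((w ⊗ₘ (x ⊗ₘ y)) ⊗ₘ z) := by
    rw [← tensorHom_id, tensorHom_comp_tensorHom, tensorHom_comp_tensorHom, Category.comp_id,
      Category.id_comp, MonoidalCategory.associator_naturality]
  have e4 : ((w ⊗ₘ (x ⊗ₘ y)) ⊗ₘ z) ≫ ((w ⊗ₘ (x ⊗ₘ y)) ⊗ₘ z) = ((w ⊗ₘ (x ⊗ₘ y)) ⊗ₘ z) := by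
    simp only [tensorHom_comp_tensorHom, hw, hx, hy, hz]
  have e5 : (w ⊗ₘ ((x ⊗ₘ y) ⊗ₘ z)) ≫ (w ⊗ₘ ((x ⊗ₘ y) ⊗ₘ z)) = (w ⊗ₘ ((x ⊗ₘ y) ⊗ₘ z)) := by
    simp only [tensorHom_comp_tensorHom, hw, hx, hy, hz]
  have e6 : ((w ⊗ₘ x) ⊗ₘ (y ⊗ₘ z)) ≫ ((w ⊗ₘ x) ⊗ₘ (y ⊗ₘ z)) = ((w ⊗ₘ x) ⊗ₘ (y ⊗ₘ z)) := by
    simp only [tensorHom_comp_tensorHom, hw, hx, hy, hz]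
  have e7 := MonoidalCategory.associator_naturality (w ⊗ₘ x) y z
  have e8 := MonoidalCategory.associator_naturality w (x ⊗ₘ y) z
  rw [e1, e2, e3, e7]
  simp only [Category.assoc]
  rw [reassoc_of% e4, reassoc_of% e6, ← reassoc_of% e8, reassoc_of% e4, ← reassoc_of% e3,
    ← reassoc_of% e7, pentagon]

theorem triangle_idem {X Y : C} {x : X ⟶ X} {y : Y ⟶ Y} (hx : x ≫ x = x) (hy : y ≫ y = y) :
    (((x ⊗ₘ 𝟙 (𝟙_ C)) ⊗ₘ y) ≫ (α_ X (𝟙_ C) Y).hom) ≫ (x ⊗ₘ ((𝟙 (𝟙_ C) ⊗ₘ y) ≫ (λ_ Y).hom)) =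
      (((x ⊗ₘ 𝟙 (𝟙_ C)) ≫ (ρ_ X).hom) ⊗ₘ y) := by
  have e1 : (x ⊗ₘ ((𝟙 (𝟙_ C) ⊗ₘ y) ≫ (λ_ Y).hom)) =
      (x ⊗ₘ (𝟙 (𝟙_ C) ⊗ₘ y)) ≫ (X ◁ (λ_ Y).hom) := by
    rw [← id_tensorHom X, tensorHom_comp_tensorHom, Category.comp_id]
  have e2 : (((x ⊗ₘ 𝟙 (𝟙_ C)) ≫ (ρ_ X).hom) ⊗ₘ y) =
      ((x ⊗ₘ 𝟙 (𝟙_ C)) ⊗ₘ y) ≫ ((ρ_ X).hom ▷ Y) := by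
    rw [← tensorHom_id (ρ_ X).hom, tensorHom_comp_tensorHom, Category.comp_id]
  have e3 := MonoidalCategory.associator_naturality x (𝟙 (𝟙_ C)) y
  have e4 : ((x ⊗ₘ 𝟙 (𝟙_ C)) ⊗ₘ y) ≫ ((x ⊗ₘ 𝟙 (𝟙_ C)) ⊗ₘ y) = ((x ⊗ₘ 𝟙 (𝟙_ C)) ⊗ₘ y) := by
    simp only [tensorHom_comp_tensorHom, hx, hy, Category.comp_id]
  rw [e1, e2, Category.assoc, ← reassoc_of% e3, reassoc_of% e4, triangle]

instance : MonoidalCategory (Karoubi C) where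
  tensorHom_def {X₁ Y₁ X₂ Y₂} f g := Karoubi.hom_ext _ _ (by
    change (f.f ⊗ₘ g.f) = (f.f ⊗ₘ X₂.p) ≫ (Y₁.p ⊗ₘ g.f)
    rw [tensorHom_comp_tensorHom, Karoubi.comp_p, Karoubi.p_comp])
  id_tensorHom_id P Q := rfl
  tensorHom_comp_tensorHom f₁ f₂ g₁ g₂ := Karoubi.hom_ext _ _
    (tensorHom_comp_tensorHom f₁.f f₂.f g₁.f g₂.f)
  whiskerLeft_id P Q := rfl
  id_whiskerRight P Q := rfl
  associator_naturality {X₁ X₂ X₃ Y₁ Y₂ Y₃} f₁ f₂ f₃ := Karoubi.hom_ext _ _ (by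
    change ((f₁.f ⊗ₘ f₂.f) ⊗ₘ f₃.f) ≫ ((Y₁.p ⊗ₘ Y₂.p) ⊗ₘ Y₃.p) ≫ (α_ _ _ _).hom =
      (((X₁.p ⊗ₘ X₂.p) ⊗ₘ X₃.p) ≫ (α_ _ _ _).hom) ≫ (f₁.f ⊗ₘ (f₂.f ⊗ₘ f₃.f))
    rw [Category.assoc, ← MonoidalCategory.associator_naturality, ← Category.assoc,
      ← Category.assoc]
    simp only [tensorHom_comp_tensorHom, Karoubi.comp_p, Karoubi.p_comp])
  leftUnitor_naturality {X Y} f := Karoubi.hom_ext _ _ (by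
    change (𝟙 (𝟙_ C) ⊗ₘ f.f) ≫ (𝟙 (𝟙_ C) ⊗ₘ Y.p) ≫ (λ_ Y.X).hom =
      ((𝟙 (𝟙_ C) ⊗ₘ X.p) ≫ (λ_ X.X).hom) ≫ f.f
    simp)
  rightUnitor_naturality {X Y} f := Karoubi.hom_ext _ _ (by
    change (f.f ⊗ₘ 𝟙 (𝟙_ C)) ≫ (Y.p ⊗ₘ 𝟙 (𝟙_ C)) ≫ (ρ_ Y.X).hom =
      ((X.p ⊗ₘ 𝟙 (𝟙_ C)) ≫ (ρ_ X.X).hom) ≫ f.f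
    simp)
  pentagon W X Y Z := Karoubi.hom_ext _ _ (pentagon_idem W.idem X.idem Y.idem Z.idem)
  triangle X Y := Karoubi.hom_ext _ _ (triangle_idem X.idem Y.idem)

section
variable [Preadditive C] [MonoidalPreadditive C]

instance : MonoidalPreadditive (Karoubi C) where
  whiskerLeft_zero {X Y Z} := Karoubi.hom_ext _ _ (MonoidalPreadditive.tensor_zero X.p)
  zero_whiskerRight {X Y Z} := Karoubi.hom_ext _ _ (MonoidalPreadditive.zero_tensor X.p)
  whiskerLeft_add {X Y Z} f g :=
    Karoubi.hom_ext _ _ (MonoidalPreadditive.tensor_add X.p f.f g.f)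
  add_whiskerRight {X Y Z} f g :=
    Karoubi.hom_ext _ _ (MonoidalPreadditive.add_tensor f.f g.f X.p)

variable [Linear ℂ C] [MonoidalLinear ℂ C]

instance : MonoidalLinear ℂ (Karoubi C) where
  whiskerLeft_smul X _ _ c f := Karoubi.hom_ext _ _ (tensor_smul c X.p f.f)
  smul_whiskerRight c _ _ f X := Karoubi.hom_ext _ _ (smul_tensor c f.f X.p)
end

theorem braid_nat [BraidedCategory C] {X Y X' Y' : C} (f : X ⟶ X') (g : Y ⟶ Y') :
    (f ⊗ₘ g) ≫ (β_ X' Y').hom = (β_ X Y).hom ≫ (g ⊗ₘ f) :=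
  BraidedCategory.braiding_naturality f g

theorem hexagon_forward_idem [BraidedCategory C] {X Y Z : C} {x : X ⟶ X} {y : Y ⟶ Y} {z : Z ⟶ Z}
    (hx : x ≫ x = x) (hy : y ≫ y = y) (hz : z ≫ z = z) :
    (((x ⊗ₘ y) ⊗ₘ z) ≫ (α_ X Y Z).hom) ≫ ((x ⊗ₘ (y ⊗ₘ z)) ≫ (β_ X (Y ⊗ Z)).hom) ≫
      (((y ⊗ₘ z) ⊗ₘ x) ≫ (α_ Y Z X).hom) =
    (((x ⊗ₘ y) ≫ (β_ X Y).hom) ⊗ₘ z) ≫ (((y ⊗ₘ x) ⊗ₘ z) ≫ (α_ Y X Z).hom) ≫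
      (y ⊗ₘ ((x ⊗ₘ z) ≫ (β_ X Z).hom)) := by
  have e1 : (((x ⊗ₘ y) ≫ (β_ X Y).hom) ⊗ₘ z) = ((x ⊗ₘ y) ⊗ₘ z) ≫ ((β_ X Y).hom ▷ Z) := by
    rw [← tensorHom_id, tensorHom_comp_tensorHom, Category.comp_id]
  have e2 : (y ⊗ₘ ((x ⊗ₘ z) ≫ (β_ X Z).hom)) = (y ⊗ₘ (x ⊗ₘ z)) ≫ (Y ◁ (β_ X Z).hom) := by
    rw [← id_tensorHom, tensorHom_comp_tensorHom, Category.comp_id]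
  have e3 : ((x ⊗ₘ y) ⊗ₘ z) ≫ ((β_ X Y).hom ▷ Z) = ((β_ X Y).hom ▷ Z) ≫ ((y ⊗ₘ x) ⊗ₘ z) := by
    rw [← tensorHom_id, tensorHom_comp_tensorHom, tensorHom_comp_tensorHom, Category.comp_id,
      Category.id_comp, braid_nat]
  have i1 : ((y ⊗ₘ x) ⊗ₘ z) ≫ ((y ⊗ₘ x) ⊗ₘ z) = ((y ⊗ₘ x) ⊗ₘ z) := by
    simp only [tensorHom_comp_tensorHom, hx, hy, hz]
  have i2 : ((x ⊗ₘ y) ⊗ₘ z) ≫ ((x ⊗ₘ y) ⊗ₘ z) = ((x ⊗ₘ y) ⊗ₘ z) := by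
    simp only [tensorHom_comp_tensorHom, hx, hy, hz]
  have a1 := MonoidalCategory.associator_naturality x y z
  have a2 := MonoidalCategory.associator_naturality y x z
  have b1 := braid_nat x (y ⊗ₘ z)
  rw [e1, e2]
  simp only [Category.assoc]
  rw [← reassoc_of% b1, ← reassoc_of% a1, ← reassoc_of% a1, reassoc_of% i2, reassoc_of% i2,
    ← reassoc_of% a2, ← reassoc_of% e3, ← reassoc_of% e3, reassoc_of% i2, reassoc_of% i2,
    BraidedCategory.hexagon_forward]

theorem hexagon_reverse_idem [BraidedCategory C] {X Y Z : C} {x : X ⟶ X} {y : Y ⟶ Y} {z : Z ⟶ Z}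
    (hx : x ≫ x = x) (hy : y ≫ y = y) (hz : z ≫ z = z) :
    ((x ⊗ₘ (y ⊗ₘ z)) ≫ (α_ X Y Z).inv) ≫ (((x ⊗ₘ y) ⊗ₘ z) ≫ (β_ (X ⊗ Y) Z).hom) ≫
      ((z ⊗ₘ (x ⊗ₘ y)) ≫ (α_ Z X Y).inv) =
    (x ⊗ₘ ((y ⊗ₘ z) ≫ (β_ Y Z).hom)) ≫ ((x ⊗ₘ (z ⊗ₘ y)) ≫ (α_ X Z Y).inv) ≫
      (((x ⊗ₘ z) ≫ (β_ X Z).hom) ⊗ₘ y) := by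
  have e1 : (((x ⊗ₘ z) ≫ (β_ X Z).hom) ⊗ₘ y) = ((x ⊗ₘ z) ⊗ₘ y) ≫ ((β_ X Z).hom ▷ Y) := by
    rw [← tensorHom_id, tensorHom_comp_tensorHom, Category.comp_id]
  have e2 : (x ⊗ₘ ((y ⊗ₘ z) ≫ (β_ Y Z).hom)) = (x ⊗ₘ (y ⊗ₘ z)) ≫ (X ◁ (β_ Y Z).hom) := by
    rw [← id_tensorHom, tensorHom_comp_tensorHom, Category.comp_id]
  have e3 : (x ⊗ₘ (y ⊗ₘ z)) ≫ (X ◁ (β_ Y Z).hom) = (X ◁ (β_ Y Z).hom) ≫ (x ⊗ₘ (z ⊗ₘ y)) := by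
    rw [← id_tensorHom, tensorHom_comp_tensorHom, tensorHom_comp_tensorHom, Category.comp_id,
      Category.id_comp, braid_nat]
  have i2 : (x ⊗ₘ (y ⊗ₘ z)) ≫ (x ⊗ₘ (y ⊗ₘ z)) = (x ⊗ₘ (y ⊗ₘ z)) := by
    simp only [tensorHom_comp_tensorHom, hx, hy, hz]
  have a1 := associator_inv_naturality x y z
  have a2 := associator_inv_naturality x z y
  have b1 := braid_nat (x ⊗ₘ y) z
  rw [e1, e2]
  simp only [Category.assoc]
  rw [← reassoc_of% b1, ← reassoc_of% a1, ← reassoc_of% a1, reassoc_of% i2, reassoc_of% i2,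
    ← reassoc_of% a2, ← reassoc_of% e3, ← reassoc_of% e3, reassoc_of% i2, reassoc_of% i2,
    BraidedCategory.hexagon_reverse]

instance [BraidedCategory C] : BraidedCategory (Karoubi C) where
  braiding P Q := karoubiIso (P ⊗ Q) (Q ⊗ P) (β_ P.X Q.X) (braid_nat P.p Q.p)
  braiding_naturality_right X Y Z f := Karoubi.hom_ext _ _ (by
    change (X.p ⊗ₘ f.f) ≫ (X.p ⊗ₘ Z.p) ≫ (β_ X.X Z.X).hom =
      ((X.p ⊗ₘ Y.p) ≫ (β_ X.X Y.X).hom) ≫ (f.f ⊗ₘ X.p)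
    rw [Category.assoc, ← braid_nat, ← Category.assoc, ← Category.assoc]
    simp only [tensorHom_comp_tensorHom, Karoubi.comp_p, Karoubi.p_comp])
  braiding_naturality_left {X Y} f Z := Karoubi.hom_ext _ _ (by
    change (f.f ⊗ₘ Z.p) ≫ (Y.p ⊗ₘ Z.p) ≫ (β_ Y.X Z.X).hom =
      ((X.p ⊗ₘ Z.p) ≫ (β_ X.X Z.X).hom) ≫ (Z.p ⊗ₘ f.f)
    rw [Category.assoc, ← braid_nat, ← Category.assoc, ← Category.assoc]
    simp only [tensorHom_comp_tensorHom, Karoubi.comp_p, Karoubi.p_comp])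
  hexagon_forward X Y Z := Karoubi.hom_ext _ _ (hexagon_forward_idem X.idem Y.idem Z.idem)
  hexagon_reverse X Y Z := Karoubi.hom_ext _ _ (hexagon_reverse_idem X.idem Y.idem Z.idem)
end IdempotentCompletion

section Diagrams

/-- Expressions for planar diagrams, read upwards from `m` dots on the bottom to `n` dots on the
top: vertical strands, the cup, the cap, vertical stacking (the first argument at the bottom) and
horizontal juxtaposition. -/
inductive DiagramTerm : ℕ → ℕ → Type
  | id (n : ℕ) : DiagramTerm n n
  | cup : DiagramTerm 0 2
  | cap : DiagramTerm 2 0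
  | comp {l m n : ℕ} (f : DiagramTerm l m) (g : DiagramTerm m n) : DiagramTerm l n
  | tensor {m n m' n' : ℕ} (f : DiagramTerm m n) (g : DiagramTerm m' n') :
      DiagramTerm (m + m') (n + n')

namespace DiagramTerm

/-- Transport along equalities of the numbers of dots. -/
def cast {m n m' n' : ℕ} (hm : m = m') (hn : n = n') (f : DiagramTerm m n) : DiagramTerm m' n' :=
  hm ▸ hn ▸ f

/-- Planar isotopy of diagrams: the congruence generated by the axioms of a strict monoidal
category (identities, associativity of stacking and of juxtaposition, independence of the heights
of horizontally separated pieces) and the two straightenings of a zigzag. No relation is imposed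
on closed loops. -/
inductive Isotopic : ∀ {m n : ℕ}, DiagramTerm m n → DiagramTerm m n → Prop
  | refl {m n} (f : DiagramTerm m n) : Isotopic f f
  | symm {m n} {f g : DiagramTerm m n} : Isotopic f g → Isotopic g f
  | trans {m n} {f g h : DiagramTerm m n} : Isotopic f g → Isotopic g h → Isotopic f h
  | comp {l m n} {f f' : DiagramTerm l m} {g g' : DiagramTerm m n} :
      Isotopic f f' → Isotopic g g' → Isotopic (f.comp g) (f'.comp g')
  | tensor {m n m' n'} {f f' : DiagramTerm m n} {g g' : DiagramTerm m' n'} :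
      Isotopic f f' → Isotopic g g' → Isotopic (f.tensor g) (f'.tensor g')
  | id_comp {m n} (f : DiagramTerm m n) : Isotopic ((id m).comp f) f
  | comp_id {m n} (f : DiagramTerm m n) : Isotopic (f.comp (id n)) f
  | comp_assoc {k l m n} (f : DiagramTerm k l) (g : DiagramTerm l m) (h : DiagramTerm m n) :
      Isotopic ((f.comp g).comp h) (f.comp (g.comp h))
  | id_tensor_id (m n : ℕ) : Isotopic ((id m).tensor (id n)) (id (m + n))
  | interchange {l m n l' m' n'} (f : DiagramTerm l m) (f' : DiagramTerm l' m')
      (g : DiagramTerm m n) (g' : DiagramTerm m' n') :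
      Isotopic ((f.tensor f').comp (g.tensor g')) ((f.comp g).tensor (f'.comp g'))
  | tensor_assoc {a b c a' b' c'} (f : DiagramTerm a a') (g : DiagramTerm b b')
      (h : DiagramTerm c c') :
      Isotopic (((f.tensor g).tensor h).cast (Nat.add_assoc a b c) (Nat.add_assoc a' b' c'))
        (f.tensor (g.tensor h))
  | empty_tensor {m n} (f : DiagramTerm m n) :
      Isotopic (((id 0).tensor f).cast (Nat.zero_add m) (Nat.zero_add n)) f
  | tensor_empty {m n} (f : DiagramTerm m n) : Isotopic (f.tensor (id 0)) f
  | zigzag_left : Isotopic ((cup.tensor (id 1)).comp ((id 1).tensor cap)) (id 1)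
  | zigzag_right : Isotopic (((id 1).tensor cup).comp (cap.tensor (id 1))) (id 1)

/-- Planar isotopy as a setoid. -/
instance isotopy (m n : ℕ) : Setoid (DiagramTerm m n) :=
  ⟨Isotopic, Isotopic.refl, Isotopic.symm, Isotopic.trans⟩

end DiagramTerm

open DiagramTerm

/-- Planar diagrams from `m` dots to `n` dots, up to planar isotopy. -/
def Diagram (m n : ℕ) : Type := _root_.Quotient (isotopy m n)

namespace Diagram

/-- Vertical stacking, the first argument at the bottom. -/
def comp {l m n : ℕ} : Diagram l m → Diagram m n → Diagram l n :=
  Quotient.map₂ DiagramTerm.comp fun _ _ h _ _ h' => Isotopic.comp h h'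

/-- Horizontal juxtaposition. -/
def tensor {m n m' n' : ℕ} : Diagram m n → Diagram m' n' → Diagram (m + m') (n + n') :=
  Quotient.map₂ DiagramTerm.tensor fun _ _ h _ _ h' => Isotopic.tensor h h'

end Diagram

/-- The category of planar diagrams; its objects are the natural numbers (wrapped, since `ℕ`
already carries the category structure of its order). -/
structure DiagramCat where
  /-- the number of dots -/
  dots : ℕ

namespace DiagramCat

instance : Category DiagramCat where
  Hom X Y := Diagram X.dots Y.dots
  id X := ⟦DiagramTerm.id X.dots⟧
  comp f g := Diagram.comp f g
  id_comp := by rintro X Y ⟨f⟩; exact Quotient.sound (Isotopic.id_comp f)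
  comp_id := by rintro X Y ⟨f⟩; exact Quotient.sound (Isotopic.comp_id f)
  assoc := by rintro W X Y Z ⟨f⟩ ⟨g⟩ ⟨h⟩; exact Quotient.sound (Isotopic.comp_assoc f g h)

/-- The diagram represented by an expression. -/
def ofTerm {m n : ℕ} (f : DiagramTerm m n) : (⟨m⟩ : DiagramCat) ⟶ ⟨n⟩ := (⟦f⟧ : Diagram m n)

/-- Equal numbers of dots give isomorphic objects. -/
def iso {m n : ℕ} (h : m = n) : (⟨m⟩ : DiagramCat) ≅ ⟨n⟩ := eqToIso (congrArg DiagramCat.mk h)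

instance : MonoidalCategoryStruct DiagramCat where
  tensorObj X Y := ⟨X.dots + Y.dots⟩
  tensorHom f g := Diagram.tensor f g
  whiskerLeft X _ _ f := Diagram.tensor (⟦DiagramTerm.id X.dots⟧ : Diagram X.dots X.dots) f
  whiskerRight f X := Diagram.tensor f (⟦DiagramTerm.id X.dots⟧ : Diagram X.dots X.dots)
  tensorUnit := ⟨0⟩
  associator X Y Z := iso (Nat.add_assoc X.dots Y.dots Z.dots)
  leftUnitor X := iso (Nat.zero_add X.dots)
  rightUnitor X := iso (Nat.add_zero X.dots)

theorem ofTerm_cast {m n m' n' : ℕ} (hm : m = m') (hn : n = n') (f : DiagramTerm m n) :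
    ofTerm (f.cast hm hn) = (iso hm).inv ≫ ofTerm f ≫ (iso hn).hom := by
  subst hm hn
  exact ((Category.id_comp _).trans (Category.comp_id _)).symm

theorem ofTerm_tensor {m n m' n' : ℕ} (f : DiagramTerm m n) (g : DiagramTerm m' n') :
    ofTerm (f.tensor g) = ofTerm f ⊗ₘ ofTerm g := rfl

theorem iso_tensor_id {m n : ℕ} (h : m = n) (k : ℕ) :
    (iso h).hom ⊗ₘ 𝟙 (⟨k⟩ : DiagramCat) = (iso (congrArg (· + k) h)).hom := by
  subst h; exact Quotient.sound (Isotopic.id_tensor_id m k)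

theorem id_tensor_iso {m n : ℕ} (h : m = n) (k : ℕ) :
    𝟙 (⟨k⟩ : DiagramCat) ⊗ₘ (iso h).hom = (iso (congrArg (k + ·) h)).hom := by
  subst h; exact Quotient.sound (Isotopic.id_tensor_id k m)

theorem iso_trans {l m n : ℕ} (h : l = m) (h' : m = n) :
    (iso h).hom ≫ (iso h').hom = (iso (h.trans h')).hom := by
  subst h h'; exact Category.id_comp _

instance : MonoidalCategory DiagramCat := MonoidalCategory.ofTensorHom
  (id_tensorHom_id := fun X Y => Quotient.sound (Isotopic.id_tensor_id X.dots Y.dots))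
  (id_tensorHom := fun _ _ _ _ => rfl)
  (tensorHom_id := fun _ _ => rfl)
  (tensorHom_comp_tensorHom := by
    rintro X₁ Y₁ Z₁ X₂ Y₂ Z₂ ⟨f₁⟩ ⟨f₂⟩ ⟨g₁⟩ ⟨g₂⟩
    exact Quotient.sound (Isotopic.interchange f₁ f₂ g₁ g₂))
  (associator_naturality := by
    rintro ⟨x₁⟩ ⟨x₂⟩ ⟨x₃⟩ ⟨y₁⟩ ⟨y₂⟩ ⟨y₃⟩ ⟨f₁⟩ ⟨f₂⟩ ⟨f₃⟩
    have h : ofTerm _ = ofTerm _ := Quotient.sound (Isotopic.tensor_assoc f₁ f₂ f₃)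
    rw [ofTerm_cast, Iso.inv_comp_eq] at h
    exact h)
  (leftUnitor_naturality := by
    rintro ⟨x⟩ ⟨y⟩ ⟨f⟩
    have h : ofTerm _ = ofTerm _ := Quotient.sound (Isotopic.empty_tensor f)
    rw [ofTerm_cast, Iso.inv_comp_eq] at h
    exact h)
  (rightUnitor_naturality := by
    rintro ⟨x⟩ ⟨y⟩ ⟨f⟩
    have h : ofTerm _ = ofTerm _ := Quotient.sound (Isotopic.tensor_empty f)
    have h' : ofTerm (f.tensor (DiagramTerm.id 0)) ≫ 𝟙 _ = 𝟙 _ ≫ ofTerm f :=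
      (Category.comp_id _).trans (h.trans (Category.id_comp _).symm)
    exact h')
  (pentagon := by
    rintro ⟨w⟩ ⟨x⟩ ⟨y⟩ ⟨z⟩
    change ((iso _).hom ⊗ₘ 𝟙 (⟨z⟩ : DiagramCat)) ≫ (iso _).hom ≫
      (𝟙 (⟨w⟩ : DiagramCat) ⊗ₘ (iso _).hom) = (iso _).hom ≫ (iso _).hom
    rw [iso_tensor_id, id_tensor_iso]
    exact (congrArg _ (iso_trans _ _)).trans ((iso_trans _ _).trans (iso_trans _ _).symm))
  (triangle := by
    rintro ⟨x⟩ ⟨y⟩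
    change (iso _).hom ≫ (𝟙 (⟨x⟩ : DiagramCat) ⊗ₘ (iso _).hom) =
      (iso _).hom ⊗ₘ 𝟙 (⟨y⟩ : DiagramCat)
    rw [iso_tensor_id, id_tensor_iso]
    exact iso_trans _ _)

/-- The cup, a diagram from no dots to two dots. -/
def cup : 𝟙_ DiagramCat ⟶ (⟨1⟩ ⊗ ⟨1⟩ : DiagramCat) := ofTerm DiagramTerm.cup

/-- The cap, a diagram from two dots to no dots. -/
def cap : (⟨1⟩ ⊗ ⟨1⟩ : DiagramCat) ⟶ 𝟙_ DiagramCat := ofTerm DiagramTerm.cap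

end DiagramCat
end Diagrams

section Kauffman
universe v u

section
variable {C : Type u} [Category.{v} C] [MonoidalCategory C] {A M N B M' N' : C}

theorem hb_unit (b : A ⊗ M ⟶ M ⊗ A) :
    (A ◁ (ρ_ M).hom) ≫ b ≫ ((ρ_ M).inv ▷ A) =
      (α_ A M (𝟙_ C)).inv ≫ b ▷ (𝟙_ C) ≫ (α_ M A (𝟙_ C)).hom ≫
        M ◁ ((ρ_ A).hom ≫ (λ_ A).inv) ≫ (α_ M (𝟙_ C) A).inv := by
  monoidal

theorem hb_succ (b : A ⊗ M ⟶ M ⊗ A) (b' : A ⊗ N ⟶ N ⊗ A) (s : A ⊗ B ⟶ B ⊗ A) :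
    (A ◁ (α_ M N B).inv) ≫
      ((α_ A (M ⊗ N) B).inv ≫
        (((α_ A M N).inv ≫ b ▷ N ≫ (α_ M A N).hom ≫ M ◁ b' ≫ (α_ M N A).inv) ▷ B) ≫
          (α_ (M ⊗ N) A B).hom ≫ (M ⊗ N) ◁ s ≫ (α_ (M ⊗ N) B A).inv) ≫ ((α_ M N B).hom ▷ A) =
    (α_ A M (N ⊗ B)).inv ≫ b ▷ (N ⊗ B) ≫ (α_ M A (N ⊗ B)).hom ≫
      M ◁ ((α_ A N B).inv ≫ b' ▷ B ≫ (α_ N A B).hom ≫ N ◁ s ≫ (α_ N B A).inv) ≫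
        (α_ M (N ⊗ B) A).inv := by
  monoidal

/-- Naturality of a half-braiding in a tensor product. -/
theorem hb_nat_tensor {b : A ⊗ M ⟶ M ⊗ A} {b' : A ⊗ N ⟶ N ⊗ A} {d : A ⊗ M' ⟶ M' ⊗ A}
    {d' : A ⊗ N' ⟶ N' ⊗ A} {f : M ⟶ M'} {g : N ⟶ N'} (hf : A ◁ f ≫ d = b ≫ f ▷ A)
    (hg : A ◁ g ≫ d' = b' ≫ g ▷ A) :
    A ◁ (f ⊗ₘ g) ≫ ((α_ A M' N').inv ≫ d ▷ N' ≫ (α_ M' A N').hom ≫ M' ◁ d' ≫ (α_ M' N' A).inv) =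
      ((α_ A M N).inv ≫ b ▷ N ≫ (α_ M A N).hom ≫ M ◁ b' ≫ (α_ M N A).inv) ≫ (f ⊗ₘ g) ▷ A := by
  calc _ = (α_ A M N).inv ≫ (A ⊗ M) ◁ g ≫ (A ◁ f ≫ d) ▷ N' ≫ (α_ M' A N').hom ≫ M' ◁ d' ≫
            (α_ M' N' A).inv := by
        rw [MonoidalCategory.tensorHom_def']; simp
    _ = (α_ A M N).inv ≫ ((A ⊗ M) ◁ g ≫ b ▷ N') ≫ f ▷ A ▷ N' ≫ (α_ M' A N').hom ≫ M' ◁ d' ≫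
            (α_ M' N' A).inv := by
        rw [hf]; simp
    _ = (α_ A M N).inv ≫ b ▷ N ≫ (M ⊗ A) ◁ g ≫ (α_ M A N').hom ≫ (f ▷ (A ⊗ N') ≫ M' ◁ d') ≫
            (α_ M' N' A).inv := by
        rw [whisker_exchange]; simp
    _ = (α_ A M N).inv ≫ b ▷ N ≫ (α_ M A N).hom ≫ M ◁ (A ◁ g ≫ d') ≫ f ▷ (N' ⊗ A) ≫
            (α_ M' N' A).inv := by
        rw [← whisker_exchange]; simp
    _ = _ := by
        rw [hg, MonoidalCategory.tensorHom_def']; simp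

/-- Naturality, in its first variable, of a braiding with a tensor product. -/
theorem hb_nat_tensor' {P Q : C} {f : P ⟶ Q} {b : P ⊗ M ⟶ M ⊗ P} {b' : P ⊗ N ⟶ N ⊗ P}
    {d : Q ⊗ M ⟶ M ⊗ Q} {d' : Q ⊗ N ⟶ N ⊗ Q} (hM : f ▷ M ≫ d = b ≫ M ◁ f)
    (hN : f ▷ N ≫ d' = b' ≫ N ◁ f) :
    f ▷ (M ⊗ N) ≫ ((α_ Q M N).inv ≫ d ▷ N ≫ (α_ M Q N).hom ≫ M ◁ d' ≫ (α_ M N Q).inv) =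
      ((α_ P M N).inv ≫ b ▷ N ≫ (α_ M P N).hom ≫ M ◁ b' ≫ (α_ M N P).inv) ≫ (M ⊗ N) ◁ f := by
  calc _ = (α_ P M N).inv ≫ (f ▷ M ≫ d) ▷ N ≫ (α_ M Q N).hom ≫ M ◁ d' ≫ (α_ M N Q).inv := by
        simp
    _ = (α_ P M N).inv ≫ b ▷ N ≫ (α_ M P N).hom ≫ M ◁ (f ▷ N ≫ d') ≫ (α_ M N Q).inv := by
        rw [hM]; simp
    _ = _ := by rw [hN]; simp

end

variable {C : Type u} [Category.{v} C] [Preadditive C] [Linear ℂ C] [MonoidalCategory C]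
  [MonoidalPreadditive C] [MonoidalLinear ℂ C] {A : C}

/-- The crossing `t • 1 + t⁻¹ • (cup ∘ cap)`. -/
def crossing (t : ℂ) (η : 𝟙_ C ⟶ A ⊗ A) (ε : A ⊗ A ⟶ 𝟙_ C) : A ⊗ A ⟶ A ⊗ A :=
  t • 𝟙 (A ⊗ A) + t⁻¹ • (ε ≫ η)

theorem crossing_inv {t : ℂ} (ht : t ≠ 0) {η : 𝟙_ C ⟶ A ⊗ A} {ε : A ⊗ A ⟶ 𝟙_ C}
    (hl : η ≫ ε = (-t ^ 2 - (t⁻¹) ^ 2) • 𝟙 (𝟙_ C)) :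
    crossing t η ε ≫ crossing t⁻¹ η ε = 𝟙 _ := by
  have h : (ε ≫ η) ≫ (ε ≫ η) = (-t ^ 2 - (t⁻¹) ^ 2) • (ε ≫ η) := by
    rw [Category.assoc, reassoc_of% hl, Linear.smul_comp, Linear.comp_smul, Category.id_comp]
  simp only [crossing, Preadditive.add_comp, Preadditive.comp_add, Linear.smul_comp,
    Linear.comp_smul, Category.id_comp, Category.comp_id, h, smul_smul, smul_add]
  match_scalars <;> field_simp
  ring

/-- The crossing as an isomorphism. -/
def crossingIso (t : ℂ) (ht : t ≠ 0) (η : 𝟙_ C ⟶ A ⊗ A) (ε : A ⊗ A ⟶ 𝟙_ C)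
    (hl : η ≫ ε = (-t ^ 2 - (t⁻¹) ^ 2) • 𝟙 (𝟙_ C)) : A ⊗ A ≅ A ⊗ A where
  hom := crossing t η ε
  inv := crossing t⁻¹ η ε
  hom_inv_id := crossing_inv ht hl
  inv_hom_id := by
    have h := crossing_inv (inv_ne_zero ht) (η := η) (ε := ε) (by
      rw [hl, inv_inv]; congr 1; ring)
    rwa [inv_inv] at h

theorem crossing_wl (t : ℂ) (η : 𝟙_ C ⟶ A ⊗ A) (ε : A ⊗ A ⟶ 𝟙_ C) :
    A ◁ crossing t η ε = t • 𝟙 _ + t⁻¹ • (A ◁ ε ≫ A ◁ η) := by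
  simp [crossing]

theorem crossing_wr (t : ℂ) (η : 𝟙_ C ⟶ A ⊗ A) (ε : A ⊗ A ⟶ 𝟙_ C) :
    crossing t η ε ▷ A = t • 𝟙 _ + t⁻¹ • (ε ▷ A ≫ η ▷ A) := by
  simp [crossing]

/-- Two-layer expansion of a pair of crossings. -/
theorem expand_two {X Y Z W : C} (t : ℂ) (ht : t ≠ 0) (x : X ⟶ Y) (p : Y ⟶ Y) (a : Y ≅ Z)
    (q : Z ⟶ Z) (y : Z ⟶ W) (r : X ⟶ W) (hp : x ≫ p ≫ a.hom ≫ y = r)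
    (hq : x ≫ a.hom ≫ q ≫ y = (-t ^ 2 - (t⁻¹) ^ 2) • (x ≫ a.hom ≫ y))
    (hpq : x ≫ p ≫ a.hom ≫ q ≫ y = x ≫ a.hom ≫ y) :
    x ≫ (t • 𝟙 _ + t⁻¹ • p) ≫ a.hom ≫ (t • 𝟙 _ + t⁻¹ • q) ≫ y = r := by
  simp only [Preadditive.add_comp, Preadditive.comp_add, Linear.smul_comp,
    Linear.comp_smul, Category.id_comp, hp, hq, hpq, smul_smul, smul_add]
  match_scalars <;> field_simp
  ring

theorem expand_two' {X Y Z W : C} (t : ℂ) (ht : t ≠ 0) (x : X ⟶ Y) (p : Y ⟶ Y) (a : Y ≅ Z)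
    (q : Z ⟶ Z) (y : Z ⟶ W) (r : X ⟶ W) (hq : x ≫ a.hom ≫ q ≫ y = r)
    (hp : x ≫ p ≫ a.hom ≫ y = (-t ^ 2 - (t⁻¹) ^ 2) • (x ≫ a.hom ≫ y))
    (hpq : x ≫ p ≫ a.hom ≫ q ≫ y = x ≫ a.hom ≫ y) :
    x ≫ (t • 𝟙 _ + t⁻¹ • p) ≫ a.hom ≫ (t • 𝟙 _ + t⁻¹ • q) ≫ y = r := by
  simp only [Preadditive.add_comp, Preadditive.comp_add, Linear.smul_comp,
    Linear.comp_smul, Category.id_comp, hp, hq, hpq, smul_smul, smul_add]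
  match_scalars <;> field_simp
  ring

variable {t : ℂ} {η : 𝟙_ C ⟶ A ⊗ A} {ε : A ⊗ A ⟶ 𝟙_ C}

theorem cup_slide (ht : t ≠ 0) (hl : η ≫ ε = (-t ^ 2 - (t⁻¹) ^ 2) • 𝟙 (𝟙_ C))
    (z₁ : A ◁ η ≫ (α_ A A A).inv ≫ ε ▷ A = (ρ_ A).hom ≫ (λ_ A).inv)
    (z₂ : η ▷ A ≫ (α_ A A A).hom ≫ A ◁ ε = (λ_ A).hom ≫ (ρ_ A).inv) :
    A ◁ η ≫ (α_ A A A).inv ≫ crossing t η ε ▷ A ≫ (α_ A A A).hom ≫ A ◁ crossing t η ε ≫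
      (α_ A A A).inv = ((ρ_ A).hom ≫ (λ_ A).inv) ≫ η ▷ A := by
  have hl' : A ◁ η ≫ A ◁ ε = (-t ^ 2 - (t⁻¹) ^ 2) • 𝟙 _ := by
    rw [← MonoidalCategory.whiskerLeft_comp, hl]; simp
  have h := expand_two t ht (A ◁ η ≫ (α_ A A A).inv) (ε ▷ A ≫ η ▷ A) (α_ A A A) (A ◁ ε ≫ A ◁ η)
    (α_ A A A).inv (((ρ_ A).hom ≫ (λ_ A).inv) ≫ η ▷ A)
    (by simp only [Category.assoc, reassoc_of% z₁, Iso.hom_inv_id, Category.comp_id])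
    (by simp only [Category.assoc, Iso.inv_hom_id_assoc, reassoc_of% hl', Linear.smul_comp,
          Category.id_comp])
    (by simp only [Category.assoc, reassoc_of% z₁, reassoc_of% z₂, Iso.inv_hom_id_assoc,
          Iso.hom_inv_id_assoc])
  rw [crossing_wl, crossing_wr]
  simpa only [Category.assoc] using h

theorem cap_slide (ht : t ≠ 0) (hl : η ≫ ε = (-t ^ 2 - (t⁻¹) ^ 2) • 𝟙 (𝟙_ C))
    (z₁ : A ◁ η ≫ (α_ A A A).inv ≫ ε ▷ A = (ρ_ A).hom ≫ (λ_ A).inv)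
    (z₂ : η ▷ A ≫ (α_ A A A).hom ≫ A ◁ ε = (λ_ A).hom ≫ (ρ_ A).inv) :
    ((α_ A A A).inv ≫ crossing t η ε ▷ A ≫ (α_ A A A).hom ≫ A ◁ crossing t η ε ≫
      (α_ A A A).inv) ≫ ε ▷ A = A ◁ ε ≫ (ρ_ A).hom ≫ (λ_ A).inv := by
  have hl' : η ▷ A ≫ ε ▷ A = (-t ^ 2 - (t⁻¹) ^ 2) • 𝟙 _ := by
    rw [← MonoidalCategory.comp_whiskerRight, hl]; simp
  have h := expand_two' t ht (α_ A A A).inv (ε ▷ A ≫ η ▷ A) (α_ A A A) (A ◁ ε ≫ A ◁ η)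
    ((α_ A A A).inv ≫ ε ▷ A) (A ◁ ε ≫ (ρ_ A).hom ≫ (λ_ A).inv)
    (by simp only [Category.assoc, z₁, Iso.inv_hom_id_assoc])
    (by simp only [Category.assoc, Iso.hom_inv_id_assoc, hl', Linear.comp_smul,
          Category.comp_id])
    (by simp only [Category.assoc, z₁, reassoc_of% z₂, Iso.inv_hom_id_assoc]; simp)
  rw [crossing_wl, crossing_wr]
  simpa only [Category.assoc] using h

theorem cup_slide' (ht : t ≠ 0) (hl : η ≫ ε = (-t ^ 2 - (t⁻¹) ^ 2) • 𝟙 (𝟙_ C))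
    (z₁ : A ◁ η ≫ (α_ A A A).inv ≫ ε ▷ A = (ρ_ A).hom ≫ (λ_ A).inv)
    (z₂ : η ▷ A ≫ (α_ A A A).hom ≫ A ◁ ε = (λ_ A).hom ≫ (ρ_ A).inv) :
    η ▷ A ≫ (α_ A A A).hom ≫ A ◁ crossing t η ε ≫ (α_ A A A).inv ≫ crossing t η ε ▷ A ≫
      (α_ A A A).hom = ((λ_ A).hom ≫ (ρ_ A).inv) ≫ A ◁ η := by
  have hl' : η ▷ A ≫ ε ▷ A = (-t ^ 2 - (t⁻¹) ^ 2) • 𝟙 _ := by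
    rw [← MonoidalCategory.comp_whiskerRight, hl]; simp
  have h := expand_two t ht (η ▷ A ≫ (α_ A A A).hom) (A ◁ ε ≫ A ◁ η) (α_ A A A).symm
    (ε ▷ A ≫ η ▷ A) (α_ A A A).hom (((λ_ A).hom ≫ (ρ_ A).inv) ≫ A ◁ η)
    (by simp only [Category.assoc, reassoc_of% z₂, Iso.symm_hom, Iso.inv_hom_id,
          Category.comp_id])
    (by simp only [Category.assoc, Iso.symm_hom, Iso.hom_inv_id_assoc, reassoc_of% hl',
          Linear.smul_comp, Category.id_comp])
    (by simp only [Category.assoc, reassoc_of% z₁, reassoc_of% z₂, Iso.symm_hom,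
          Iso.inv_hom_id_assoc, Iso.hom_inv_id_assoc])
  rw [crossing_wl, crossing_wr]
  simpa only [Category.assoc, Iso.symm_hom] using h

theorem cap_slide' (ht : t ≠ 0) (hl : η ≫ ε = (-t ^ 2 - (t⁻¹) ^ 2) • 𝟙 (𝟙_ C))
    (z₁ : A ◁ η ≫ (α_ A A A).inv ≫ ε ▷ A = (ρ_ A).hom ≫ (λ_ A).inv)
    (z₂ : η ▷ A ≫ (α_ A A A).hom ≫ A ◁ ε = (λ_ A).hom ≫ (ρ_ A).inv) :
    ((α_ A A A).hom ≫ A ◁ crossing t η ε ≫ (α_ A A A).inv ≫ crossing t η ε ▷ A ≫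
      (α_ A A A).hom) ≫ A ◁ ε = ε ▷ A ≫ (λ_ A).hom ≫ (ρ_ A).inv := by
  have hl' : A ◁ η ≫ A ◁ ε = (-t ^ 2 - (t⁻¹) ^ 2) • 𝟙 _ := by
    rw [← MonoidalCategory.whiskerLeft_comp, hl]; simp
  have h := expand_two' t ht (α_ A A A).hom (A ◁ ε ≫ A ◁ η) (α_ A A A).symm (ε ▷ A ≫ η ▷ A)
    ((α_ A A A).hom ≫ A ◁ ε) (ε ▷ A ≫ (λ_ A).hom ≫ (ρ_ A).inv)
    (by simp only [Category.assoc, z₂, Iso.symm_hom, Iso.hom_inv_id_assoc])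
    (by simp only [Category.assoc, Iso.symm_hom, hl', Linear.comp_smul, Category.comp_id,
          Iso.inv_hom_id_assoc])
    (by simp only [Category.assoc, Iso.symm_hom, z₂, reassoc_of% z₁, Iso.hom_inv_id_assoc]; simp)
  rw [crossing_wl, crossing_wr]
  simpa only [Category.assoc, Iso.symm_hom] using h

end Kauffman

section TemperleyLieb

/-- `t = exp (π i / (2 k + 4))`. -/
def rootT (k : ℕ) : ℂ := Complex.exp (Real.pi * Complex.I / (2 * k + 4))

/-- `q = t ^ 2`. -/
def rootQ (k : ℕ) : ℂ := rootT k ^ 2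

/-- The quantum integer `[i] = (q ^ i - q ^ (-i)) / (q - q ^ (-1))`. -/
def qInt (k i : ℕ) : ℂ := (rootQ k ^ i - (rootQ k)⁻¹ ^ i) / (rootQ k - (rootQ k)⁻¹)

/-- The loop value `δ = -q - q⁻¹`. -/
def loopValue (k : ℕ) : ℂ := -rootQ k - (rootQ k)⁻¹

theorem rootT_ne_zero (k : ℕ) : rootT k ≠ 0 := Complex.exp_ne_zero _

theorem loopValue_eq (k : ℕ) : loopValue k = -rootT k ^ 2 - ((rootT k)⁻¹) ^ 2 := by
  rw [loopValue, rootQ, inv_pow]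

/-- The relation "a loop equals `δ`", as an endomorphism of the empty object. -/
def loopRelation (k : ℕ) : 𝟙_ (Linearization DiagramCat) ⟶ 𝟙_ (Linearization DiagramCat) :=
  Linearization.ι (DiagramCat.cup ≫ DiagramCat.cap) - loopValue k • 𝟙 _

/-- `ℂ`-linear combinations of planar diagrams modulo the relation that every loop is equal
to `δ`, before any completion. -/
abbrev PreTL (k : ℕ) : Type := TensorQuotient (loopRelation k)

namespace PreTL
variable {k : ℕ}

/-- The object `n` (that is, `n` strands). -/
def strands (k n : ℕ) : PreTL k := ⟨⟨⟨n⟩⟩⟩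

/-- The morphism given by a planar diagram. -/
def ofDiagram {X Y : DiagramCat} (f : X ⟶ Y) : (⟨⟨X⟩⟩ : PreTL k) ⟶ ⟨⟨Y⟩⟩ :=
  (toQuot (loopRelation k)).map (Linearization.ι f)

theorem ofDiagram_comp {X Y Z : DiagramCat} (f : X ⟶ Y) (g : Y ⟶ Z) :
    (ofDiagram (f ≫ g) : (⟨⟨X⟩⟩ : PreTL k) ⟶ _) = ofDiagram f ≫ ofDiagram g :=
  (congrArg _ (Linearization.ι_comp f g)).trans (Functor.map_comp _ _ _)

theorem ofDiagram_tensor {X Y X' Y' : DiagramCat} (f : X ⟶ Y) (g : X' ⟶ Y') :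
    (ofDiagram (f ⊗ₘ g) : (⟨⟨X ⊗ X'⟩⟩ : PreTL k) ⟶ _) = ofDiagram f ⊗ₘ ofDiagram g :=
  (congrArg _ (Linearization.ι_tensor f g)).trans (toQuot_tensor _ _ _).symm

theorem ofDiagram_wl (Z : DiagramCat) {X Y : DiagramCat} (f : X ⟶ Y) :
    (ofDiagram (Z ◁ f) : (⟨⟨Z ⊗ X⟩⟩ : PreTL k) ⟶ _) = (⟨⟨Z⟩⟩ : PreTL k) ◁ ofDiagram f :=
  congrArg _ (Linearization.ι_wl Z f)

theorem ofDiagram_wr (Z : DiagramCat) {X Y : DiagramCat} (f : X ⟶ Y) :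
    (ofDiagram (f ▷ Z) : (⟨⟨X ⊗ Z⟩⟩ : PreTL k) ⟶ _) = ofDiagram f ▷ (⟨⟨Z⟩⟩ : PreTL k) :=
  congrArg _ (Linearization.ι_wr Z f)

/-- The cup. -/
def cup (k : ℕ) : 𝟙_ (PreTL k) ⟶ strands k 1 ⊗ strands k 1 := ofDiagram DiagramCat.cup

/-- The cap. -/
def cap (k : ℕ) : strands k 1 ⊗ strands k 1 ⟶ 𝟙_ (PreTL k) := ofDiagram DiagramCat.cap

theorem loop (k : ℕ) : cup k ≫ cap k = loopValue k • 𝟙 (𝟙_ (PreTL k)) := by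
  have h : idealRel (loopRelation k) (Linearization.ι (DiagramCat.cup ≫ DiagramCat.cap))
    (loopValue k • 𝟙 (𝟙_ (Linearization DiagramCat))) := TensorIdeal.of
  have h' := toQuot_eq _ h
  exact (ofDiagram_comp _ _).symm.trans h'

theorem assoc_one (m n : ℕ) :
    (α_ (strands k m) (strands k n) (strands k 1)).hom = 𝟙 (strands k (m + n + 1)) := rfl

theorem assoc_one_inv (m n : ℕ) :
    (α_ (strands k m) (strands k n) (strands k 1)).inv = 𝟙 (strands k (m + n + 1)) := rfl

theorem rightUnitor_eq (m : ℕ) : (ρ_ (strands k m)).hom = 𝟙 (strands k m) := rfl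
theorem rightUnitor_inv_eq (m : ℕ) : (ρ_ (strands k m)).inv = 𝟙 (strands k m) := rfl
theorem leftUnitor_one : (λ_ (strands k 1)).hom = 𝟙 (strands k 1) := rfl

theorem zigzag₁ : strands k 1 ◁ cup k ≫ (α_ (strands k 1) (strands k 1) (strands k 1)).inv ≫
    cap k ▷ strands k 1 = (ρ_ (strands k 1)).hom ≫ (λ_ (strands k 1)).inv := by
  have h : DiagramCat.ofTerm _ = DiagramCat.ofTerm _ :=
    Quotient.sound DiagramTerm.Isotopic.zigzag_right
  have h' := congrArg (ofDiagram (k := k)) h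
  refine Eq.trans ?_ (h'.trans ?_)
  · rw [assoc_one_inv]
    erw [Category.id_comp]
    refine Eq.trans ?_ (ofDiagram_comp (k := k) (Y := ⟨3⟩) ((⟨1⟩ : DiagramCat) ◁ DiagramCat.cup) (DiagramCat.cap ▷ (⟨1⟩ : DiagramCat))).symm
    rw [cup, cap]
    erw [ofDiagram_wl, ofDiagram_wr]
    rfl
  · exact (Category.id_comp _).symm

theorem zigzag₂ : cup k ▷ strands k 1 ≫ (α_ (strands k 1) (strands k 1) (strands k 1)).hom ≫
    strands k 1 ◁ cap k = (λ_ (strands k 1)).hom ≫ (ρ_ (strands k 1)).inv := by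
  have h : DiagramCat.ofTerm _ = DiagramCat.ofTerm _ :=
    Quotient.sound DiagramTerm.Isotopic.zigzag_left
  have h' := congrArg (ofDiagram (k := k)) h
  refine Eq.trans ?_ (h'.trans ?_)
  · rw [assoc_one]
    erw [Category.id_comp]
    refine Eq.trans ?_ (ofDiagram_comp (k := k) (Y := ⟨3⟩) (DiagramCat.cup ▷ (⟨1⟩ : DiagramCat)) ((⟨1⟩ : DiagramCat) ◁ DiagramCat.cap)).symm
    rw [cup, cap]
    erw [ofDiagram_wl, ofDiagram_wr]
    rfl
  · exact (Category.id_comp _).symm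

end PreTL
end TemperleyLieb

section Braiding
namespace PreTL
variable {k : ℕ}

/-- The braiding `σ₁,₁ = t • 1 + t⁻¹ • (cup ∘ cap)` of one strand with itself. -/
def crossingOne (k : ℕ) : strands k 1 ⊗ strands k 1 ≅ strands k 1 ⊗ strands k 1 :=
  crossingIso (rootT k) (rootT_ne_zero k) (cup k) (cap k) (by rw [loop, loopValue_eq])

/-- The braiding of one strand with `n` strands, by the hexagon axiom:
`σ₁,ₙ₊₁ = (1ₙ ⊗ σ₁,₁) ∘ (σ₁,ₙ ⊗ 1₁)`. -/
def braidOne (k : ℕ) : (n : ℕ) → (strands k 1 ⊗ strands k n ≅ strands k n ⊗ strands k 1)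
  | 0 => ρ_ (strands k 1) ≪≫ (λ_ (strands k 1)).symm
  | n + 1 => (α_ (strands k 1) (strands k n) (strands k 1)).symm ≪≫
      whiskerRightIso (braidOne k n) (strands k 1) ≪≫
      α_ (strands k n) (strands k 1) (strands k 1) ≪≫
      whiskerLeftIso (strands k n) (crossingOne k) ≪≫
      (α_ (strands k n) (strands k 1) (strands k 1)).symm

theorem braidOne_succ_hom (n : ℕ) : (braidOne k (n + 1)).hom =
    (α_ (strands k 1) (strands k n) (strands k 1)).inv ≫ (braidOne k n).hom ▷ strands k 1 ≫
      (α_ (strands k n) (strands k 1) (strands k 1)).hom ≫ strands k n ◁ (crossingOne k).hom ≫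
      (α_ (strands k n) (strands k 1) (strands k 1)).inv := rfl

theorem id_sandwich {C : Type*} [Category C] [MonoidalCategory C] {A M N : C} (b : A ⊗ M ⟶ N ⊗ A) :
    A ◁ 𝟙 M ≫ b ≫ 𝟙 N ▷ A = b := by simp

theorem braidOne_add (m n : ℕ) : (braidOne k (m + n)).hom =
    (α_ (strands k 1) (strands k m) (strands k n)).inv ≫ (braidOne k m).hom ▷ strands k n ≫
      (α_ (strands k m) (strands k 1) (strands k n)).hom ≫ strands k m ◁ (braidOne k n).hom ≫
      (α_ (strands k m) (strands k n) (strands k 1)).inv := by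
  induction n with
  | zero => exact (id_sandwich (braidOne k m).hom).symm.trans (hb_unit (braidOne k m).hom)
  | succ n ih =>
    have h := hb_succ (braidOne k m).hom (braidOne k n).hom (crossingOne k).hom
    rw [← ih] at h
    exact (id_sandwich (braidOne k (m + n + 1)).hom).symm.trans h

/-- Induction principle for morphisms. -/
theorem hom_induction {P : ∀ {m n : ℕ}, (strands k m ⟶ strands k n) → Prop}
    (h0 : ∀ m n, P (0 : strands k m ⟶ strands k n))
    (ha : ∀ {m n} (f g : strands k m ⟶ strands k n), P f → P g → P (f + g))
    (hs : ∀ {m n} (r : ℂ) (f : strands k m ⟶ strands k n), P f → P (r • f))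
    (hid : ∀ n, P (𝟙 (strands k n)))
    (hcup : P (m := 0) (n := 2) (cup k)) (hcap : P (m := 2) (n := 0) (cap k))
    (hcomp : ∀ {l m n} (f : strands k l ⟶ strands k m) (g : strands k m ⟶ strands k n),
      P f → P g → P (f ≫ g))
    (htensor : ∀ {m n m' n'} (f : strands k m ⟶ strands k n) (g : strands k m' ⟶ strands k n'),
      P f → P g → P (m := m + m') (n := n + n') (f ⊗ₘ g))
    {m n : ℕ} (f : strands k m ⟶ strands k n) : P f := by
  obtain ⟨f, rfl⟩ := toQuot_surj _ f
  induction f using Linearization.hom_induction with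
  | h0 => exact h0 m n
  | ha f g hf hg => exact ha _ _ hf hg
  | hs r f =>
    refine hs r (ofDiagram f) ?_
    obtain ⟨f⟩ := f
    have key : ∀ {m n : ℕ} (f : DiagramTerm m n), P (m := m) (n := n)
        (ofDiagram (DiagramCat.ofTerm f)) := by
      intro m n f
      induction f with
      | id n => exact hid n
      | cup => exact hcup
      | cap => exact hcap
      | comp f g hf hg =>
        have h := hcomp _ _ hf hg
        have e := ofDiagram_comp (k := k) (DiagramCat.ofTerm f) (DiagramCat.ofTerm g)
        exact e.symm ▸ h
      | tensor f g hf hg =>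
        have h := htensor _ _ hf hg
        have e := ofDiagram_tensor (k := k) (DiagramCat.ofTerm f) (DiagramCat.ofTerm g)
        exact e.symm ▸ h
    exact key f

theorem braidOne_one : (braidOne k 1).hom = (crossingOne k).hom := by
  have h {A B : PreTL k} (s : A ⊗ B ⟶ B ⊗ A) : A ◁ (λ_ B).hom ≫ s ≫ (λ_ B).inv ▷ A =
      (α_ A (𝟙_ _) B).inv ≫ ((ρ_ A).hom ≫ (λ_ A).inv) ▷ B ≫ (α_ (𝟙_ _) A B).hom ≫
        𝟙_ _ ◁ s ≫ (α_ (𝟙_ _) B A).inv := by monoidal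
  exact (h (crossingOne k).hom).symm.trans (id_sandwich (crossingOne k).hom)

theorem braidOne_nat {m n : ℕ} (f : strands k m ⟶ strands k n) :
    strands k 1 ◁ f ≫ (braidOne k n).hom = (braidOne k m).hom ≫ f ▷ strands k 1 := by
  induction f using hom_induction with
  | h0 => simp
  | ha f g hf hg => simp [hf, hg]
  | hs r f hf => simp [hf]
  | hid => simp
  | hcup =>
    have h := cup_slide (rootT_ne_zero k) (by rw [loop, loopValue_eq]) (zigzag₁ (k := k)) zigzag₂
    refine Eq.trans ?_ h
    rw [braidOne_add 1 1, braidOne_one]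
    rfl
  | hcap =>
    have h := cap_slide (rootT_ne_zero k) (by rw [loop, loopValue_eq]) (zigzag₁ (k := k)) zigzag₂
    refine Eq.trans ?_ (h.symm.trans ?_)
    · rfl
    rw [braidOne_add 1 1, braidOne_one]
    rfl
  | hcomp f g hf hg =>
    rw [whiskerLeft_comp, Category.assoc, hg, ← Category.assoc, hf, Category.assoc,
      comp_whiskerRight]
  | htensor f g hf hg =>
    have h := hb_nat_tensor hf hg
    rw [← braidOne_add, ← braidOne_add] at h
    exact h

end PreTL
end Braiding

section BraidingTwo
namespace PreTL
variable {k : ℕ}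

/-- The half-braiding of one strand. -/
def halfBraidingOne (k : ℕ) : HalfBraiding (strands k 1) where
  β U := braidOne k U.as.base.dots
  monoidal U V := braidOne_add U.as.base.dots V.as.base.dots
  naturality f := braidOne_nat f

/-- The half-braiding of `n` strands, by the hexagon axiom:
`σₙ₊₁,ᵤ = (σₙ,ᵤ ⊗ 1₁) ∘ (1ₙ ⊗ σ₁,ᵤ)`. -/
def halfBraiding (k : ℕ) : (n : ℕ) → HalfBraiding (strands k n)
  | 0 => Center.tensorUnit.2
  | n + 1 => (Center.tensorObj ⟨strands k n, halfBraiding k n⟩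
      ⟨strands k 1, halfBraidingOne k⟩).2

/-- `n` strands with their half-braiding. -/
def central (k n : ℕ) : Center (PreTL k) := ⟨strands k n, halfBraiding k n⟩

/-- One strand with its half-braiding. -/
def centralOne (k : ℕ) : Center (PreTL k) := ⟨strands k 1, halfBraidingOne k⟩

theorem eq_of_id_comm {C : Type*} [Category C] [MonoidalCategory C] {A U : C}
    (b c : A ⊗ U ⟶ U ⊗ A) (h : 𝟙 A ▷ U ≫ b = c ≫ U ◁ 𝟙 A) : b = c := by
  simpa using h

theorem eq_of_id_comm' {C : Type*} [Category C] [MonoidalCategory C] {A B U : C}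
    (b c : (A ⊗ B) ⊗ U ⟶ U ⊗ (A ⊗ B)) (h : (𝟙 A ▷ B) ▷ U ≫ b = c ≫ U ◁ (𝟙 A ▷ B)) : b = c := by
  simpa using h

theorem id_comm_of_eq {C : Type*} [Category C] [MonoidalCategory C] {A U : C}
    (b c : A ⊗ U ⟶ U ⊗ A) (h : c = b) : 𝟙 A ▷ U ≫ b = c ≫ U ◁ 𝟙 A := by
  simpa using h.symm

theorem halfBraiding_add (m n : ℕ) (U : PreTL k) : ((halfBraiding k (m + n)).β U).hom =
    ((Center.tensorObj (central k m) (central k n)).2.β U).hom := by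
  induction n generalizing U with
  | zero =>
    have h := (Center.rightUnitor (central k m)).hom.comm U
    exact eq_of_id_comm (A := strands k m) (((halfBraiding k m).β U).hom) _ h
  | succ n ih =>
    let f : central k (m + n) ⟶ Center.tensorObj (central k m) (central k n) :=
      ⟨𝟙 (strands k (m + n)), fun U => id_comm_of_eq (A := strands k (m + n)) _ _ (ih U)⟩
    have h := eq_of_id_comm' (A := strands k (m + n)) (B := strands k 1) _ _
      ((Center.whiskerRight f (centralOne k)).comm U)
    have h2 := eq_of_id_comm (A := strands k (m + n + 1)) _ _
      ((Center.associator (central k m) (central k n) (centralOne k)).hom.comm U)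
    exact h.symm.trans h2.symm

theorem halfBraiding_unit {C : Type*} [Category C] [MonoidalCategory C] {A : C}
    (H : HalfBraiding A) : (H.β (𝟙_ C)).hom = (ρ_ A).hom ≫ (λ_ A).inv := by
  have h := H.naturality (λ_ (𝟙_ C)).hom
  have h' : ((α_ A (𝟙_ C) (𝟙_ C)).inv ≫ ((H.β (𝟙_ C)).hom ≫ (λ_ A).hom) ▷ 𝟙_ C) ≫
      (H.β (𝟙_ C)).hom = A ◁ (λ_ (𝟙_ C)).hom ≫ (H.β (𝟙_ C)).hom := by
    rw [h, HalfBraiding.monoidal]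
    monoidal
  rw [cancel_mono, Iso.inv_comp_eq, triangle, ← tensorHom_id, ← tensorHom_id] at h'
  rw [tensorHom_id, tensorHom_id, whiskerRight_iff] at h'
  rw [← h', Category.assoc, Iso.hom_inv_id, Category.comp_id]

theorem halfBraiding_one (U : PreTL k) :
    ((halfBraiding k 1).β U).hom = (braidOne k U.as.base.dots).hom :=
  (eq_of_id_comm (A := strands k 1) ((halfBraidingOne k).β U).hom _
    ((Center.leftUnitor (centralOne k)).hom.comm U)).symm

theorem halfBraiding_two : ((halfBraiding k 2).β (strands k 1)).hom =
    (α_ (strands k 1) (strands k 1) (strands k 1)).hom ≫ strands k 1 ◁ (crossingOne k).hom ≫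
    (α_ (strands k 1) (strands k 1) (strands k 1)).inv ≫ (crossingOne k).hom ▷ strands k 1 ≫
    (α_ (strands k 1) (strands k 1) (strands k 1)).hom := by
  have h := halfBraiding_one (strands k 1)
  rw [← braidOne_one]
  change (α_ (strands k 1) (strands k 1) (strands k 1)).hom ≫ strands k 1 ◁ (braidOne k 1).hom ≫
    (α_ (strands k 1) (strands k 1) (strands k 1)).inv ≫
      ((halfBraiding k 1).β (strands k 1)).hom ▷ strands k 1 ≫
    (α_ (strands k 1) (strands k 1) (strands k 1)).hom = _
  rw [h]
  rfl

theorem halfBraiding_nat_of_one {A B : PreTL k} (f : A ⟶ B) (H : HalfBraiding A)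
    (H' : HalfBraiding B) (h : f ▷ strands k 1 ≫ (H'.β (strands k 1)).hom =
      (H.β (strands k 1)).hom ≫ strands k 1 ◁ f) (p : ℕ) :
    f ▷ strands k p ≫ (H'.β (strands k p)).hom = (H.β (strands k p)).hom ≫ strands k p ◁ f := by
  induction p with
  | zero =>
    have e := halfBraiding_unit H
    have e' := halfBraiding_unit H'
    change f ▷ 𝟙_ _ ≫ (H'.β (𝟙_ _)).hom = (H.β (𝟙_ _)).hom ≫ 𝟙_ _ ◁ f
    rw [e, e']
    simp
  | succ p ih =>
    have e := hb_nat_tensor' ih h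
    rw [← HalfBraiding.monoidal, ← HalfBraiding.monoidal] at e
    exact e

theorem halfBraiding_nat {m n : ℕ} (f : strands k m ⟶ strands k n) (U : PreTL k) :
    f ▷ U ≫ ((halfBraiding k n).β U).hom = ((halfBraiding k m).β U).hom ≫ U ◁ f := by
  induction f using hom_induction generalizing U with
  | h0 => simp
  | ha f g hf hg => simp [hf, hg]
  | hs r f hf => simp [hf]
  | hid => simp
  | hcup =>
    refine halfBraiding_nat_of_one (cup k) (halfBraiding k 0) (halfBraiding k 2) ?_ U.as.base.dots
    have h := cup_slide' (rootT_ne_zero k) (by rw [loop, loopValue_eq]) (zigzag₁ (k := k)) zigzag₂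
    rw [halfBraiding_two]
    exact h
  | hcap =>
    refine halfBraiding_nat_of_one (cap k) (halfBraiding k 2) (halfBraiding k 0) ?_ U.as.base.dots
    have h := cap_slide' (rootT_ne_zero k) (by rw [loop, loopValue_eq]) (zigzag₁ (k := k)) zigzag₂
    rw [halfBraiding_two]
    exact h.symm
  | hcomp f g hf hg =>
    rw [comp_whiskerRight, Category.assoc, hg, ← Category.assoc, hf, Category.assoc,
      whiskerLeft_comp]
  | @htensor m n m' n' f g hf hg =>
    rw [halfBraiding_add, halfBraiding_add]
    exact (Center.tensorHom (X₁ := central k m) (Y₁ := central k n) (X₂ := central k m')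
      (Y₂ := central k n') ⟨f, hf⟩ ⟨g, hg⟩).comm U

theorem hexagon_aux {C : Type*} [Category C] [MonoidalCategory C] {X Y Z : C}
    (b : X ⊗ Y ⟶ Y ⊗ X) (c : X ⊗ Z ⟶ Z ⊗ X) :
    (α_ X Y Z).hom ≫ ((α_ X Y Z).inv ≫ b ▷ Z ≫ (α_ Y X Z).hom ≫ Y ◁ c ≫ (α_ Y Z X).inv) ≫
      (α_ Y Z X).hom = b ▷ Z ≫ (α_ Y X Z).hom ≫ Y ◁ c := by simp

theorem hexagon_aux' {C : Type*} [Category C] [MonoidalCategory C] {X Y Z : C}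
    (b : X ⊗ Z ⟶ Z ⊗ X) (c : Y ⊗ Z ⟶ Z ⊗ Y) :
    (α_ X Y Z).inv ≫ ((α_ X Y Z).hom ≫ X ◁ c ≫ (α_ X Z Y).inv ≫ b ▷ Y ≫ (α_ Z X Y).hom) ≫
      (α_ Z X Y).inv = X ◁ c ≫ (α_ X Z Y).inv ≫ b ▷ Y := by simp

/-- The braiding generated by `σ₁,₁` through the hexagon axioms. -/
instance : BraidedCategory (PreTL k) where
  braiding X Y := (halfBraiding k X.as.base.dots).β Y
  braiding_naturality_right X _ _ f := HalfBraiding.naturality _ f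
  braiding_naturality_left {X Y} f Z :=
    halfBraiding_nat (m := X.as.base.dots) (n := Y.as.base.dots) f Z
  hexagon_forward X Y Z := by
    rw [HalfBraiding.monoidal]
    exact hexagon_aux (X := X) _ _
  hexagon_reverse X Y Z := by
    have h := halfBraiding_add X.as.base.dots Y.as.base.dots Z
    change (α_ X Y Z).inv ≫ ((halfBraiding k (X.as.base.dots + Y.as.base.dots)).β Z).hom ≫
      (α_ Z X Y).inv = _
    rw [h]
    exact hexagon_aux' (X := X) (Y := Y) _ _

theorem braiding_one_one : (β_ (strands k 1) (strands k 1)).hom =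
    rootT k • 𝟙 (strands k 1 ⊗ strands k 1) + (rootT k)⁻¹ • (cap k ≫ cup k) :=
  (halfBraiding_one (strands k 1)).trans braidOne_one

end PreTL
end BraidingTwo

section JonesWenzl

theorem rootQ_pow (k i : ℕ) : rootQ k ^ i = Complex.exp (Real.pi * i / (k + 2) * Complex.I) := by
  rw [rootQ, rootT, ← pow_mul, ← Complex.exp_nat_mul]
  congr 1
  have : (k : ℂ) + 2 ≠ 0 := by exact_mod_cast (by omega : k + 2 ≠ 0)
  have : 2 * (k : ℂ) + 4 ≠ 0 := by exact_mod_cast (by omega : 2 * k + 4 ≠ 0)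
  push_cast
  field_simp
  ring

theorem qInt_num (k i : ℕ) : rootQ k ^ i - (rootQ k)⁻¹ ^ i =
    2 * Complex.I * (Real.sin (Real.pi * i / (k + 2)) : ℝ) := by
  rw [inv_pow, rootQ_pow, ← Complex.exp_neg, Complex.ofReal_sin, Complex.sin]
  push_cast
  rw [neg_mul]
  linear_combination (Complex.exp (Real.pi * i / (k + 2) * Complex.I) -
    Complex.exp (-(Real.pi * i / (k + 2) * Complex.I))) * Complex.I_sq

theorem qInt_num_ne_zero (k i : ℕ) (hi : 1 ≤ i) (hik : i ≤ k + 1) :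
    rootQ k ^ i - (rootQ k)⁻¹ ^ i ≠ 0 := by
  rw [qInt_num]
  refine mul_ne_zero (mul_ne_zero two_ne_zero Complex.I_ne_zero) ?_
  have h1 : (1 : ℝ) ≤ i := by exact_mod_cast hi
  have h2 : (i : ℝ) ≤ k + 1 := by exact_mod_cast hik
  refine Complex.ofReal_ne_zero.2 (Real.sin_pos_of_pos_of_lt_pi (by positivity) ?_).ne'
  rw [div_lt_iff₀ (by positivity)]
  nlinarith [Real.pi_pos]

theorem rootQ_sub_ne_zero (k : ℕ) : rootQ k - (rootQ k)⁻¹ ≠ 0 := by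
  simpa using qInt_num_ne_zero k 1 le_rfl (by omega)

theorem qInt_ne_zero (k i : ℕ) (hi : 1 ≤ i) (hik : i ≤ k + 1) : qInt k i ≠ 0 :=
  div_ne_zero (qInt_num_ne_zero k i hi hik) (rootQ_sub_ne_zero k)

theorem rootQ_ne_zero (k : ℕ) : rootQ k ≠ 0 := pow_ne_zero 2 (rootT_ne_zero k)

theorem qInt_zero (k : ℕ) : qInt k 0 = 0 := by simp [qInt]

theorem qInt_one (k : ℕ) : qInt k 1 = 1 := by
  simpa [qInt] using div_self (rootQ_sub_ne_zero k)

theorem qInt_rec (k i : ℕ) : loopValue k * qInt k (i + 1) + qInt k i = -qInt k (i + 2) := by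
  have h := rootQ_ne_zero k
  have h' := rootQ_sub_ne_zero k
  rw [qInt, qInt, qInt, loopValue, mul_div_assoc', ← add_div, ← neg_div]
  congr 1
  have e : rootQ k * (rootQ k)⁻¹ = 1 := mul_inv_cancel₀ h
  rw [pow_succ, pow_succ, pow_succ, pow_succ]
  linear_combination ((rootQ k)⁻¹ ^ i - rootQ k ^ i) * e

theorem temperleyLieb_aux {C : Type*} [Category C] [MonoidalCategory C] {A : C}
    {η : 𝟙_ C ⟶ A ⊗ A} {ε : A ⊗ A ⟶ 𝟙_ C}
    (z₁ : A ◁ η ≫ (α_ A A A).inv ≫ ε ▷ A = (ρ_ A).hom ≫ (λ_ A).inv)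
    (z₂ : η ▷ A ≫ (α_ A A A).hom ≫ A ◁ ε = (λ_ A).hom ≫ (ρ_ A).inv) :
    A ◁ (ε ≫ η) ≫ (α_ A A A).inv ≫ (ε ≫ η) ▷ A ≫ (α_ A A A).hom ≫ A ◁ (ε ≫ η) =
      A ◁ (ε ≫ η) := by
  simp only [MonoidalCategory.whiskerLeft_comp, comp_whiskerRight, Category.assoc]
  rw [reassoc_of% z₁, reassoc_of% z₂]
  simp

namespace PreTL
variable {k : ℕ}

/-- Juxtaposition of one strand on the right. -/
def addStrand {m n : ℕ} (f : strands k m ⟶ strands k n) :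
    strands k (m + 1) ⟶ strands k (n + 1) := f ▷ strands k 1

theorem addStrand_comp {l m n : ℕ} (f : strands k l ⟶ strands k m)
    (g : strands k m ⟶ strands k n) : addStrand (f ≫ g) = addStrand f ≫ addStrand g :=
  comp_whiskerRight f g _

theorem addStrand_id (n : ℕ) : addStrand (𝟙 (strands k n)) = 𝟙 _ := id_whiskerRight _ _

theorem addStrand_add {m n : ℕ} (f g : strands k m ⟶ strands k n) :
    addStrand (f + g) = addStrand f + addStrand g := MonoidalPreadditive.add_whiskerRight _ _

theorem addStrand_smul {m n : ℕ} (r : ℂ) (f : strands k m ⟶ strands k n) :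
    addStrand (r • f) = r • addStrand f := MonoidalLinear.smul_whiskerRight r f _

/-- `U_{n+1} = 1ₙ ⊗ (cup ∘ cap)` on `n + 2` strands. -/
def hook (k n : ℕ) : strands k (n + 2) ⟶ strands k (n + 2) := strands k n ◁ (cap k ≫ cup k)

theorem hook_sq (n : ℕ) : hook k n ≫ hook k n = loopValue k • hook k n := by
  have h : (cap k ≫ cup k) ≫ (cap k ≫ cup k) = loopValue k • (cap k ≫ cup k) := by
    rw [Category.assoc, ← Category.assoc (cup k), loop, Linear.smul_comp, Linear.comp_smul,
      Category.id_comp]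
  have h' := congrArg (fun x => strands k n ◁ x) h
  simp only [MonoidalLinear.whiskerLeft_smul, MonoidalCategory.whiskerLeft_comp _ (cap k ≫ cup k)] at h'
  exact h'

theorem hook_comm {m n : ℕ} (f : strands k m ⟶ strands k n) :
    addStrand (addStrand f) ≫ hook k n = hook k m ≫ addStrand (addStrand f) := by
  have h : addStrand (addStrand f) = f ▷ (strands k 1 ⊗ strands k 1) := by
    rw [whiskerRight_tensor]
    exact ((Category.id_comp _).trans (Category.comp_id _)).symm
  rw [h]
  exact (whisker_exchange f (cap k ≫ cup k)).symm

theorem hook_succ (n : ℕ) : hook k (n + 1) = strands k n ◁ (strands k 1 ◁ (cap k ≫ cup k)) :=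
  (tensor_whiskerLeft (strands k n) (strands k 1) (cap k ≫ cup k)).trans
    ((Category.id_comp _).trans (Category.comp_id _))

theorem addStrand_hook (n : ℕ) : addStrand (hook k n) =
    strands k n ◁ ((cap k ≫ cup k) ▷ strands k 1) :=
  (whisker_assoc (strands k n) (cap k ≫ cup k) (strands k 1)).trans
    ((Category.id_comp _).trans (Category.comp_id _))

theorem hook_hook (n : ℕ) :
    hook k (n + 1) ≫ addStrand (hook k n) ≫ hook k (n + 1) = hook k (n + 1) := by
  have h := temperleyLieb_aux (zigzag₁ (k := k)) zigzag₂
  have h' := congrArg (fun x => strands k n ◁ x) h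
  have e : (cap k ≫ cup k) ▷ strands k 1 = (α_ (strands k 1) (strands k 1) (strands k 1)).inv ≫
      (cap k ≫ cup k) ▷ strands k 1 ≫ (α_ (strands k 1) (strands k 1) (strands k 1)).hom :=
    ((Category.id_comp _).trans (Category.comp_id _)).symm
  rw [hook_succ, addStrand_hook, e]
  refine Eq.trans ?_ h'
  have w {A M N P Q R : PreTL k} (f : M ⟶ N) (g : N ⟶ P) (h : P ⟶ Q) (i : Q ⟶ R) (j : R ⟶ M) :
      A ◁ f ≫ A ◁ (g ≫ h ≫ i) ≫ A ◁ j = A ◁ (f ≫ g ≫ h ≫ i ≫ j) := by simp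
  exact w _ _ _ _ _

/-- The Jones–Wenzl idempotents: `f₀ = 1`, `f₁ = 1` and
`fₙ = fₙ₋₁ ⊗ 1 + ([n-1]/[n]) (fₙ₋₁ ⊗ 1) ∘ Uₙ₋₁ ∘ (fₙ₋₁ ⊗ 1)` (meaningful for `n ≤ k + 1`). -/
def jonesWenzl (k : ℕ) : (n : ℕ) → (strands k n ⟶ strands k n)
  | 0 => 𝟙 _
  | 1 => 𝟙 _
  | n + 2 => addStrand (jonesWenzl k (n + 1)) + (qInt k (n + 1) / qInt k (n + 2)) •
      (addStrand (jonesWenzl k (n + 1)) ≫ hook k n ≫ addStrand (jonesWenzl k (n + 1)))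

theorem jonesWenzl_aux (n : ℕ) (hn : n ≤ k) :
    jonesWenzl k (n + 1) ≫ jonesWenzl k (n + 1) = jonesWenzl k (n + 1) ∧
    addStrand (jonesWenzl k n) ≫ jonesWenzl k (n + 1) = jonesWenzl k (n + 1) ∧
    jonesWenzl k (n + 1) ≫ addStrand (jonesWenzl k n) = jonesWenzl k (n + 1) ∧
    hook k n ≫ addStrand (jonesWenzl k (n + 1)) ≫ hook k n =
      (-(qInt k (n + 2) / qInt k (n + 1))) •
        (addStrand (addStrand (jonesWenzl k n)) ≫ hook k n) := by
  induction n with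
  | zero =>
    have h := qInt_rec k 0
    rw [qInt_zero] at h
    simp only [jonesWenzl, addStrand_id, Category.id_comp, hook_sq, qInt_one, true_and,
      Nat.zero_add, div_one] at *
    rw [← h]; simp
  | succ n ih =>
    obtain ⟨i2, i3, i3r, i4⟩ := ih (by omega)
    have q1 := qInt_ne_zero k (n + 1) (by omega) (by omega)
    have q2 := qInt_ne_zero k (n + 2) (by omega) (by omega)
    have ig : addStrand (jonesWenzl k (n + 1)) ≫ addStrand (jonesWenzl k (n + 1)) =
      addStrand (jonesWenzl k (n + 1)) := by rw [← addStrand_comp, i2]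
    have i5 := congrArg addStrand i3r
    rw [addStrand_comp] at i5
    refine ⟨?_, ?_, ?_, ?_⟩
    · have e : addStrand (jonesWenzl k (n + 1)) ≫ hook k n ≫ addStrand (jonesWenzl k (n + 1)) ≫
          hook k n ≫ addStrand (jonesWenzl k (n + 1)) = (-(qInt k (n + 2) / qInt k (n + 1))) •
          (addStrand (jonesWenzl k (n + 1)) ≫ hook k n ≫ addStrand (jonesWenzl k (n + 1))) := by
        have h := congrArg (fun x => addStrand (jonesWenzl k (n + 1)) ≫ x ≫
          addStrand (jonesWenzl k (n + 1))) i4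
        simpa only [Category.assoc, Linear.smul_comp, Linear.comp_smul, reassoc_of% i5] using h
      simp only [jonesWenzl, Preadditive.comp_add, Preadditive.add_comp, Linear.comp_smul,
        Linear.smul_comp, Category.assoc, ig, reassoc_of% ig, e, smul_smul, smul_add]
      match_scalars <;> field_simp
      ring
    · simp only [jonesWenzl, Preadditive.comp_add, Linear.comp_smul, ig, reassoc_of% ig]
    · simp only [jonesWenzl, Preadditive.add_comp, Linear.smul_comp, Category.assoc, ig]
    · have c := hook_comm (jonesWenzl k (n + 1))
      have h := hook_hook (k := k) n
      have igg := congrArg addStrand ig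
      rw [addStrand_comp] at igg
      have r := qInt_rec k (n + 1)
      have e1 : hook k (n + 1) ≫ addStrand (addStrand (jonesWenzl k (n + 1))) ≫ hook k (n + 1) =
          loopValue k • (addStrand (addStrand (jonesWenzl k (n + 1))) ≫ hook k (n + 1)) := by
        rw [← reassoc_of% c, hook_sq, Linear.comp_smul]
      have e2 : hook k (n + 1) ≫ addStrand (addStrand (jonesWenzl k (n + 1))) ≫
          addStrand (hook k n) ≫ addStrand (addStrand (jonesWenzl k (n + 1))) ≫ hook k (n + 1) =
          addStrand (addStrand (jonesWenzl k (n + 1))) ≫ hook k (n + 1) := by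
        rw [← reassoc_of% c, c, reassoc_of% h, ← c, reassoc_of% igg]
      rw [jonesWenzl]
      simp only [addStrand_add, addStrand_smul, addStrand_comp, Preadditive.add_comp,
        Preadditive.comp_add, Linear.smul_comp, Linear.comp_smul, Category.assoc, e1, e2]
      rw [← add_smul]
      congr 1
      field_simp
      linear_combination r

theorem jonesWenzl_idem (n : ℕ) (hn : n ≤ k + 1) :
    jonesWenzl k n ≫ jonesWenzl k n = jonesWenzl k n := by
  cases n with
  | zero => exact Category.id_comp _
  | succ n => exact (jonesWenzl_aux n (by omega)).1

end PreTL
end JonesWenzl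

section Twists
universe v u
variable {C : Type u} [Category.{v} C] [MonoidalCategory C] [BraidedCategory C] {X : C}

/-- The left twist `(e ⊗ 1) ∘ (ι ⊗ σ) ∘ (c ⊗ 1)` of a self-dual object `X` of a braided monoidal
category with evaluation `e`, coevaluation `c` and pivotal isomorphism `ι : X → Xᵛᵛ = X`. -/
def leftTwist (e : X ⊗ X ⟶ 𝟙_ C) (c : 𝟙_ C ⟶ X ⊗ X) (ι : X ≅ X) : X ⟶ X :=
  (λ_ X).inv ≫ c ▷ X ≫ (α_ X X X).hom ≫ (ι.hom ⊗ₘ (β_ X X).hom) ≫ (α_ X X X).inv ≫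
    e ▷ X ≫ (λ_ X).hom

/-- The right twist `(1 ⊗ e) ∘ (σ ⊗ ι⁻¹) ∘ (1 ⊗ c)` of a self-dual object `X`. -/
def rightTwist (e : X ⊗ X ⟶ 𝟙_ C) (c : 𝟙_ C ⟶ X ⊗ X) (ι : X ≅ X) : X ⟶ X :=
  (ρ_ X).inv ≫ X ◁ c ≫ (α_ X X X).inv ≫ ((β_ X X).hom ⊗ₘ ι.inv) ≫ (α_ X X X).hom ≫
    X ◁ e ≫ (ρ_ X).hom

end Twists

section Reduced
open Idempotents

/-- The `j` nested caps, from `j + j` dots to no dots (the innermost cap is at the bottom). -/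
def nestedCaps : (j : ℕ) → DiagramTerm (j + j) 0
  | 0 => DiagramTerm.id 0
  | j + 1 => DiagramTerm.comp
      ((DiagramTerm.tensor (DiagramTerm.id j)
        (DiagramTerm.tensor DiagramTerm.cap (DiagramTerm.id j))).cast
          (show j + (2 + j) = (j + 1) + (j + 1) by omega) (show j + (0 + j) = j + j by omega))
      (nestedCaps j)

/-- The `j` nested cups, from no dots to `j + j` dots (the innermost cup is at the top). -/
def nestedCups : (j : ℕ) → DiagramTerm 0 (j + j)
  | 0 => DiagramTerm.id 0
  | j + 1 => DiagramTerm.comp (nestedCups j)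
      ((DiagramTerm.tensor (DiagramTerm.id j)
        (DiagramTerm.tensor DiagramTerm.cup (DiagramTerm.id j))).cast
          (show j + (0 + j) = j + j by omega) (show j + (2 + j) = (j + 1) + (j + 1) by omega))

/-- The Temperley–Lieb category: the additive and idempotent completion of linear combinations of
planar diagrams modulo "loop equals `δ`". -/
abbrev TL (k : ℕ) : Type 1 := Karoubi (Mat_ (PreTL k))

namespace TL

/-- The object of `j` strands in the additive completion. -/
def strands (k j : ℕ) : Mat_ (PreTL k) := (Mat_.embedding (PreTL k)).obj (PreTL.strands k j)

/-- The object `F_j = (j, f_j)`. -/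
def jonesWenzlObj (k j : ℕ) (hj : j ≤ k + 1) : TL k where
  X := strands k j
  p := (Mat_.embedding (PreTL k)).map (PreTL.jonesWenzl k j)
  idem := ((Mat_.embedding (PreTL k)).map_comp _ _).symm.trans
    (congrArg _ (PreTL.jonesWenzl_idem j hj))

/-- The `j` nested caps as a morphism of the additive completion. -/
def caps (k j : ℕ) : strands k j ⊗ strands k j ⟶ 𝟙_ (Mat_ (PreTL k)) :=
  fun _ _ => PreTL.ofDiagram (DiagramCat.ofTerm (nestedCaps j))

/-- The `j` nested cups as a morphism of the additive completion. -/
def cups (k j : ℕ) : 𝟙_ (Mat_ (PreTL k)) ⟶ strands k j ⊗ strands k j :=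
  fun _ _ => PreTL.ofDiagram (DiagramCat.ofTerm (nestedCups j))

/-- The morphism `g φ f : (x, f) ⟶ (y, g)` of the idempotent completion given by `φ : x ⟶ y`. -/
def compress {C : Type*} [Category C] {P Q : Karoubi C} (φ : P.X ⟶ Q.X) : P ⟶ Q where
  f := P.p ≫ φ ≫ Q.p
  comm := by simp only [Category.assoc, Q.idem, P.idem_assoc]

/-- The evaluation `e_j : F_j ⊗ F_j ⟶ 𝟙`. -/
def ev (k j : ℕ) (hj : j ≤ k + 1) : jonesWenzlObj k j hj ⊗ jonesWenzlObj k j hj ⟶ 𝟙_ (TL k) :=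
  compress (caps k j)

/-- The coevaluation `c_j : 𝟙 ⟶ F_j ⊗ F_j`. -/
def coev (k j : ℕ) (hj : j ≤ k + 1) : 𝟙_ (TL k) ⟶ jonesWenzlObj k j hj ⊗ jonesWenzlObj k j hj :=
  compress (cups k j)

end TL

/-- The reduced Temperley–Lieb category: the quotient of `TL` by the tensor ideal generated by
(the identity of) `F_{k+1}`. -/
abbrev ReducedTL (k : ℕ) : Type 1 := TensorQuotient (𝟙 (TL.jonesWenzlObj k (k + 1) le_rfl))

namespace ReducedTL

/-- The quotient functor. -/
abbrev proj (k : ℕ) : TL k ⥤ ReducedTL k := toQuot (𝟙 (TL.jonesWenzlObj k (k + 1) le_rfl))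

/-- The object `F_j` of the reduced category. -/
def jonesWenzlObj (k j : ℕ) (hj : j ≤ k + 1) : ReducedTL k := (proj k).obj (TL.jonesWenzlObj k j hj)

/-- The evaluation of `F_j` in the reduced category. -/
def ev (k j : ℕ) (hj : j ≤ k + 1) :
    jonesWenzlObj k j hj ⊗ jonesWenzlObj k j hj ⟶ 𝟙_ (ReducedTL k) := (proj k).map (TL.ev k j hj)

/-- The coevaluation of `F_j` in the reduced category. -/
def coev (k j : ℕ) (hj : j ≤ k + 1) :
    𝟙_ (ReducedTL k) ⟶ jonesWenzlObj k j hj ⊗ jonesWenzlObj k j hj := (proj k).map (TL.coev k j hj)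

end ReducedTL
end Reduced

end

end TLJ

/-!
A curl of `j + 1` nested strands is a curl of the innermost strand, which contributes `-t ^ 3`,
composed with a curl of the other `j` strands and a full twist of the single strand around them.
The Jones–Wenzl idempotent `f` kills every hook, so each crossing `t • 𝟙 + t⁻¹ • hook` acts on it
as `t`, the full twist acts as `t ^ (2 * j)`, and `-t ^ (2 * j + 3)` is the ratio of consecutive
values of `(-1) ^ j * t ^ (j ^ 2 + 2 * j)`.

Modulo hooks `f` is the identity, and nested caps turn a hook on one leg into a hook on the other.
Hence `(f ⊗ f)` followed by the caps is `(1 ⊗ f)` followed by the caps, so that zigzags and curls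
of the nested diagrams restrict to the image of `f`. Braiding two nested cups on their left legs or
on their right legs gives the same morphism, so the right curl is the transpose of the left curl
across the coevaluation, and by the zigzag identity it is the same scalar.
-/

namespace TLJ

noncomputable section

/-! ### Partial traces, curls and zigzags -/

section PartialTrace
universe v u
variable {C : Type u} [Category.{v} C] [MonoidalCategory C]
  {X Y Z W V X₁ X₂ X₃ Y₁ Y₂ Y₃ : C}

/-- The partial trace over `X` on the left, for an evaluation `e : Y ⊗ X ⟶ 𝟙` and a
coevaluation `c : 𝟙 ⟶ Y ⊗ X` which need not satisfy any zigzag identity. -/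
def leftTrace (e : Y ⊗ X ⟶ 𝟙_ C) (c : 𝟙_ C ⟶ Y ⊗ X) (g : X ⊗ Z ⟶ X ⊗ W) : Z ⟶ W :=
  (λ_ Z).inv ≫ c ▷ Z ≫ (α_ Y X Z).hom ≫ Y ◁ g ≫ (α_ Y X W).inv ≫ e ▷ W ≫ (λ_ W).hom

/-- The evaluation on `(Y₂ ⊗ Y₁) ⊗ (X₁ ⊗ X₂)` with `e₁` nested inside `e₂`. -/
def nestEv (e₁ : Y₁ ⊗ X₁ ⟶ 𝟙_ C) (e₂ : Y₂ ⊗ X₂ ⟶ 𝟙_ C) :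
    (Y₂ ⊗ Y₁) ⊗ (X₁ ⊗ X₂) ⟶ 𝟙_ C :=
  (α_ Y₂ Y₁ (X₁ ⊗ X₂)).hom ≫ Y₂ ◁ ((α_ Y₁ X₁ X₂).inv ≫ e₁ ▷ X₂ ≫ (λ_ X₂).hom) ≫ e₂

/-- The coevaluation on `(Y₂ ⊗ Y₁) ⊗ (X₁ ⊗ X₂)` with `c₁` nested inside `c₂`. -/
def nestCoev (c₁ : 𝟙_ C ⟶ Y₁ ⊗ X₁) (c₂ : 𝟙_ C ⟶ Y₂ ⊗ X₂) :
    𝟙_ C ⟶ (Y₂ ⊗ Y₁) ⊗ (X₁ ⊗ X₂) :=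
  c₂ ≫ Y₂ ◁ ((λ_ X₂).inv ≫ c₁ ▷ X₂ ≫ (α_ Y₁ X₁ X₂).hom) ≫ (α_ Y₂ Y₁ (X₁ ⊗ X₂)).inv

/-- The endomorphism of `Y` obtained by straightening a coevaluation `c` against an
evaluation `e`; the zigzag identity for the pair `(c, e)` says that it is the identity. -/
def zigzag (c : 𝟙_ C ⟶ Y ⊗ X) (e : X ⊗ Y ⟶ 𝟙_ C) : Y ⟶ Y :=
  (λ_ Y).inv ≫ c ▷ Y ≫ (α_ Y X Y).hom ≫ Y ◁ e ≫ (ρ_ Y).hom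

theorem leftTrace_comp_left (e : Y ⊗ X ⟶ 𝟙_ C) (c : 𝟙_ C ⟶ Y ⊗ X) (h : Z ⟶ W)
    (g : X ⊗ W ⟶ X ⊗ V) : leftTrace e c (X ◁ h ≫ g) = h ≫ leftTrace e c g := by
  simp only [leftTrace]
  rw [leftUnitor_inv_naturality_assoc, whisker_exchange_assoc]
  simp

theorem leftTrace_comp_right (e : Y ⊗ X ⟶ 𝟙_ C) (c : 𝟙_ C ⟶ Y ⊗ X) (g : X ⊗ Z ⟶ X ⊗ W)
    (h : W ⟶ V) : leftTrace e c (g ≫ X ◁ h) = leftTrace e c g ≫ h := by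
  simp only [leftTrace, Category.assoc]
  rw [← leftUnitor_naturality, ← whisker_exchange_assoc]
  simp

theorem leftTrace_whiskerRight (e : Y ⊗ X ⟶ 𝟙_ C) (c : 𝟙_ C ⟶ Y ⊗ X) (g : X ⊗ Z ⟶ X ⊗ W) :
    leftTrace e c ((α_ X Z V).inv ≫ g ▷ V ≫ (α_ X W V).hom) = leftTrace e c g ▷ V := by
  simp only [leftTrace]
  monoidal

theorem leftTrace_slide {Y' : C} (e : Y' ⊗ X ⟶ 𝟙_ C) (c : 𝟙_ C ⟶ Y ⊗ X) (h : Y ⟶ Y')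
    (g : X ⊗ Z ⟶ X ⊗ W) : leftTrace e (c ≫ h ▷ X) g = leftTrace (h ▷ X ≫ e) c g := by
  simp only [leftTrace, comp_whiskerRight, Category.assoc, associator_naturality_left_assoc]
  rw [← whisker_exchange_assoc]
  simp

theorem leftTrace_nest (e₁ : Y₁ ⊗ X₁ ⟶ 𝟙_ C) (e₂ : Y₂ ⊗ X₂ ⟶ 𝟙_ C) (c₁ : 𝟙_ C ⟶ Y₁ ⊗ X₁)
    (c₂ : 𝟙_ C ⟶ Y₂ ⊗ X₂) (g : (X₁ ⊗ X₂) ⊗ Z ⟶ (X₁ ⊗ X₂) ⊗ W) :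
    leftTrace (nestEv e₁ e₂) (nestCoev c₁ c₂) g =
      leftTrace e₂ c₂ (leftTrace e₁ c₁ ((α_ X₁ X₂ Z).inv ≫ g ≫ (α_ X₁ X₂ W).hom)) := by
  simp only [leftTrace, nestEv, nestCoev]
  monoidal

theorem zigzag_nest (c₁ : 𝟙_ C ⟶ Y₁ ⊗ X₁) (c₂ : 𝟙_ C ⟶ Y₂ ⊗ X₂) (e₁ : X₁ ⊗ Y₁ ⟶ 𝟙_ C)
    (e₂ : X₂ ⊗ Y₂ ⟶ 𝟙_ C) :
    zigzag (nestCoev c₁ c₂) (nestEv e₂ e₁) = zigzag c₂ e₂ ⊗ₘ zigzag c₁ e₁ := by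
  calc
    _ = 𝟙 _ ⊗≫ c₂ ▷ (Y₂ ⊗ Y₁) ⊗≫
          Y₂ ◁ (c₁ ▷ ((X₂ ⊗ Y₂) ⊗ Y₁) ≫ (Y₁ ⊗ X₁) ◁ (e₂ ▷ Y₁)) ⊗≫ (Y₂ ⊗ Y₁) ◁ e₁ ⊗≫ 𝟙 _ := by
      simp only [zigzag, nestEv, nestCoev]
      monoidal
    _ = _ := by
      rw [← whisker_exchange, MonoidalCategory.tensorHom_def]
      simp only [zigzag]
      monoidal

theorem zigzag_comp_whiskerRight (c : 𝟙_ C ⟶ Y ⊗ X) (e : X ⊗ Y ⟶ 𝟙_ C) (f : Y ⟶ Y) :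
    zigzag (c ≫ f ▷ X) e = zigzag c e ≫ f := by
  simp only [zigzag, comp_whiskerRight, Category.assoc, associator_naturality_left_assoc]
  rw [← whisker_exchange_assoc, rightUnitor_naturality]

theorem retract_comp_ev {P : C} (h : Retract P X) (e : X ⊗ X ⟶ 𝟙_ C)
    (he : (h.r ≫ h.i ⊗ₘ h.r ≫ h.i) ≫ e = X ◁ (h.r ≫ h.i) ≫ e) :
    h.r ▷ P ≫ (h.i ⊗ₘ h.i) ≫ e = X ◁ h.i ≫ e := by
  calc
    _ = X ◁ h.i ≫ (h.r ≫ h.i ⊗ₘ h.r ≫ h.i) ≫ e := by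
      simp [← tensorHom_id, ← id_tensorHom, tensorHom_comp_tensorHom_assoc]
    _ = _ := by
      rw [he, ← MonoidalCategory.whiskerLeft_comp_assoc, h.retract_assoc]

theorem zigzag_of_retract {P : C} (h : Retract P X) (e : X ⊗ X ⟶ 𝟙_ C) (c : 𝟙_ C ⟶ X ⊗ X)
    (he : (h.r ≫ h.i ⊗ₘ h.r ≫ h.i) ≫ e = X ◁ (h.r ≫ h.i) ≫ e) :
    zigzag (c ≫ (h.r ⊗ₘ h.r)) ((h.i ⊗ₘ h.i) ≫ e) = h.i ≫ zigzag c e ≫ h.r := by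
  calc
    _ = 𝟙 P ⊗≫ c ▷ P ⊗≫ (h.r ▷ (X ⊗ P) ≫ P ◁ (h.r ▷ P ≫ (h.i ⊗ₘ h.i) ≫ e)) ⊗≫ 𝟙 P := by
      simp only [zigzag, MonoidalCategory.tensorHom_def h.r]
      monoidal
    _ = 𝟙 P ⊗≫ (c ▷ P ≫ (X ⊗ X) ◁ h.i) ⊗≫ X ◁ e ⊗≫ h.r ⊗≫ 𝟙 P := by
      rw [retract_comp_ev h e he, ← whisker_exchange]
      monoidal
    _ = _ := by
      rw [← whisker_exchange]
      simp only [zigzag]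
      monoidal

theorem zigzag_comp_whiskerLeft {X' : C} (c : 𝟙_ C ⟶ Y ⊗ X) (s : X ⟶ X') (e : X' ⊗ Y ⟶ 𝟙_ C) :
    zigzag (c ≫ Y ◁ s) e = zigzag c (s ▷ Y ≫ e) := by
  simp [zigzag]

theorem zigzag_unit : zigzag (λ_ (𝟙_ C)).inv (λ_ (𝟙_ C)).hom = 𝟙 (𝟙_ C) := by
  simp only [zigzag]
  monoidal

theorem nestEv_unit_inner (e : Y ⊗ X ⟶ 𝟙_ C) :
    nestEv (λ_ (𝟙_ C)).hom e = (ρ_ Y).hom ▷ (𝟙_ C ⊗ X) ≫ Y ◁ (λ_ X).hom ≫ e := by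
  simp only [nestEv]
  monoidal

theorem nestEv_unit_outer (e : Y ⊗ X ⟶ 𝟙_ C) :
    nestEv e (λ_ (𝟙_ C)).hom = (λ_ Y).hom ▷ (X ⊗ 𝟙_ C) ≫ Y ◁ (ρ_ X).hom ≫ e := by
  simp only [nestEv]
  monoidal

theorem nestEv_comp_inner (e₁ : Y₁ ⊗ X₁ ⟶ 𝟙_ C) (e₂ : Y₂ ⊗ X₂ ⟶ 𝟙_ C) (s : W ⟶ X₁) :
    nestEv (Y₁ ◁ s ≫ e₁) e₂ = (Y₂ ⊗ Y₁) ◁ (s ▷ X₂) ≫ nestEv e₁ e₂ := by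
  simp only [nestEv]
  monoidal

theorem nestEv_comp_outer (e₁ : Y₁ ⊗ X₁ ⟶ 𝟙_ C) (e₂ : Y₂ ⊗ X₂ ⟶ 𝟙_ C) (s : W ⟶ X₂) :
    nestEv e₁ (Y₂ ◁ s ≫ e₂) = (Y₂ ⊗ Y₁) ◁ (X₁ ◁ s) ≫ nestEv e₁ e₂ := by
  calc
    _ = 𝟙 _ ⊗≫ Y₂ ◁ (e₁ ▷ W ≫ 𝟙_ C ◁ s) ⊗≫ e₂ := by
      simp only [nestEv]
      monoidal
    _ = _ := by
      rw [← whisker_exchange]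
      simp only [nestEv]
      monoidal

theorem nestEv_nestEv (e₁ : Y₁ ⊗ X₁ ⟶ 𝟙_ C) (e₂ : Y₂ ⊗ X₂ ⟶ 𝟙_ C) (e₃ : Y₃ ⊗ X₃ ⟶ 𝟙_ C) :
    nestEv e₁ (nestEv e₂ e₃) = (α_ Y₃ Y₂ Y₁).hom ▷ _ ≫ _ ◁ (α_ X₁ X₂ X₃).inv ≫
      nestEv (nestEv e₁ e₂) e₃ := by
  simp only [nestEv]
  monoidal

/-- `g` and `h` are mates under the evaluation `e`: an endomorphism `g` of the left leg of `e`
can be moved to the right leg, where it becomes `h`. -/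
def IsMate (e : Y ⊗ X ⟶ 𝟙_ C) (g : Y ⟶ Y) (h : X ⟶ X) : Prop := g ▷ X ≫ e = Y ◁ h ≫ e

theorem IsMate.conj {e : Y ⊗ X ⟶ 𝟙_ C} {g : Y ⟶ Y} {h : X ⟶ X} (H : IsMate e g h) (s : X ≅ Z) :
    IsMate (Y ◁ s.inv ≫ e) g (s.inv ≫ h ≫ s.hom) := by
  rw [IsMate, ← whisker_exchange_assoc, H]
  simp

theorem IsMate.nestEv_inner {e₁ : Y₁ ⊗ X₁ ⟶ 𝟙_ C} {g : Y₁ ⟶ Y₁} {h : X₁ ⟶ X₁}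
    (H : IsMate e₁ g h) (e₂ : Y₂ ⊗ X₂ ⟶ 𝟙_ C) :
    IsMate (nestEv e₁ e₂) (Y₂ ◁ g) (h ▷ X₂) := by
  calc
    _ = nestEv (g ▷ X₁ ≫ e₁) e₂ := by
      simp only [nestEv]
      monoidal
    _ = _ := by rw [H, nestEv_comp_inner]

theorem IsMate.nestEv_outer {e₂ : Y₂ ⊗ X₂ ⟶ 𝟙_ C} {g : Y₂ ⟶ Y₂} {h : X₂ ⟶ X₂}
    (H : IsMate e₂ g h) (e₁ : Y₁ ⊗ X₁ ⟶ 𝟙_ C) :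
    IsMate (nestEv e₁ e₂) (g ▷ Y₁) (X₁ ◁ h) := by
  calc
    _ = nestEv e₁ (g ▷ X₂ ≫ e₂) := by
      rw [nestEv, nestEv, associator_naturality_left_assoc, whisker_exchange_assoc]
    _ = _ := by rw [H, nestEv_comp_outer]

theorem isMate_nestEv_of_zigzag {A : C} {η : 𝟙_ C ⟶ A ⊗ A} {ε : A ⊗ A ⟶ 𝟙_ C}
    (z₁ : A ◁ η ≫ (α_ A A A).inv ≫ ε ▷ A = (ρ_ A).hom ≫ (λ_ A).inv)
    (z₂ : η ▷ A ≫ (α_ A A A).hom ≫ A ◁ ε = (λ_ A).hom ≫ (ρ_ A).inv) :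
    IsMate (nestEv ε ε) (ε ≫ η) (ε ≫ η) := by
  have left : η ▷ (A ⊗ A) ≫ nestEv ε ε = (λ_ (A ⊗ A)).hom ≫ ε := by
    calc
      _ = (α_ (𝟙_ C) A A).inv ≫ (η ▷ A ≫ (α_ A A A).hom ≫ A ◁ ε) ▷ A ≫ (ρ_ A).hom ▷ A ≫ ε := by
        simp only [nestEv]
        monoidal
      _ = _ := by
        rw [z₂]
        monoidal
  have right : (A ⊗ A) ◁ η ≫ nestEv ε ε = (ρ_ (A ⊗ A)).hom ≫ ε := by
    calc
      _ = (α_ A A (𝟙_ C)).hom ≫ A ◁ (A ◁ η ≫ (α_ A A A).inv ≫ ε ▷ A) ≫ A ◁ (λ_ A).hom ≫ ε := by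
        simp only [nestEv]
        monoidal
      _ = _ := by
        rw [z₁]
        monoidal
  rw [IsMate, comp_whiskerRight, MonoidalCategory.whiskerLeft_comp, Category.assoc,
    Category.assoc, left, right, ← leftUnitor_naturality, ← whisker_exchange_assoc, unitors_equal,
    rightUnitor_naturality]

section Linear
variable [Preadditive C]

theorem leftTrace_add [MonoidalPreadditive C] (e : Y ⊗ X ⟶ 𝟙_ C) (c : 𝟙_ C ⟶ Y ⊗ X)
    (g h : X ⊗ Z ⟶ X ⊗ W) :
    leftTrace e c (g + h) = leftTrace e c g + leftTrace e c h := by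
  simp [leftTrace]

variable {R : Type*} [CommRing R] [Linear R C] [MonoidalPreadditive C] [MonoidalLinear R C]

theorem leftTrace_smul (e : Y ⊗ X ⟶ 𝟙_ C) (c : 𝟙_ C ⟶ Y ⊗ X) (r : R) (g : X ⊗ Z ⟶ X ⊗ W) :
    leftTrace e c (r • g) = r • leftTrace e c g := by
  simp [leftTrace]

theorem zigzag_smul (c : 𝟙_ C ⟶ Y ⊗ X) (e : X ⊗ Y ⟶ 𝟙_ C) (r : R) :
    zigzag (r • c) e = r • zigzag c e := by
  simp [zigzag]

end Linear

section Crossing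
variable [Preadditive C] [Linear ℂ C] [MonoidalPreadditive C] [MonoidalLinear ℂ C]

theorem leftTrace_crossing {A : C} {t : ℂ}
    {η : 𝟙_ C ⟶ A ⊗ A} {ε : A ⊗ A ⟶ 𝟙_ C} (ht : t ≠ 0)
    (hl : η ≫ ε = (-t ^ 2 - (t⁻¹) ^ 2) • 𝟙 (𝟙_ C))
    (z₁ : A ◁ η ≫ (α_ A A A).inv ≫ ε ▷ A = (ρ_ A).hom ≫ (λ_ A).inv)
    (z₂ : η ▷ A ≫ (α_ A A A).hom ≫ A ◁ ε = (λ_ A).hom ≫ (ρ_ A).inv) :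
    leftTrace ε η (crossing t η ε) = (-t ^ 3) • 𝟙 A := by
  have trace_id : leftTrace ε η (𝟙 (A ⊗ A)) = (-t ^ 2 - (t⁻¹) ^ 2) • 𝟙 A := by
    have loop : η ▷ A ≫ ε ▷ A = (-t ^ 2 - (t⁻¹) ^ 2) • 𝟙 _ := by
      rw [← comp_whiskerRight, hl, MonoidalLinear.smul_whiskerRight, id_whiskerRight]
    simp [leftTrace, reassoc_of% loop]
  have trace_hook : leftTrace ε η (ε ≫ η) = 𝟙 A := by
    simp only [leftTrace, MonoidalCategory.whiskerLeft_comp, Category.assoc]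
    rw [reassoc_of% z₂, reassoc_of% z₁]
    simp
  rw [crossing, leftTrace_add, leftTrace_smul, leftTrace_smul, trace_id, trace_hook, smul_smul,
    ← add_smul]
  congr 1
  field_simp
  ring

end Crossing

section Braided
variable [BraidedCategory C]

/-- The left curl of `X`: the braiding of `X` with itself, with one strand closed on the left. -/
def leftCurl (e : Y ⊗ X ⟶ 𝟙_ C) (c : 𝟙_ C ⟶ Y ⊗ X) : X ⟶ X := leftTrace e c (β_ X X).hom

/-- The right curl of `Y`: the braiding of `Y` with itself, with one strand closed on the right. -/
def rightCurl (e : Y ⊗ X ⟶ 𝟙_ C) (c : 𝟙_ C ⟶ Y ⊗ X) : Y ⟶ Y :=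
  (ρ_ Y).inv ≫ Y ◁ c ≫ (α_ Y Y X).inv ≫ (β_ Y Y).hom ▷ X ≫ (α_ Y Y X).hom ≫ Y ◁ e ≫ (ρ_ Y).hom

theorem leftTwist_refl (e : X ⊗ X ⟶ 𝟙_ C) (c : 𝟙_ C ⟶ X ⊗ X) :
    leftTwist e c (Iso.refl X) = leftCurl e c := by
  simp only [leftTwist, leftCurl, leftTrace, Iso.refl_hom, id_tensorHom]

theorem rightTwist_refl (e : X ⊗ X ⟶ 𝟙_ C) (c : 𝟙_ C ⟶ X ⊗ X) :
    rightTwist e c (Iso.refl X) = rightCurl e c := by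
  simp only [rightTwist, rightCurl, Iso.refl_inv, tensorHom_id]

theorem leftTrace_braiding (e : Y ⊗ X ⟶ 𝟙_ C) (c : 𝟙_ C ⟶ Y ⊗ X) :
    leftTrace e c ((β_ X (X ⊗ W)).hom ≫ (α_ X W X).hom) = leftCurl e c ▷ W ≫ (β_ X W).hom := by
  have hexagon : (β_ X (X ⊗ W)).hom ≫ (α_ X W X).hom =
      ((α_ X X W).inv ≫ (β_ X X).hom ▷ W ≫ (α_ X X W).hom) ≫ X ◁ (β_ X W).hom := by
    have := BraidedCategory.hexagon_forward X X W
    rw [Category.assoc, Category.assoc, ← this, Iso.inv_hom_id_assoc]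
  rw [hexagon, leftTrace_comp_right, leftTrace_whiskerRight, leftCurl]

theorem leftCurl_nest (e₁ : Y₁ ⊗ X₁ ⟶ 𝟙_ C) (e₂ : Y₂ ⊗ X₂ ⟶ 𝟙_ C) (c₁ : 𝟙_ C ⟶ Y₁ ⊗ X₁)
    (c₂ : 𝟙_ C ⟶ Y₂ ⊗ X₂) :
    leftCurl (nestEv e₁ e₂) (nestCoev c₁ c₂) =
      leftCurl e₁ c₁ ▷ X₂ ≫ (β_ X₁ X₂).hom ≫ leftCurl e₂ c₂ ▷ X₁ ≫ (β_ X₂ X₁).hom := by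
  have hexagon : (α_ X₁ X₂ (X₁ ⊗ X₂)).inv ≫ (β_ (X₁ ⊗ X₂) (X₁ ⊗ X₂)).hom ≫
      (α_ X₁ X₂ (X₁ ⊗ X₂)).hom =
      X₁ ◁ (β_ X₂ (X₁ ⊗ X₂)).hom ≫ ((α_ X₁ (X₁ ⊗ X₂) X₂).inv ≫
        ((β_ X₁ (X₁ ⊗ X₂)).hom ≫ (α_ X₁ X₂ X₁).hom) ▷ X₂ ≫ (α_ X₁ (X₂ ⊗ X₁) X₂).hom) ≫
        X₁ ◁ (α_ X₂ X₁ X₂).hom := by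
    have := BraidedCategory.hexagon_reverse X₁ X₂ (X₁ ⊗ X₂)
    rw [comp_whiskerRight]
    simp only [Category.assoc]
    rw [pentagon, ← reassoc_of% this]
    simp
  rw [leftCurl, leftTrace_nest, hexagon, leftTrace_comp_left, leftTrace_comp_right,
    leftTrace_whiskerRight, leftTrace_braiding, ← BraidedCategory.braiding_naturality_right_assoc,
    leftTrace_comp_left, leftTrace_braiding, Category.assoc]

theorem leftCurl_unit : leftCurl (λ_ (𝟙_ C)).hom (λ_ (𝟙_ C)).inv = 𝟙 _ := by
  simp only [leftCurl, leftTrace, braiding_tensorUnit_left]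
  monoidal

theorem leftCurl_of_retract {P : C} (h : Retract P X) (e : X ⊗ X ⟶ 𝟙_ C) (c : 𝟙_ C ⟶ X ⊗ X)
    (he : (h.r ≫ h.i ⊗ₘ h.r ≫ h.i) ≫ e = X ◁ (h.r ≫ h.i) ≫ e) :
    leftCurl ((h.i ⊗ₘ h.i) ≫ e) (c ≫ (h.r ⊗ₘ h.r)) = h.i ≫ leftCurl e c ≫ h.r := by
  have slide : leftCurl ((h.i ⊗ₘ h.i) ≫ e) (c ≫ (h.r ⊗ₘ h.r)) =
      leftTrace (h.r ▷ P ≫ (h.i ⊗ₘ h.i) ≫ e) (c ≫ X ◁ h.r) (β_ P P).hom := by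
    rw [MonoidalCategory.tensorHom_def' h.r, ← Category.assoc, leftCurl, leftTrace_slide]
  rw [slide, retract_comp_ev h e he]
  calc
    _ = leftTrace e c ((h.r ▷ P ≫ (β_ P P).hom) ≫ h.i ▷ P) := by
      simp only [leftTrace]
      monoidal
    _ = leftTrace e c (X ◁ h.i ≫ (β_ X X).hom ≫ X ◁ h.r) := by
      rw [BraidedCategory.braiding_naturality_left, Category.assoc, whisker_exchange,
        BraidedCategory.braiding_naturality_right_assoc]
    _ = _ := by rw [leftTrace_comp_left, leftTrace_comp_right, leftCurl]

theorem whiskerLeft_comp_braiding (c : 𝟙_ C ⟶ Y ⊗ X) :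
    Z ◁ c ≫ (α_ Z Y X).inv ≫ (β_ Z Y).hom ▷ X ≫ (α_ Y Z X).hom =
      (ρ_ Z).hom ≫ (λ_ Z).inv ≫ c ▷ Z ≫ (α_ Y X Z).hom ≫ Y ◁ (β_ Z X).inv := by
  have hexagon := BraidedCategory.braiding_tensor_right_hom Z Y X
  have := BraidedCategory.braiding_naturality_right Z c
  rw [hexagon, braiding_tensorUnit_right] at this
  simp only [Category.assoc] at this
  rw [← reassoc_of% this]
  simp

theorem whiskerRight_comp_braiding (c : 𝟙_ C ⟶ Y ⊗ X) :
    c ▷ Z ≫ (α_ Y X Z).hom ≫ Y ◁ (β_ X Z).hom ≫ (α_ Y Z X).inv =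
      (λ_ Z).hom ≫ (ρ_ Z).inv ≫ Z ◁ c ≫ (α_ Z Y X).inv ≫ (β_ Y Z).inv ▷ X := by
  have hexagon := BraidedCategory.braiding_tensor_left_hom Y X Z
  have := BraidedCategory.braiding_naturality_left c Z
  rw [hexagon, braiding_tensorUnit_left] at this
  simp only [Category.assoc] at this
  rw [← reassoc_of% this]
  simp

theorem nestCoev_comp_braiding (c₁ : 𝟙_ C ⟶ Y₁ ⊗ X₁) (c₂ : 𝟙_ C ⟶ Y₂ ⊗ X₂) :
    nestCoev c₁ c₂ ≫ (β_ Y₂ Y₁).hom ▷ (X₁ ⊗ X₂) =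
      nestCoev c₂ c₁ ≫ (Y₁ ⊗ Y₂) ◁ (β_ X₂ X₁).hom := by
  calc
    _ = c₂ ⊗≫ (Y₂ ◁ c₁ ≫ (α_ Y₂ Y₁ X₁).inv ≫ (β_ Y₂ Y₁).hom ▷ X₁ ≫ (α_ Y₁ Y₂ X₁).hom) ▷ X₂ ⊗≫
          𝟙 _ := by
      simp only [nestCoev]
      monoidal
    _ = 𝟙 _ ⊗≫ (𝟙_ C ◁ c₂ ≫ c₁ ▷ (Y₂ ⊗ X₂)) ⊗≫ Y₁ ◁ (β_ Y₂ X₁).inv ▷ X₂ ⊗≫ 𝟙 _ := by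
      rw [whiskerLeft_comp_braiding]
      monoidal
    _ = c₁ ⊗≫ Y₁ ◁ ((λ_ X₁).hom ≫ (ρ_ X₁).inv ≫ X₁ ◁ c₂ ≫ (α_ X₁ Y₂ X₂).inv ≫
          (β_ Y₂ X₁).inv ▷ X₂) ⊗≫ 𝟙 _ := by
      rw [whisker_exchange]
      monoidal
    _ = _ := by
      rw [← whiskerRight_comp_braiding]
      simp only [nestCoev]
      monoidal

theorem comp_rightCurl_eq_comp_leftCurl (e : Y ⊗ X ⟶ 𝟙_ C) (c : 𝟙_ C ⟶ Y ⊗ X) :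
    c ≫ rightCurl e c ▷ X = c ≫ Y ◁ leftCurl e c := by
  calc
    _ = (nestCoev c c ≫ (β_ Y Y).hom ▷ (X ⊗ X)) ⊗≫ Y ◁ e ▷ X ⊗≫ 𝟙 _ := by
      simp only [nestCoev, rightCurl]
      monoidal
    _ = (nestCoev c c ≫ (Y ⊗ Y) ◁ (β_ X X).hom) ⊗≫ Y ◁ e ▷ X ⊗≫ 𝟙 _ := by
      rw [nestCoev_comp_braiding]
    _ = _ := by
      simp only [nestCoev, leftCurl, leftTrace]
      monoidal

theorem leftCurl_iso (e : Y ⊗ X ⟶ 𝟙_ C) (c : 𝟙_ C ⟶ Y ⊗ X) (s : X ≅ Z) :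
    leftCurl (Y ◁ s.inv ≫ e) (c ≫ Y ◁ s.hom) = s.inv ≫ leftCurl e c ≫ s.hom := by
  have slide : leftCurl (Y ◁ s.inv ≫ e) (c ≫ Y ◁ s.hom) =
      leftTrace e c ((s.hom ▷ Z ≫ (β_ Z Z).hom) ≫ s.inv ▷ Z) := by
    simp only [leftCurl, leftTrace]
    monoidal
  rw [slide, BraidedCategory.braiding_naturality_left, Category.assoc, whisker_exchange,
    ← BraidedCategory.braiding_naturality_right_assoc, leftTrace_comp_left, leftTrace_comp_right,
    leftCurl]

theorem rightCurl_eq_smul_id [Preadditive C] {R : Type*} [CommRing R] [Linear R C]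
    [MonoidalPreadditive C] [MonoidalLinear R C] {e : Y ⊗ X ⟶ 𝟙_ C} {c : 𝟙_ C ⟶ Y ⊗ X}
    {e' : X ⊗ Y ⟶ 𝟙_ C} {r : R} (hz : zigzag c e' = 𝟙 Y) (hl : leftCurl e c = r • 𝟙 X) :
    rightCurl e c = r • 𝟙 Y := by
  calc
    rightCurl e c = zigzag (c ≫ rightCurl e c ▷ X) e' := by
      rw [zigzag_comp_whiskerRight, hz, Category.id_comp]
    _ = zigzag (r • c) e' := by
      rw [comp_rightCurl_eq_comp_leftCurl, hl, MonoidalLinear.whiskerLeft_smul,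
        MonoidalCategory.whiskerLeft_id, Linear.comp_smul, Category.comp_id]
    _ = r • 𝟙 Y := by rw [zigzag_smul, hz]

end Braided

end PartialTrace

/-! ### Curls in additive and idempotent completions -/

section MonoidalFunctor
open Functor.LaxMonoidal Functor.OplaxMonoidal
universe v₁ v₂ u₁ u₂
variable {C : Type u₁} [Category.{v₁} C] [MonoidalCategory C]
  {D : Type u₂} [Category.{v₂} D] [MonoidalCategory D] {X Y Z W : C} (F : C ⥤ D)

/-- The image of an evaluation under a monoidal functor. -/
def mapEv [F.Monoidal] (e : Y ⊗ X ⟶ 𝟙_ C) : F.obj Y ⊗ F.obj X ⟶ 𝟙_ D := μ F Y X ≫ F.map e ≫ η F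

/-- The image of a coevaluation under a monoidal functor. -/
def mapCoev [F.Monoidal] (c : 𝟙_ C ⟶ Y ⊗ X) : 𝟙_ D ⟶ F.obj Y ⊗ F.obj X := ε F ≫ F.map c ≫ δ F Y X

theorem map_leftTrace [F.Monoidal] (e : Y ⊗ X ⟶ 𝟙_ C) (c : 𝟙_ C ⟶ Y ⊗ X) (g : X ⊗ Z ⟶ X ⊗ W) :
    F.map (leftTrace e c g) =
      leftTrace (mapEv F e) (mapCoev F c) (μ F X Z ≫ F.map g ≫ δ F X W) := by
  simp only [leftTrace, mapEv, mapCoev, Functor.map_comp, Functor.Monoidal.map_whiskerLeft,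
    Functor.Monoidal.map_whiskerRight, Functor.Monoidal.map_associator,
    Functor.Monoidal.map_associator_inv, Functor.Monoidal.map_leftUnitor,
    Functor.Monoidal.map_leftUnitor_inv, Category.assoc, Functor.Monoidal.μ_δ_assoc,
    comp_whiskerRight, MonoidalCategory.whiskerLeft_comp]

theorem map_zigzag [F.Monoidal] (c : 𝟙_ C ⟶ Y ⊗ X) (e : X ⊗ Y ⟶ 𝟙_ C) :
    F.map (zigzag c e) = zigzag (mapCoev F c) (mapEv F e) := by
  simp only [zigzag, mapEv, mapCoev, Functor.map_comp, Functor.Monoidal.map_whiskerLeft,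
    Functor.Monoidal.map_whiskerRight, Functor.Monoidal.map_associator,
    Functor.Monoidal.map_leftUnitor_inv, Functor.Monoidal.map_rightUnitor, Category.assoc,
    Functor.Monoidal.μ_δ_assoc, comp_whiskerRight, MonoidalCategory.whiskerLeft_comp]

theorem map_leftCurl [BraidedCategory C] [BraidedCategory D] [F.Braided] (e : Y ⊗ X ⟶ 𝟙_ C)
    (c : 𝟙_ C ⟶ Y ⊗ X) :
    F.map (leftCurl e c) = leftCurl (mapEv F e) (mapCoev F c) := by
  rw [leftCurl, map_leftTrace, Functor.map_braiding]
  simp [leftCurl]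

theorem tensorHom_comp_mapEv [F.Monoidal] {X' Y' : C} (f : Y' ⟶ Y) (g : X' ⟶ X)
    (e : Y ⊗ X ⟶ 𝟙_ C) :
    (F.map f ⊗ₘ F.map g) ≫ mapEv F e = mapEv F ((f ⊗ₘ g) ≫ e) := by
  simp [mapEv]

theorem whiskerLeft_comp_mapEv [F.Monoidal] {X' : C} (g : X' ⟶ X) (e : Y ⊗ X ⟶ 𝟙_ C) :
    F.obj Y ◁ F.map g ≫ mapEv F e = mapEv F (Y ◁ g ≫ e) := by
  simp [mapEv]

end MonoidalFunctor

section Embedding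
universe v u
variable {C : Type u} [Category.{v} C] [Preadditive C]

theorem embedding_map_hom {X Y : C} (a : X ≅ Y) :
    (Mat_.embedding C).map a.hom =
      relabel (M := (Mat_.embedding C).obj X) (N := (Mat_.embedding C).obj Y)
        (Equiv.refl PUnit) (fun _ => a) :=
  eq_relabel (fun _ => rfl) fun i j h => (h (Subsingleton.elim (α := PUnit) i j)).elim

theorem embedding_id_apply (X : C) (i j : PUnit) :
    (𝟙 ((Mat_.embedding C).obj X) : Mat_.Hom _ _) i j = 𝟙 X := Mat_.id_apply_self _ _

instance [Linear ℂ C] : (Mat_.embedding C).Linear ℂ where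
  map_smul _ _ := rfl

variable [MonoidalCategory C]

/-- The comparison isomorphism of one-by-one matrices which makes `Mat_.embedding` monoidal. -/
def embeddingTensorIso (X Y : C) :
    (Mat_.embedding C).obj X ⊗ (Mat_.embedding C).obj Y ≅ (Mat_.embedding C).obj (X ⊗ Y) :=
  relabelIso (M := matTensor ((Mat_.embedding C).obj X) ((Mat_.embedding C).obj Y))
    (N := (Mat_.embedding C).obj (X ⊗ Y)) (Equiv.prodPUnit PUnit) (fun _ => Iso.refl (X ⊗ Y))

/-- The comparison isomorphism of the unit objects which makes `Mat_.embedding` monoidal. -/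
def embeddingUnitIso : 𝟙_ (Mat_ C) ≅ (Mat_.embedding C).obj (𝟙_ C) :=
  relabelIso (M := matUnit) (N := (Mat_.embedding C).obj (𝟙_ C)) (Equiv.refl PUnit)
    (fun _ => Iso.refl (𝟙_ C))

variable [MonoidalPreadditive C]

instance : (Mat_.embedding C).Monoidal :=
  Functor.CoreMonoidal.toMonoidal
    { εIso := embeddingUnitIso
      μIso := embeddingTensorIso
      μIso_hom_natural_left {X Y} f X' := relabel_naturality _ _ _ _ _ _ fun i j => by
        exact (congrArg (fun x => (f ⊗ₘ x) ≫ 𝟙 _) (embedding_id_apply X' i.2 j.2)).trans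
          (by simp : (f ⊗ₘ 𝟙 X') ≫ 𝟙 _ = 𝟙 _ ≫ f ▷ X')
      μIso_hom_natural_right {X Y} X' f := relabel_naturality _ _ _ _ _ _ fun i j => by
        exact (congrArg (fun x => (x ⊗ₘ f) ≫ 𝟙 _) (embedding_id_apply X' i.1 j.1)).trans
          (by simp : (𝟙 X' ⊗ₘ f) ≫ 𝟙 _ = 𝟙 _ ≫ X' ◁ f)
      associativity X Y Z := by
        refine relabel_ext (relabel_trans (relabel_wr _ _ _) (relabel_trans rfl
          (embedding_map_hom _))) (relabel_trans rfl (relabel_trans (relabel_wl _ _ _) rfl)) rfl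
          fun i => ?_
        change (𝟙 (X ⊗ Y) ▷ Z ≫ 𝟙 _ ≫ (α_ X Y Z).hom) ≫ 𝟙 _ =
          (α_ X Y Z).hom ≫ X ◁ 𝟙 (Y ⊗ Z) ≫ 𝟙 _
        simp
      left_unitality X := by
        refine relabel_ext (φ := fun _ => λ_ X) rfl (relabel_trans (relabel_wr _ _ _)
          (relabel_trans rfl (embedding_map_hom _))) rfl fun i => ?_
        change (λ_ X).hom ≫ 𝟙 _ = 𝟙 (𝟙_ C) ▷ X ≫ 𝟙 _ ≫ (λ_ X).hom
        simp
      right_unitality X := by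
        refine relabel_ext (φ := fun _ => ρ_ X) rfl (relabel_trans (relabel_wl _ _ _)
          (relabel_trans rfl (embedding_map_hom _))) rfl fun i => ?_
        change (ρ_ X).hom ≫ 𝟙 _ = X ◁ 𝟙 (𝟙_ C) ≫ 𝟙 _ ≫ (ρ_ X).hom
        simp }

instance [BraidedCategory C] : (Mat_.embedding C).Braided where
  braided X Y := relabel_ext (relabel_trans rfl (embedding_map_hom _)) (relabel_trans rfl rfl) rfl
    fun i => by
      change (𝟙 (X ⊗ Y) ≫ (β_ X Y).hom) ≫ 𝟙 _ = (β_ X Y).hom ≫ 𝟙 _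
      simp

theorem mapEv_embedding {X Y : C} (e : Y ⊗ X ⟶ 𝟙_ C) :
    mapEv (Mat_.embedding C) e = fun _ _ => e := by
  rw [mapEv, ← Category.assoc]
  refine (Iso.comp_inv_eq embeddingUnitIso).mpr (Mat_.hom_ext _ _ fun i j => ?_)
  refine (relabel_comp _ _ _ _ _).trans (Eq.trans ?_ (comp_relabel _ _ _ i j).symm)
  exact (Category.id_comp e).trans (Category.comp_id e).symm

theorem mapCoev_embedding {X Y : C} (c : 𝟙_ C ⟶ Y ⊗ X) :
    mapCoev (Mat_.embedding C) c = fun _ _ => c := by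
  rw [mapCoev, ← Category.assoc]
  refine (Iso.comp_inv_eq (embeddingTensorIso Y X)).mpr (Mat_.hom_ext _ _ fun i j => ?_)
  refine (relabel_comp _ _ _ _ _).trans (Eq.trans ?_ (comp_relabel _ _ _ i (j, j)).symm)
  exact (Category.id_comp c).trans (Category.comp_id c).symm

end Embedding

section Karoubi
open Idempotents
universe v u
variable {C : Type u} [Category.{v} C]

/-- An object of the idempotent completion is a retract of its underlying object. -/
def karoubiRetract (P : Karoubi C) : Retract P ((toKaroubi C).obj P.X) where
  i := P.decompId_i
  r := P.decompId_p
  retract := P.decompId.symm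

theorem karoubiRetract_r_comp_i (P : Karoubi C) :
    (karoubiRetract P).r ≫ (karoubiRetract P).i = (toKaroubi C).map P.p := by
  ext
  simp [karoubiRetract]

theorem karoubiRetract_i_comp_r {P : Karoubi C} (φ : P.X ⟶ P.X) :
    (karoubiRetract P).i ≫ (toKaroubi C).map φ ≫ (karoubiRetract P).r = TL.compress φ := by
  ext
  simp [karoubiRetract, TL.compress]

theorem compress_eq_smul [Preadditive C] [Linear ℂ C] {P : Karoubi C} {φ : P.X ⟶ P.X} {s : ℂ}
    (h : P.p ≫ φ = s • P.p) : (TL.compress φ : P ⟶ P) = s • 𝟙 P := by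
  ext
  change P.p ≫ φ ≫ P.p = s • P.p
  rw [reassoc_of% h, Linear.smul_comp, P.idem]

variable [MonoidalCategory C]

/-- The comparison isomorphism which makes `toKaroubi` monoidal: it is the identity of `X ⊗ Y`. -/
def toKaroubiTensorIso (X Y : C) :
    (toKaroubi C).obj X ⊗ (toKaroubi C).obj Y ≅ (toKaroubi C).obj (X ⊗ Y) :=
  karoubiIso ((toKaroubi C).obj X ⊗ (toKaroubi C).obj Y) ((toKaroubi C).obj (X ⊗ Y))
    (Iso.refl (X ⊗ Y)) <| by
      change (𝟙 X ⊗ₘ 𝟙 Y) ≫ 𝟙 _ = 𝟙 _ ≫ 𝟙 _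
      simp

instance : (toKaroubi C).Monoidal :=
  Functor.CoreMonoidal.toMonoidal
    { εIso := Iso.refl (𝟙_ (Karoubi C))
      μIso := toKaroubiTensorIso
      μIso_hom_natural_left {X Y} f X' := by
        ext
        change (f ⊗ₘ 𝟙 X') ≫ (𝟙 Y ⊗ₘ 𝟙 X') ≫ 𝟙 _ = ((𝟙 X ⊗ₘ 𝟙 X') ≫ 𝟙 _) ≫ f ▷ X'
        simp
      μIso_hom_natural_right {X Y} X' f := by
        ext
        change (𝟙 X' ⊗ₘ f) ≫ (𝟙 X' ⊗ₘ 𝟙 Y) ≫ 𝟙 _ = ((𝟙 X' ⊗ₘ 𝟙 X) ≫ 𝟙 _) ≫ X' ◁ f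
        simp
      associativity X Y Z := by
        ext
        change ((𝟙 X ⊗ₘ 𝟙 Y) ≫ 𝟙 _ ⊗ₘ 𝟙 Z) ≫ ((𝟙 (X ⊗ Y) ⊗ₘ 𝟙 Z) ≫ 𝟙 _) ≫ (α_ X Y Z).hom =
          (((𝟙 X ⊗ₘ 𝟙 Y) ⊗ₘ 𝟙 Z) ≫ (α_ X Y Z).hom) ≫
            (𝟙 X ⊗ₘ (𝟙 Y ⊗ₘ 𝟙 Z) ≫ 𝟙 _) ≫ (𝟙 X ⊗ₘ 𝟙 (Y ⊗ Z)) ≫ 𝟙 _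
        simp
      left_unitality X := by
        ext
        change (𝟙 _ ⊗ₘ 𝟙 X) ≫ (λ_ X).hom =
          (𝟙 _ ⊗ₘ 𝟙 X) ≫ ((𝟙 (𝟙_ C) ⊗ₘ 𝟙 X) ≫ 𝟙 _) ≫ (λ_ X).hom
        simp
      right_unitality X := by
        ext
        change (𝟙 X ⊗ₘ 𝟙 _) ≫ (ρ_ X).hom =
          (𝟙 X ⊗ₘ 𝟙 _) ≫ ((𝟙 X ⊗ₘ 𝟙 (𝟙_ C)) ≫ 𝟙 _) ≫ (ρ_ X).hom
        simp }

instance [BraidedCategory C] : (toKaroubi C).Braided where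
  braided X Y := by
    ext
    change ((𝟙 X ⊗ₘ 𝟙 Y) ≫ 𝟙 _) ≫ (β_ X Y).hom =
      ((𝟙 X ⊗ₘ 𝟙 Y) ≫ (β_ X Y).hom) ≫ (𝟙 Y ⊗ₘ 𝟙 X) ≫ 𝟙 _
    simp

theorem compress_ev (P : Karoubi C) (e : P.X ⊗ P.X ⟶ 𝟙_ C) :
    (TL.compress e : P ⊗ P ⟶ 𝟙_ (Karoubi C)) =
      ((karoubiRetract P).i ⊗ₘ (karoubiRetract P).i) ≫ mapEv (toKaroubi C) e := by
  ext
  change (P.p ⊗ₘ P.p) ≫ e ≫ 𝟙 _ = (P.p ⊗ₘ P.p) ≫ ((𝟙 P.X ⊗ₘ 𝟙 P.X) ≫ 𝟙 _) ≫ e ≫ 𝟙 _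
  simp

theorem compress_coev (P : Karoubi C) (c : 𝟙_ C ⟶ P.X ⊗ P.X) :
    (TL.compress c : 𝟙_ (Karoubi C) ⟶ P ⊗ P) =
      mapCoev (toKaroubi C) c ≫ ((karoubiRetract P).r ⊗ₘ (karoubiRetract P).r) := by
  ext
  change 𝟙 _ ≫ c ≫ (P.p ⊗ₘ P.p) = (𝟙 _ ≫ c ≫ 𝟙 (P.X ⊗ P.X) ≫ 𝟙 (P.X ⊗ P.X)) ≫ (P.p ⊗ₘ P.p)
  simp

theorem karoubiRetract_comp_mapEv {P : Karoubi C} {e : P.X ⊗ P.X ⟶ 𝟙_ C}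
    (he : (P.p ⊗ₘ P.p) ≫ e = P.X ◁ P.p ≫ e) :
    ((karoubiRetract P).r ≫ (karoubiRetract P).i ⊗ₘ (karoubiRetract P).r ≫ (karoubiRetract P).i) ≫
        mapEv (toKaroubi C) e =
      (toKaroubi C).obj P.X ◁ ((karoubiRetract P).r ≫ (karoubiRetract P).i) ≫
        mapEv (toKaroubi C) e := by
  rw [karoubiRetract_r_comp_i, tensorHom_comp_mapEv, he, whiskerLeft_comp_mapEv]

theorem zigzag_compress {P : Karoubi C} {e : P.X ⊗ P.X ⟶ 𝟙_ C} (c : 𝟙_ C ⟶ P.X ⊗ P.X)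
    (he : (P.p ⊗ₘ P.p) ≫ e = P.X ◁ P.p ≫ e) :
    zigzag (TL.compress c : 𝟙_ (Karoubi C) ⟶ P ⊗ P) (TL.compress e) =
      TL.compress (zigzag c e) := by
  rw [compress_ev, compress_coev, zigzag_of_retract _ _ _ (karoubiRetract_comp_mapEv he),
    ← map_zigzag, karoubiRetract_i_comp_r]

theorem leftCurl_compress [BraidedCategory C] {P : Karoubi C} {e : P.X ⊗ P.X ⟶ 𝟙_ C}
    (c : 𝟙_ C ⟶ P.X ⊗ P.X) (he : (P.p ⊗ₘ P.p) ≫ e = P.X ◁ P.p ≫ e) :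
    leftCurl (TL.compress e : P ⊗ P ⟶ 𝟙_ (Karoubi C)) (TL.compress c) =
      TL.compress (leftCurl e c) := by
  rw [compress_ev, compress_coev, leftCurl_of_retract _ _ _ (karoubiRetract_comp_mapEv he),
    ← map_leftCurl, karoubiRetract_i_comp_r]

end Karoubi

section Quotient
universe v u
variable {C : Type u} [Category.{v} C] [Preadditive C] [Linear ℂ C] [MonoidalCategory C]
  [MonoidalPreadditive C] [MonoidalLinear ℂ C] {A B X Y : C}

theorem zigzag_toQuot (g : A ⟶ B) (c : 𝟙_ C ⟶ Y ⊗ X) (e : X ⊗ Y ⟶ 𝟙_ C) :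
    zigzag (Y := (toQuot g).obj Y) (X := (toQuot g).obj X) ((toQuot g).map c)
      ((toQuot g).map e) = (toQuot g).map (zigzag c e) := rfl

theorem leftCurl_toQuot [BraidedCategory C] (g : A ⟶ B) (e : Y ⊗ X ⟶ 𝟙_ C)
    (c : 𝟙_ C ⟶ Y ⊗ X) :
    leftCurl (Y := (toQuot g).obj Y) (X := (toQuot g).obj X) ((toQuot g).map e)
      ((toQuot g).map c) = (toQuot g).map (leftCurl e c) := rfl

end Quotient

variable {k : ℕ}

/-! ### Jones–Wenzl idempotents and nested diagrams -/

namespace PreTL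

/-- The morphism is the transport along an equality of objects. All structure isomorphisms of
`PreTL` are of this kind, so that any two composites of them with the same ends agree. -/
def IsTransport {X Y : PreTL k} (f : X ⟶ Y) : Prop := ∃ h : X = Y, f = eqToHom h

namespace IsTransport
variable {X X' Y Y' Z W : PreTL k}

theorem unique {f g : X ⟶ Y} (hf : IsTransport f) (hg : IsTransport g) : f = g := by
  obtain ⟨h, rfl⟩ := hf
  obtain ⟨_, rfl⟩ := hg
  rfl

theorem id (X : PreTL k) : IsTransport (𝟙 X) := ⟨rfl, rfl⟩

theorem comp {f : X ⟶ Y} {g : Y ⟶ Z} (hf : IsTransport f) (hg : IsTransport g) :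
    IsTransport (f ≫ g) := by
  obtain ⟨rfl, rfl⟩ := hf
  obtain ⟨rfl, rfl⟩ := hg
  exact ⟨rfl, Category.comp_id _⟩

theorem whiskerLeft (W : PreTL k) {f : X ⟶ Y} (hf : IsTransport f) : IsTransport (W ◁ f) := by
  obtain ⟨rfl, rfl⟩ := hf
  exact ⟨rfl, whiskerLeft_id _ _⟩

theorem whiskerRight {f : X ⟶ Y} (hf : IsTransport f) (W : PreTL k) : IsTransport (f ▷ W) := by
  obtain ⟨rfl, rfl⟩ := hf
  exact ⟨rfl, id_whiskerRight _ _⟩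

theorem ofDiagram_iso {m n : ℕ} (h : m = n) :
    IsTransport (k := k) (ofDiagram (DiagramCat.iso h).hom) := by
  subst h
  exact id _

theorem ofDiagram_iso_inv {m n : ℕ} (h : m = n) :
    IsTransport (k := k) (ofDiagram (DiagramCat.iso h).inv) := by
  subst h
  exact id _

theorem associator_hom (X Y Z : PreTL k) : IsTransport (α_ X Y Z).hom := ofDiagram_iso _
theorem associator_inv (X Y Z : PreTL k) : IsTransport (α_ X Y Z).inv := ofDiagram_iso_inv _
theorem leftUnitor_hom (X : PreTL k) : IsTransport (λ_ X).hom := ofDiagram_iso _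
theorem leftUnitor_inv (X : PreTL k) : IsTransport (λ_ X).inv := ofDiagram_iso_inv _
theorem rightUnitor_hom (X : PreTL k) : IsTransport (ρ_ X).hom := ofDiagram_iso _
theorem rightUnitor_inv (X : PreTL k) : IsTransport (ρ_ X).inv := ofDiagram_iso_inv _

theorem comp_heq {p : X ⟶ Y} (hp : IsTransport p) (u : Y ⟶ Z) : p ≫ u ≍ u := by
  obtain ⟨rfl, rfl⟩ := hp
  exact heq_of_eq (Category.id_comp u)

theorem conj_heq {p : X ⟶ Y} {q : Y' ⟶ X'} (hp : IsTransport p)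
    (hq : IsTransport q) (u : Y ⟶ Y') : p ≫ u ≫ q ≍ u := by
  obtain ⟨rfl, rfl⟩ := hp
  obtain ⟨rfl, rfl⟩ := hq
  exact heq_of_eq ((Category.id_comp _).trans (Category.comp_id _))

end IsTransport

theorem strands_tensor_comm (k m n : ℕ) :
    strands k m ⊗ strands k n = strands k n ⊗ strands k m :=
  congrArg (strands k) (Nat.add_comm m n)

/-- The identification of `m + n` strands with `n + m` strands. -/
def renumber (k m n : ℕ) : strands k m ⊗ strands k n ≅ strands k n ⊗ strands k m :=
  eqToIso (strands_tensor_comm k m n)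

theorem isTransport_renumber_hom (m n : ℕ) : IsTransport (renumber k m n).hom :=
  ⟨strands_tensor_comm k m n, rfl⟩

theorem isTransport_renumber_inv (m n : ℕ) : IsTransport (renumber k m n).inv :=
  ⟨(strands_tensor_comm k m n).symm, rfl⟩

/-- The `j` nested caps. -/
def caps (k j : ℕ) : strands k j ⊗ strands k j ⟶ 𝟙_ (PreTL k) :=
  ofDiagram (DiagramCat.ofTerm (nestedCaps j))

/-- The `j` nested cups. -/
def cups (k j : ℕ) : 𝟙_ (PreTL k) ⟶ strands k j ⊗ strands k j :=
  ofDiagram (DiagramCat.ofTerm (nestedCups j))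

theorem caps_zero : caps k 0 = (λ_ (𝟙_ (PreTL k))).hom := rfl

theorem cups_zero : cups k 0 = (λ_ (𝟙_ (PreTL k))).inv := rfl

theorem ofDiagram_cast {m n m' n' : ℕ} (hm : m = m') (hn : n = n') (f : DiagramTerm m n) :
    (ofDiagram (DiagramCat.ofTerm (f.cast hm hn)) : strands k m' ⟶ strands k n') =
      eqToHom (congrArg (strands k) hm.symm) ≫
        (ofDiagram (DiagramCat.ofTerm f) : strands k m ⟶ strands k n) ≫
        eqToHom (congrArg (strands k) hn) := by
  subst hm hn
  exact ((Category.id_comp _).trans (Category.comp_id _)).symm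

theorem ofDiagram_sandwich {m n : ℕ} (j : ℕ) (f : DiagramTerm m n) :
    (ofDiagram (DiagramCat.ofTerm ((DiagramTerm.id j).tensor (f.tensor (DiagramTerm.id j)))) :
        strands k j ⊗ (strands k m ⊗ strands k j) ⟶ strands k j ⊗ (strands k n ⊗ strands k j)) =
      strands k j ◁ (ofDiagram (DiagramCat.ofTerm f) : strands k m ⟶ strands k n) ▷ strands k j :=
  (ofDiagram_wl ⟨j⟩ (DiagramCat.ofTerm (f.tensor (DiagramTerm.id j)))).trans
    (congrArg (strands k j ◁ ·) (ofDiagram_wr ⟨j⟩ (DiagramCat.ofTerm f)))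

theorem caps_succ (j : ℕ) : caps k (j + 1) =
    (strands k j ⊗ strands k 1) ◁ (renumber k 1 j).inv ≫ nestEv (cap k) (caps k j) := by
  have expand : (strands k j ⊗ strands k 1) ◁ (renumber k 1 j).inv ≫ nestEv (cap k) (caps k j) =
      (((strands k j ⊗ strands k 1) ◁ (renumber k 1 j).inv ≫ (α_ _ _ _).hom ≫
          strands k j ◁ (α_ _ _ _).inv) ≫
        strands k j ◁ cap k ▷ strands k j ≫ strands k j ◁ (λ_ (strands k j)).hom) ≫ caps k j := by
    simp [nestEv]
  rw [expand]
  refine (ofDiagram_comp (k := k) (X := ⟨j + 1 + (j + 1)⟩) (Y := ⟨j + j⟩) (Z := ⟨0⟩)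
    (DiagramCat.ofTerm _) (DiagramCat.ofTerm (nestedCaps j))).trans
      (congrArg (· ≫ caps k j) ?_)
  refine (ofDiagram_cast _ _ _).trans (congr (congrArg _ (IsTransport.unique ⟨_, rfl⟩ ?_))
    (congr (congrArg _ (ofDiagram_sandwich _ _)) (IsTransport.unique ⟨_, rfl⟩ ?_)))
  · exact ((isTransport_renumber_inv 1 j).whiskerLeft _).comp
      ((IsTransport.associator_hom _ _ _).comp ((IsTransport.associator_inv _ _ _).whiskerLeft _))
  · exact (IsTransport.leftUnitor_hom _).whiskerLeft _

theorem cups_succ (j : ℕ) : cups k (j + 1) =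
    nestCoev (cup k) (cups k j) ≫ (strands k j ⊗ strands k 1) ◁ (renumber k 1 j).hom := by
  have expand :
      nestCoev (cup k) (cups k j) ≫ (strands k j ⊗ strands k 1) ◁ (renumber k 1 j).hom =
      cups k j ≫ strands k j ◁ (λ_ (strands k j)).inv ≫ strands k j ◁ cup k ▷ strands k j ≫
        strands k j ◁ (α_ _ _ _).hom ≫ (α_ _ _ _).inv ≫
          (strands k j ⊗ strands k 1) ◁ (renumber k 1 j).hom := by
    simp [nestCoev]
  rw [expand]
  refine (ofDiagram_comp (k := k) (X := ⟨0⟩) (Y := ⟨j + j⟩) (Z := ⟨j + 1 + (j + 1)⟩)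
    (DiagramCat.ofTerm (nestedCups j)) (DiagramCat.ofTerm _)).trans (congrArg (cups k j ≫ ·) ?_)
  refine (ofDiagram_cast _ _ _).trans (congr (congrArg _ (IsTransport.unique ⟨_, rfl⟩ ?_))
    (congr (congrArg _ (ofDiagram_sandwich _ _)) (IsTransport.unique ⟨_, rfl⟩ ?_)))
  · exact (IsTransport.leftUnitor_inv _).whiskerLeft _
  · exact ((IsTransport.associator_hom _ _ _).whiskerLeft _).comp
      ((IsTransport.associator_inv _ _ _).comp ((isTransport_renumber_hom 1 j).whiskerLeft _))

theorem caps_add (m n : ℕ) : caps k (m + n) =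
    (strands k m ⊗ strands k n) ◁ (renumber k n m).inv ≫ nestEv (caps k n) (caps k m) := by
  suffices h : nestEv (caps k n) (caps k m) ≍ caps k (m + n) from
    eq_of_heq ((((isTransport_renumber_inv n m).whiskerLeft _).comp_heq _).trans h).symm
  induction n with
  | zero =>
    exact (heq_of_eq (nestEv_unit_inner (caps k m))).trans
      ((((IsTransport.rightUnitor_hom _).whiskerRight _).comp_heq _).trans
        (((IsTransport.leftUnitor_hom _).whiskerLeft _).comp_heq _))
  | succ n ih =>
    have ih' : caps k (m + n) =
        (strands k m ⊗ strands k n) ◁ (renumber k n m).inv ≫ nestEv (caps k n) (caps k m) :=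
      eq_of_heq ((((isTransport_renumber_inv n m).whiskerLeft _).comp_heq _).trans ih).symm
    have split_inner :
        nestEv (caps k (n + 1)) (caps k m) ≍ nestEv (nestEv (cap k) (caps k n)) (caps k m) :=
      (heq_of_eq ((congrArg (nestEv · (caps k m)) (caps_succ n)).trans
        (nestEv_comp_inner _ _ _))).trans
          ((((isTransport_renumber_inv 1 n).whiskerRight _).whiskerLeft _).comp_heq _)
    have reassociate : nestEv (cap k) (nestEv (caps k n) (caps k m)) ≍
        nestEv (nestEv (cap k) (caps k n)) (caps k m) :=
      (heq_of_eq (nestEv_nestEv _ _ _)).trans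
        ((((IsTransport.associator_hom _ _ _).whiskerRight _).comp_heq _).trans
          (((IsTransport.associator_inv _ _ _).whiskerLeft _).comp_heq _))
    have split_outer :
        nestEv (cap k) (caps k (m + n)) ≍ nestEv (cap k) (nestEv (caps k n) (caps k m)) :=
      (heq_of_eq ((congrArg (nestEv (cap k)) ih').trans (nestEv_comp_outer _ _ _))).trans
        ((((isTransport_renumber_inv n m).whiskerLeft _).whiskerLeft _).comp_heq _)
    have peel : caps k (m + (n + 1)) ≍ nestEv (cap k) (caps k (m + n)) :=
      (heq_of_eq (caps_succ (m + n))).trans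
        (((isTransport_renumber_inv 1 (m + n)).whiskerLeft _).comp_heq _)
    exact split_inner.trans (reassociate.symm.trans (split_outer.symm.trans peel.symm))

theorem renumber_comp_caps (m n : ℕ) :
    (renumber k m n).hom ▷ (strands k n ⊗ strands k m) ≫ caps k (n + m) =
      nestEv (caps k n) (caps k m) := by
  have cast : ∀ {p q : ℕ} (h : p = q), (eqToHom (congrArg (strands k) h)) ▷ _ ≫ caps k q =
      strands k p ◁ eqToHom (congrArg (strands k) h.symm) ≫ caps k p := by
    rintro p _ rfl
    simp
  have cancel : (strands k m ⊗ strands k n) ◁ (renumber k n m).hom ≫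
      (strands k m ⊗ strands k n) ◁ (renumber k n m).inv ≫ nestEv (caps k n) (caps k m) =
        nestEv (caps k n) (caps k m) := by simp
  exact (cast (Nat.add_comm m n)).trans ((congrArg (_ ≫ ·) (caps_add m n)).trans cancel)

theorem caps_one : caps k 1 = cap k :=
  eq_of_heq ((heq_of_eq ((caps_succ 0).trans (congrArg (_ ≫ ·) (nestEv_unit_outer (cap k))))).trans
    ((((isTransport_renumber_inv 1 0).whiskerLeft _).comp_heq _).trans
      ((((IsTransport.leftUnitor_hom _).whiskerRight _).comp_heq _).trans
        (((IsTransport.rightUnitor_hom _).whiskerLeft _).comp_heq _))))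

theorem zigzag_cups_caps (j : ℕ) : zigzag (cups k j) (caps k j) = 𝟙 (strands k j) := by
  induction j with
  | zero => exact zigzag_unit
  | succ j ih =>
    have strand : zigzag (cup k) (cap k) = 𝟙 _ := by
      have := zigzag₂ (k := k)
      simp [zigzag, reassoc_of% this]
    rw [cups_succ]
    refine (zigzag_comp_whiskerLeft _ _ _).trans ?_
    have nest : (renumber k 1 j).hom ▷ (strands k j ⊗ strands k 1) ≫ caps k (j + 1) =
        nestEv (caps k j) (cap k) :=
      (renumber_comp_caps 1 j).trans (congrArg (nestEv (caps k j)) caps_one)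
    refine (congrArg (zigzag _) nest).trans ((zigzag_nest _ _ _ _).trans ?_)
    refine (congr (congrArg _ ih) strand).trans ?_
    exact id_tensorHom_id _ _

theorem jonesWenzl_comp_hook (n : ℕ) (hn : n + 1 ≤ k) :
    jonesWenzl k (n + 2) ≫ hook k n = 0 := by
  obtain ⟨-, -, absorb, hook_trace⟩ := jonesWenzl_aux (k := k) n (by omega)
  have absorb_strand := congrArg addStrand absorb
  rw [addStrand_comp] at absorb_strand
  have coefficients :
      qInt k (n + 1) / qInt k (n + 2) * -(qInt k (n + 2) / qInt k (n + 1)) = -1 := by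
    have := qInt_ne_zero k (n + 1) (by omega) (by omega)
    have := qInt_ne_zero k (n + 2) (by omega) (by omega)
    field_simp
  rw [jonesWenzl, Preadditive.add_comp, Linear.smul_comp, Category.assoc, Category.assoc,
    hook_trace, Linear.comp_smul, reassoc_of% absorb_strand, smul_smul, coefficients,
    neg_one_smul, add_neg_cancel]

theorem jonesWenzl_comp_addStrand (n : ℕ) (hn : n ≤ k) :
    jonesWenzl k (n + 1) ≫ addStrand (jonesWenzl k n) = jonesWenzl k (n + 1) :=
  (jonesWenzl_aux n hn).2.2.1

theorem jonesWenzl_comp_addStrand_eq_smul {n : ℕ} (hn : n ≤ k) {g : strands k n ⟶ strands k n}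
    {s : ℂ} (hg : jonesWenzl k n ≫ g = s • jonesWenzl k n) :
    jonesWenzl k (n + 1) ≫ addStrand g = s • jonesWenzl k (n + 1) := by
  rw [← jonesWenzl_comp_addStrand n hn, Category.assoc, ← addStrand_comp, hg, addStrand_smul,
    Linear.comp_smul]

/-- The braiding of `n` strands with one strand (in this order), as an endomorphism of `n + 1`
strands. -/
def rightCross (k n : ℕ) : strands k (n + 1) ⟶ strands k (n + 1) :=
  (β_ (strands k n) (strands k 1)).hom ≫ (renumber k 1 n).hom

/-- The braiding of one strand with `n` strands (in this order), as an endomorphism of `n + 1`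
strands. -/
def leftCross (k n : ℕ) : strands k (n + 1) ⟶ strands k (n + 1) :=
  (renumber k 1 n).inv ≫ (β_ (strands k 1) (strands k n)).hom

theorem braiding_strand_strand : (β_ (strands k 1) (strands k 1)).hom =
    crossing (rootT k) (cup k) (cap k) := braiding_one_one

/-- The crossing of the last two of `n + 2` strands. -/
def lastCross (k n : ℕ) : strands k (n + 2) ⟶ strands k (n + 2) :=
  rootT k • 𝟙 (strands k (n + 2)) + (rootT k)⁻¹ • hook k n

theorem whiskerLeft_crossing (n : ℕ) :
    strands k n ◁ crossing (rootT k) (cup k) (cap k) = lastCross k n := by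
  simp only [crossing, MonoidalPreadditive.whiskerLeft_add, MonoidalLinear.whiskerLeft_smul,
    whiskerLeft_id]
  rfl

theorem jonesWenzl_comp_lastCross (n : ℕ) (hn : n + 1 ≤ k) :
    jonesWenzl k (n + 2) ≫ lastCross k n = rootT k • jonesWenzl k (n + 2) := by
  rw [lastCross, Preadditive.comp_add, Linear.comp_smul, Linear.comp_smul,
    jonesWenzl_comp_hook n hn, Category.comp_id, smul_zero, add_zero]

theorem renumber_one_succ_hom (n : ℕ) : (renumber k 1 (n + 1)).hom =
    (α_ (strands k 1) (strands k n) (strands k 1)).inv ≫ (renumber k 1 n).hom ▷ strands k 1 :=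
  IsTransport.unique (isTransport_renumber_hom 1 _)
    ((IsTransport.associator_inv _ _ _).comp ((isTransport_renumber_hom 1 n).whiskerRight _))

theorem renumber_one_succ_inv (n : ℕ) : (renumber k 1 (n + 1)).inv =
    (renumber k 1 n).inv ▷ strands k 1 ≫ (α_ (strands k 1) (strands k n) (strands k 1)).hom :=
  IsTransport.unique (isTransport_renumber_inv 1 _)
    (((isTransport_renumber_inv 1 n).whiskerRight _).comp (IsTransport.associator_hom _ _ _))

theorem leftCross_succ (n : ℕ) :
    leftCross k (n + 1) = addStrand (leftCross k n) ≫ lastCross k n := by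
  have hexagon : (α_ (strands k 1) (strands k n) (strands k 1)).hom ≫
      (β_ (strands k 1) (strands k n ⊗ strands k 1)).hom =
        (β_ (strands k 1) (strands k n)).hom ▷ strands k 1 ≫ lastCross k n := by
    have := BraidedCategory.hexagon_forward (strands k 1) (strands k n) (strands k 1)
    rw [braiding_strand_strand, whiskerLeft_crossing] at this
    exact (congrArg _ (Category.comp_id _).symm).trans
      (this.trans (congrArg _ (Category.id_comp _)))
  refine (congrArg (· ≫ (β_ (strands k 1) (strands k n ⊗ strands k 1)).hom)
    (renumber_one_succ_inv n)).trans ((Category.assoc _ _ _).trans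
      ((congrArg ((renumber k 1 n).inv ▷ strands k 1 ≫ ·) hexagon).trans
        ((Category.assoc _ _ _).symm.trans ?_)))
  exact congrArg (· ≫ lastCross k n) (comp_whiskerRight _ _ _).symm

theorem rightCross_succ (n : ℕ) :
    rightCross k (n + 1) = lastCross k n ≫ addStrand (rightCross k n) := by
  have hexagon : (β_ (strands k n ⊗ strands k 1) (strands k 1)).hom ≫
      (α_ (strands k 1) (strands k n) (strands k 1)).inv =
        lastCross k n ≫ (β_ (strands k n) (strands k 1)).hom ▷ strands k 1 := by
    have := BraidedCategory.hexagon_reverse (strands k n) (strands k 1) (strands k 1)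
    rw [braiding_strand_strand, whiskerLeft_crossing] at this
    exact (Category.id_comp _).symm.trans (this.trans (congrArg _ (Category.id_comp _)))
  refine (congrArg ((β_ (strands k n ⊗ strands k 1) (strands k 1)).hom ≫ ·)
    (renumber_one_succ_hom n)).trans ((Category.assoc _ _ _).symm.trans
      ((congrArg (· ≫ (renumber k 1 n).hom ▷ strands k 1) hexagon).trans
        ((Category.assoc _ _ _).trans ?_)))
  exact congrArg (lastCross k n ≫ ·) (comp_whiskerRight _ _ _).symm

theorem leftCross_zero : leftCross k 0 = 𝟙 _ := by
  have braiding : IsTransport (β_ (strands k 1) (𝟙_ (PreTL k))).hom := by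
    rw [braiding_tensorUnit_right]
    exact (IsTransport.rightUnitor_hom _).comp (IsTransport.leftUnitor_inv _)
  exact ((isTransport_renumber_inv 1 0).comp braiding).unique (IsTransport.id _)

theorem rightCross_zero : rightCross k 0 = 𝟙 _ := by
  have braiding : IsTransport (β_ (𝟙_ (PreTL k)) (strands k 1)).hom := by
    rw [braiding_tensorUnit_left]
    exact (IsTransport.leftUnitor_hom _).comp (IsTransport.rightUnitor_inv _)
  exact (braiding.comp (isTransport_renumber_hom 1 0)).unique (IsTransport.id _)

theorem jonesWenzl_comp_leftCross (n : ℕ) (hn : n ≤ k) :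
    jonesWenzl k (n + 1) ≫ leftCross k n = rootT k ^ n • jonesWenzl k (n + 1) := by
  induction n with
  | zero => rw [leftCross_zero, Category.comp_id, pow_zero, one_smul]
  | succ n ih =>
    rw [leftCross_succ, ← Category.assoc, jonesWenzl_comp_addStrand_eq_smul hn (ih (by omega)),
      Linear.smul_comp, jonesWenzl_comp_lastCross n hn, smul_smul, pow_succ]

theorem jonesWenzl_comp_rightCross (n : ℕ) (hn : n ≤ k) :
    jonesWenzl k (n + 1) ≫ rightCross k n = rootT k ^ n • jonesWenzl k (n + 1) := by
  induction n with
  | zero => rw [rightCross_zero, Category.comp_id, pow_zero, one_smul]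
  | succ n ih =>
    rw [rightCross_succ, ← Category.assoc, jonesWenzl_comp_lastCross n hn, Linear.smul_comp,
      jonesWenzl_comp_addStrand_eq_smul hn (ih (by omega)), smul_smul, pow_succ']

theorem leftCurl_strand : leftCurl (cap k) (cup k) = (-rootT k ^ 3) • 𝟙 (strands k 1) := by
  rw [leftCurl, braiding_strand_strand]
  exact leftTrace_crossing (rootT_ne_zero k) (by rw [loop, loopValue_eq]) zigzag₁ zigzag₂

theorem leftCurl_succ (j : ℕ) : leftCurl (caps k (j + 1)) (cups k (j + 1)) =
    (-rootT k ^ 3) • (leftCross k j ≫ addStrand (leftCurl (caps k j) (cups k j)) ≫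
      rightCross k j) := by
  rw [caps_succ, cups_succ]
  refine (leftCurl_iso (nestEv (cap k) (caps k j)) (nestCoev (cup k) (cups k j))
    (renumber k 1 j)).trans ?_
  rw [leftCurl_nest, leftCurl_strand, MonoidalLinear.smul_whiskerRight, id_whiskerRight,
    Linear.smul_comp, Category.id_comp, Linear.smul_comp, Linear.comp_smul]
  refine congrArg _ ?_
  rw [Category.assoc, Category.assoc]
  exact (Category.assoc _ _ _).symm

theorem jonesWenzl_comp_leftCurl (j : ℕ) (hj : j ≤ k + 1) :
    jonesWenzl k j ≫ leftCurl (caps k j) (cups k j) =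
      ((-1) ^ j * rootT k ^ (j ^ 2 + 2 * j)) • jonesWenzl k j := by
  induction j with
  | zero =>
    rw [caps_zero, cups_zero]
    refine (congrArg _ leftCurl_unit).trans ((Category.comp_id _).trans ?_)
    simp
  | succ j ih =>
    rw [leftCurl_succ, Linear.comp_smul, ← Category.assoc, jonesWenzl_comp_leftCross j (by omega),
      Linear.smul_comp, ← Category.assoc,
      jonesWenzl_comp_addStrand_eq_smul (by omega) (ih (by omega)), Linear.smul_comp,
      jonesWenzl_comp_rightCross j (by omega), smul_smul, smul_smul, smul_smul]
    congr 1
    ring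

/-- The hook with `a` strands to its left and `b` strands to its right. -/
def hookAt (k a b : ℕ) : strands k (a + 2 + b) ⟶ strands k (a + 2 + b) := hook k a ▷ strands k b

theorem hookAt_zero (a : ℕ) : hookAt k a 0 = hook k a :=
  (whiskerRight_id (hook k a)).trans ((Category.id_comp _).trans (Category.comp_id _))

theorem hookAt_succ (a b : ℕ) : hookAt k a (b + 1) = addStrand (hookAt k a b) :=
  (whiskerRight_tensor (hook k a) (strands k b) (strands k 1)).trans
    ((Category.id_comp _).trans (Category.comp_id _))

theorem jonesWenzl_comp_hookAt (a b : ℕ) (h : a + 2 + b ≤ k + 1) :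
    jonesWenzl k (a + 2 + b) ≫ hookAt k a b = 0 := by
  induction b with
  | zero =>
    rw [hookAt_zero]
    exact jonesWenzl_comp_hook a (by omega)
  | succ b ih =>
    have killed : jonesWenzl k (a + 2 + b) ≫ hookAt k a b = (0 : ℂ) • jonesWenzl k (a + 2 + b) :=
      (ih (by omega)).trans (zero_smul ℂ _).symm
    exact (congrArg (_ ≫ ·) (hookAt_succ a b)).trans
      ((jonesWenzl_comp_addStrand_eq_smul (by omega) killed).trans (zero_smul ℂ _))

/-- `g` is one of the generating hooks of the Temperley–Lieb algebra on `n` strands. -/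
def IsHook {n : ℕ} (g : strands k n ⟶ strands k n) : Prop :=
  ∃ a b, a + 2 + b = n ∧ g ≍ hookAt k a b

theorem isHook_hook (n : ℕ) : IsHook (hook k n) := ⟨n, 0, rfl, heq_of_eq (hookAt_zero n).symm⟩

theorem IsHook.addStrand {n : ℕ} {g : strands k n ⟶ strands k n} (hg : IsHook g) :
    IsHook (addStrand g) := by
  obtain ⟨a, b, rfl, hg⟩ := hg
  obtain rfl := eq_of_heq hg
  exact ⟨a, b + 1, rfl, heq_of_eq (hookAt_succ a b).symm⟩

theorem IsHook.jonesWenzl_comp {n : ℕ} (hn : n ≤ k + 1) {g : strands k n ⟶ strands k n}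
    (hg : IsHook g) : jonesWenzl k n ≫ g = 0 := by
  obtain ⟨a, b, rfl, hg⟩ := hg
  rw [eq_of_heq hg]
  exact jonesWenzl_comp_hookAt a b hn

theorem isMate_caps_two : IsMate (caps k 2) (cap k ≫ cup k) (cap k ≫ cup k) := by
  have caps_two : caps k 2 = nestEv (cap k) (cap k) :=
    eq_of_heq (((heq_of_eq (caps_succ 1)).trans
      (((isTransport_renumber_inv 1 1).whiskerLeft _).comp_heq _)).trans
        (heq_of_eq (congrArg (nestEv (cap k)) caps_one)))
  rw [caps_two]
  exact isMate_nestEv_of_zigzag zigzag₁ zigzag₂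

theorem isMate_hook (a : ℕ) : IsMate (caps k (a + 2)) (hook k a)
    ((renumber k 2 a).inv ≫ (cap k ≫ cup k) ▷ strands k a ≫ (renumber k 2 a).hom) := by
  rw [caps_add]
  exact (isMate_caps_two.nestEv_inner (caps k a)).conj (renumber k 2 a)

theorem IsHook.exists_mate {n : ℕ} {g : strands k n ⟶ strands k n} (hg : IsHook g) :
    ∃ h, IsHook h ∧ IsMate (caps k n) g h := by
  obtain ⟨a, b, rfl, hg⟩ := hg
  obtain rfl := eq_of_heq hg
  have mate := ((isMate_hook (k := k) a).nestEv_outer (caps k b)).conj (renumber k b (a + 2))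
  rw [← caps_add (a + 2) b] at mate
  refine ⟨_, ⟨b, a, by omega, ?_⟩, mate⟩
  refine ((isTransport_renumber_inv b (a + 2)).conj_heq (isTransport_renumber_hom _ _) _).trans ?_
  have unfold_hookAt : hookAt k b a ≍ strands k b ◁ (cap k ≫ cup k) ▷ strands k a :=
    (heq_of_eq (whisker_assoc (strands k b) (cap k ≫ cup k) (strands k a))).trans
      ((IsTransport.associator_hom _ _ _).conj_heq (IsTransport.associator_inv _ _ _) _)
  refine HEq.trans (heq_of_eq ?_) ((((isTransport_renumber_inv 2 a).whiskerLeft _).conj_heq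
    ((isTransport_renumber_hom 2 a).whiskerLeft _) _).trans unfold_hookAt.symm)
  exact (MonoidalCategory.whiskerLeft_comp _ _ _).trans
    (congrArg (_ ≫ ·) (MonoidalCategory.whiskerLeft_comp _ _ _))

theorem jonesWenzl_whiskerRight_comp {n : ℕ} {W V : PreTL k} (w : strands k n ⊗ W ⟶ V)
    (hw : ∀ g : strands k n ⟶ strands k n, IsHook g → g ▷ W ≫ w = 0) :
    jonesWenzl k n ▷ W ≫ w = w := by
  induction n using Nat.twoStepInduction generalizing W with
  | zero => exact (congrArg (· ≫ w) (id_whiskerRight _ _)).trans (Category.id_comp w)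
  | one => exact (congrArg (· ≫ w) (id_whiskerRight _ _)).trans (Category.id_comp w)
  | more n _ ih =>
    have slide (f : strands k (n + 1) ⟶ strands k (n + 1)) :
        f ▷ (strands k 1 ⊗ W) ≫ (α_ (strands k (n + 1)) (strands k 1) W).inv ≫ w =
          (α_ (strands k (n + 1)) (strands k 1) W).inv ≫ addStrand f ▷ W ≫ w :=
      associator_inv_naturality_left_assoc f (strands k 1) W w
    have absorb : addStrand (jonesWenzl k (n + 1)) ▷ W ≫ w = w := by
      have := ih ((α_ (strands k (n + 1)) (strands k 1) W).inv ≫ w) fun g hg =>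
        (slide g).trans ((congrArg (_ ≫ ·) (hw _ hg.addStrand)).trans Limits.comp_zero)
      exact (cancel_epi (α_ (strands k (n + 1)) (strands k 1) W).inv).1 ((slide _).symm.trans this)
    have kill : hook k n ▷ W ≫ w = 0 := hw _ (isHook_hook n)
    rw [jonesWenzl, MonoidalPreadditive.add_whiskerRight, MonoidalLinear.smul_whiskerRight,
      comp_whiskerRight, comp_whiskerRight, Preadditive.add_comp, Linear.smul_comp,
      Category.assoc, Category.assoc, absorb, kill, Limits.comp_zero, smul_zero, add_zero]

theorem jonesWenzl_tensor_caps (n : ℕ) (hn : n ≤ k + 1) :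
    (jonesWenzl k n ⊗ₘ jonesWenzl k n) ≫ caps k n = strands k n ◁ jonesWenzl k n ≫ caps k n := by
  rw [MonoidalCategory.tensorHom_def, Category.assoc]
  refine jonesWenzl_whiskerRight_comp _ fun g hg => ?_
  obtain ⟨h, hh, mate⟩ := hg.exists_mate
  rw [← whisker_exchange_assoc, mate, ← MonoidalCategory.whiskerLeft_comp_assoc,
    hh.jonesWenzl_comp hn, MonoidalPreadditive.whiskerLeft_zero, Limits.zero_comp]

end PreTL

namespace TL

theorem caps_eq_mapEv (j : ℕ) : caps k j = mapEv (Mat_.embedding (PreTL k)) (PreTL.caps k j) :=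
  (mapEv_embedding (PreTL.caps k j)).symm

theorem cups_eq_mapCoev (j : ℕ) :
    cups k j = mapCoev (Mat_.embedding (PreTL k)) (PreTL.cups k j) :=
  (mapCoev_embedding (PreTL.cups k j)).symm

theorem zigzag_cups_caps (j : ℕ) : zigzag (cups k j) (caps k j) = 𝟙 (strands k j) := by
  rw [caps_eq_mapEv, cups_eq_mapCoev]
  refine (map_zigzag _ _ _).symm.trans ?_
  rw [PreTL.zigzag_cups_caps]
  exact (Mat_.embedding (PreTL k)).map_id _

theorem jonesWenzlObj_tensor_caps (j : ℕ) (hj : j ≤ k + 1) :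
    ((jonesWenzlObj k j hj).p ⊗ₘ (jonesWenzlObj k j hj).p) ≫ caps k j =
      strands k j ◁ (jonesWenzlObj k j hj).p ≫ caps k j := by
  rw [caps_eq_mapEv]
  have h := congrArg (mapEv (Mat_.embedding (PreTL k))) (PreTL.jonesWenzl_tensor_caps j hj)
  rw [← tensorHom_comp_mapEv, ← whiskerLeft_comp_mapEv] at h
  exact h

theorem jonesWenzlObj_comp_leftCurl (j : ℕ) (hj : j ≤ k + 1) :
    (jonesWenzlObj k j hj).p ≫ leftCurl (caps k j) (cups k j) =
      ((-1) ^ j * rootT k ^ (j ^ 2 + 2 * j)) • (jonesWenzlObj k j hj).p := by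
  rw [caps_eq_mapEv, cups_eq_mapCoev]
  have h := congrArg (Mat_.embedding (PreTL k)).map (PreTL.jonesWenzl_comp_leftCurl j hj)
  rw [Functor.map_comp, map_leftCurl, Functor.map_smul] at h
  exact h

theorem zigzag_coev_ev (j : ℕ) (hj : j ≤ k + 1) :
    zigzag (coev k j hj) (ev k j hj) = 𝟙 (jonesWenzlObj k j hj) := by
  have compressed :=
    zigzag_compress (P := jonesWenzlObj k j hj) (cups k j) (jonesWenzlObj_tensor_caps j hj)
  have straight : (jonesWenzlObj k j hj).p ≫ zigzag (cups k j) (caps k j) =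
      (1 : ℂ) • (jonesWenzlObj k j hj).p :=
    (congrArg (_ ≫ ·) (zigzag_cups_caps j)).trans
      ((Category.comp_id _).trans (one_smul ℂ _).symm)
  exact (compressed.trans (compress_eq_smul straight)).trans (one_smul _ _)

theorem leftCurl_ev_coev (j : ℕ) (hj : j ≤ k + 1) :
    leftCurl (ev k j hj) (coev k j hj) =
      ((-1) ^ j * rootT k ^ (j ^ 2 + 2 * j)) • 𝟙 (jonesWenzlObj k j hj) :=
  (leftCurl_compress (P := jonesWenzlObj k j hj) (cups k j) (jonesWenzlObj_tensor_caps j hj)).trans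
    (compress_eq_smul (jonesWenzlObj_comp_leftCurl j hj))

end TL

namespace ReducedTL

theorem zigzag_coev_ev (j : ℕ) (hj : j ≤ k + 1) :
    zigzag (coev k j hj) (ev k j hj) = 𝟙 (jonesWenzlObj k j hj) :=
  (zigzag_toQuot _ _ _).trans (congrArg (proj k).map (TL.zigzag_coev_ev j hj))

theorem leftCurl_ev_coev (j : ℕ) (hj : j ≤ k + 1) :
    leftCurl (ev k j hj) (coev k j hj) =
      ((-1) ^ j * rootT k ^ (j ^ 2 + 2 * j)) • 𝟙 (jonesWenzlObj k j hj) :=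
  (leftCurl_toQuot _ _ _).trans (congrArg (proj k).map (TL.leftCurl_ev_coev j hj))

end ReducedTL

end

end TLJ

theorem lemma3p19 (k : ℕ) (hk : 1 ≤ k) (j : ℕ) (hj : j ≤ k + 1) :
    TLJ.leftTwist (TLJ.ReducedTL.ev k j hj) (TLJ.ReducedTL.coev k j hj) (Iso.refl _) =
        ((-1) ^ j * TLJ.rootT k ^ (j ^ 2 + 2 * j)) • 𝟙 (TLJ.ReducedTL.jonesWenzlObj k j hj) ∧
      TLJ.rightTwist (TLJ.ReducedTL.ev k j hj) (TLJ.ReducedTL.coev k j hj) (Iso.refl _) =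
        ((-1) ^ j * TLJ.rootT k ^ (j ^ 2 + 2 * j)) • 𝟙 (TLJ.ReducedTL.jonesWenzlObj k j hj) := by
  have left_curl := TLJ.ReducedTL.leftCurl_ev_coev j hj
  refine ⟨(TLJ.leftTwist_refl _ _).trans left_curl, (TLJ.rightTwist_refl _ _).trans ?_⟩
  exact TLJ.rightCurl_eq_smul_id (TLJ.ReducedTL.zigzag_coev_ev j hj) left_curl
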